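/- Let $\Gamma$ be the free group freely generated by a finite set $S$, with word length $|\cdot|$ with respect to $S\cup S^{-1}$, and let $B_n$ and $S_n$ be the closed ball and the sphere of radius $n$ about the identity $e$ (so $B_0=\{e\}$). Fix a total order on the letters $S\cup S^{-1}$ and order $\Gamma$ length-lexicographically: $g$ precedes $h$ if $|g|<|h|$, or if $|g|=|h|$ and, at the first place from the left where the reduced words of $g$ and $h$ differ, the letter of $g$ precedes that of $h$. Let $P(g)$ be the finite set of strict predecessors of $g$ (so $P(e)=\emptyset$). Let $k\ge 1$ and let $\phi:\Gamma\to \mathrm{M}_k(\mathbb{C})$ be positive definite, that is, $\sum_{g,h\in\Gamma,\,1\le i,j\le k}\overline{a_{i,h}}\,a_{j,g}\,\phi_{ij}(h^{-1}g)\ge 0$ for all finitely supported families $(a_{i,g})$ of complex numbers. *Log-determinant entropies.* For a linear map $T$ from a finite-dimensional complex inner product space to a complex inner product space put $\mathrm{H}(T):=\log|\det T|$, where $|\det T|$ is computed in orthonormal bases of the domain and of the range if $T$ is injective and $|\det T|:=0$ otherwise ($\log 0=-\infty$); equivalently $\mathrm{H}(T)=\tfrac12\log\det(T^*T)$. For a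 finite-dimensional subspace $L$ put $\mathrm{H}(T\mid L):=\mathrm{H}(P_L^\perp T)$, with $P_L^\perp$ the orthogonal projection onto $L^\perp$. For finite $E,F\subset\Gamma$ let $(v_{g,i})_{g\in E\cup F,\,1\le i\le k}$ be vectors in an inner product space with Gram matrix $[\phi(g^{-1}h)]_{g,h\in E\cup F}$, and let $H(E):=\mathrm{H}(T_E)$ and $H(E\mid F):=\mathrm{H}(T_E\mid \operatorname{ran}T_F)$, where $T_E,T_F$ are the maps given by the tuples $(v_{g,i})_{g\in E,i}$ and $(v_{g,i})_{g\in F,i}$; these values do not depend on the choice of the vectors. Write $H(g\mid F)$ for $H(\{g\}\mid F)$. *Annealed entropy.* For each $n$ let $\pi_n$ be the random representation of $\Gamma$ on $\mathbb{C}^n$ for which the unitary matrices $\pi_n(s)$, $s\in S$, are independent and distributed according to the Haar probability measure of $\mathrm{U}(n)$. For a set $O$ of maps $\Gamma\to\mathrm{M}_k(\mathbb{C})$ let $\mathcal{X}(\pi_n,O)$ be the set of $k$-tuples $(v_1,\dots,v_k)$ of vectors in $\mathbb{C}^n$ such that the map $g\mapsto[\langle\pi_n(g)v_j,v_i\rangle]_{i,j=1}^k$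 lies in $O$. Let $$\mathrm{h}^{\mathrm{ann}}(\phi):=\inf_O\limsup_{n\to\infty}\frac1n\log\mathbf{E}\,\frac{\mathrm{vol}_{2kn}\,\mathcal{X}(\pi_n,O)}{v(n)^k},\qquad v(n)=\frac{\pi^n}{n!},$$ where $O$ runs over the open neighbourhoods of $\phi$ in the topology of pointwise convergence. **Claim.** For every reduced word $s_{n+1}\cdots s_1$ in $S\cup S^{-1}$ with $n\ge 0$, $$H(s_{n+1}\cdots s_1\mid P(s_{n+1}\cdots s_1))\le H(s_n\cdots s_1\mid P(s_n\cdots s_1))$$ (for $n=0$ the word $s_n\cdots s_1$ is $e$), and $$\mathrm{h}^{\mathrm{ann}}(\phi)=2H(B_0)-\sum_{n=0}^\infty\ \sum_{s_{n+1}\cdots s_1\in S_{n+1}}\Big(H(s_n\cdots s_1\mid P(s_n\cdots s_1))-H(s_{n+1}\cdots s_1\mid P(s_{n+1}\cdots s_1))\Big).$$ Here all quantities take values in $[-\infty,\infty]$, a difference whose second member is $-\infty$ is read as $+\infty$, all terms of the series are non-negative, and the series is summable in $[0,\infty]$. In particular $\mathrm{h}^{\mathrm{ann}}(\phi)=-\infty$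 if one of the entropies that occur is $-\infty$. -/

import Mathlib

open MeasureTheory Filter Topology
open scoped ENNReal ComplexOrder MatrixOrder

noncomputable section

namespace AnnealedEntropy

/-! ### Geometry of the free group on `S` (left Cayley graph) -/

section FreeGroupGeometry

variable {S : Type*} [Fintype S] [DecidableEq S]

theorem finite_norm_le (n : ℕ) : {g : FreeGroup S | g.norm ≤ n}.Finite :=
  Set.Finite.of_finite_image
    ((List.finite_length_le (S × Bool) n).subset (by
      rintro _ ⟨g, hg, rfl⟩
      exact hg))
    (FreeGroup.toWord_injective.injOn)

/-- The closed ball `B_n` around the identity for the word length. -/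
def ball (n : ℕ) : Finset (FreeGroup S) := (finite_norm_le n).toFinset

/-- The sphere `S_n` around the identity for the word length. -/
def sphere (n : ℕ) : Finset (FreeGroup S) := (ball n).filter fun g => g.norm = n

/-- The set `P(g)` of elements that strictly precede `g` in the length-lexicographic ordering of
the free group determined by a strict total order `r` on the letters. The letter `(s, true)` is the
generator `s`, the letter `(s, false)` is its inverse; elements are compared first by length, and
then by the first letter, from the left, at which their reduced words differ. (A predecessor of `g`
has length at most `|g|`, hence lies in the finite set `ball g.norm`.) -/
def predecessors (r : S × Bool → S × Bool → Prop) (g : FreeGroup S) : Finset (FreeGroup S) :=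
  open Classical in (ball g.norm).filter fun h => List.Shortlex r h.toWord g.toWord

/-- For `g = s_{n+1} s_n ⋯ s_1` in reduced form, the element `s_n ⋯ s_1`, obtained by deleting the
leftmost letter. -/
def deleteFirst (g : FreeGroup S) : FreeGroup S := FreeGroup.mk g.toWord.tail

end FreeGroupGeometry

/-! ### Log-determinant entropy -/

section LogDet

variable {K H : Type*} [NormedAddCommGroup K] [InnerProductSpace ℂ K] [FiniteDimensional ℂ K]
  [NormedAddCommGroup H] [InnerProductSpace ℂ H]

/-- `H(T) = log |det T|` with `log 0 = -∞`. Here `|det T|` is computed with respect to orthonormal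
bases of `K` and of the range of `T` if `T` is injective, and is `0` otherwise. -/
def logDetEntropy (T : K →ₗ[ℂ] H) : EReal := ENNReal.log (ENNReal.ofReal T.normDet)

/-- `H(T | L) = H(P_L^⊥ T)`, where `P_L^⊥ = I - P_L` is the orthogonal projection onto the
orthogonal complement of `L`. -/
def condLogDetEntropy (T : K →ₗ[ℂ] H) (L : Submodule ℂ H) [L.HasOrthogonalProjection] : EReal :=
  logDetEntropy ((LinearMap.id - (L.starProjection : H →ₗ[ℂ] H)) ∘ₗ T)

/-- A finite tuple of vectors, regarded as the linear map `x ↦ ∑ i, x i • w i`. -/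
def tupleMap {ι : Type*} [Fintype ι] (w : ι → H) : EuclideanSpace ℂ ι →ₗ[ℂ] H :=
  Fintype.linearCombination ℂ w ∘ₗ (WithLp.linearEquiv 2 ℂ (ι → ℂ)).toLinearMap

end LogDet

/-! ### Positive definite maps and their entropies -/

section PositiveDefinite

variable {Γ : Type*} [Group Γ] {k : ℕ}

/-- `φ : Γ → M_k` is positive definite:
`∑_{h,g,i,j} conj (a_{i,h}) φ_{ij}(h⁻¹ g) a_{j,g} ≥ 0` for all finitely supported `a`.
(Such a map is automatically bounded.) -/
def IsPositiveDefinite (φ : Γ → Matrix (Fin k) (Fin k) ℂ) : Prop :=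
  (Matrix.of fun p q : Γ × Fin k => φ (p.1⁻¹ * q.1) p.2 q.2).PosSemidef

/-- The `F`-by-`F` block matrix `φ[F] = [φ(g⁻¹ h)]_{g,h ∈ F}`. -/
def blockMatrix (φ : Γ → Matrix (Fin k) (Fin k) ℂ) (F : Finset Γ) :
    Matrix (F × Fin k) (F × Fin k) ℂ :=
  Matrix.of fun p q => φ ((p.1 : Γ)⁻¹ * q.1) p.2 q.2

theorem blockMatrix_posSemidef {φ : Γ → Matrix (Fin k) (Fin k) ℂ} (hφ : IsPositiveDefinite φ)
    (F : Finset Γ) : (blockMatrix φ F).PosSemidef :=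
  Matrix.PosSemidef.submatrix hφ (fun p : F × Fin k => ((p.1 : Γ), p.2))

variable [DecidableEq Γ]

/-- A tuple of vectors, indexed by `F × Fin k`, whose Gram matrix is `φ[F]`: the columns of the
square root of `φ[F]`. -/
def gramTuple (φ : Γ → Matrix (Fin k) (Fin k) ℂ) (F : Finset Γ) :
    F × Fin k → EuclideanSpace ℂ (F × Fin k) :=
  fun q => WithLp.toLp 2 fun p => CFC.sqrt (blockMatrix φ F) p q

theorem gram_gramTuple {φ : Γ → Matrix (Fin k) (Fin k) ℂ} (hφ : IsPositiveDefinite φ)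
    (F : Finset Γ) : Matrix.gram ℂ (gramTuple φ F) = blockMatrix φ F := by
  have h0 : 0 ≤ blockMatrix φ F := (blockMatrix_posSemidef hφ F).nonneg
  have h1 : (CFC.sqrt (blockMatrix φ F)).IsHermitian := 
    (Matrix.nonneg_iff_posSemidef.mp (CFC.sqrt_nonneg (blockMatrix φ F))).isHermitian
  conv_rhs => rw [← CFC.sqrt_mul_sqrt_self (blockMatrix φ F) h0]
  ext p q
  rw [Matrix.gram_apply, Matrix.mul_apply]
  simp only [gramTuple, PiLp.inner_apply, RCLike.inner_apply]
  refine Finset.sum_congr rfl fun x _ => ?_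
  rw [mul_comm]
  congr 1
  exact h1.apply p x

/-- `H_φ(F)`: the log-determinant entropy of a tuple with Gram matrix `φ[F]`. -/
def entropy (φ : Γ → Matrix (Fin k) (Fin k) ℂ) (F : Finset Γ) : EReal :=
  logDetEntropy (tupleMap (gramTuple φ F))

/-- `H_φ(E | F)`: for a tuple `T` with Gram matrix `φ[E ∪ F]`, the conditional log-determinant
entropy of the sub-tuple indexed by `E` given the span of the sub-tuple indexed by `F`. -/
def condEntropy (φ : Γ → Matrix (Fin k) (Fin k) ℂ) (E F : Finset Γ) : EReal :=
  condLogDetEntropy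
    (tupleMap fun p : E × Fin k =>
      gramTuple φ (E ∪ F) (⟨p.1, Finset.mem_union_left F p.1.2⟩, p.2))
    (Submodule.span ℂ (Set.range fun p : F × Fin k =>
      gramTuple φ (E ∪ F) (⟨p.1, Finset.mem_union_right E p.1.2⟩, p.2)))

/-- The difference `a - b`, with the convention that it is `+∞` whenever `b = -∞`
(also when `a = -∞`). -/
def entropyDiff (a b : EReal) : EReal := open Classical in if b = ⊥ then ⊤ else a - b

end PositiveDefinite

/-! ### Annealed almost periodic entropy of the uniformly random representations -/

section Unitary

/-- The Borel sigma-algebra of the unitary group `U(n)`. -/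
instance unitaryMeasurableSpace (n : ℕ) : MeasurableSpace (Matrix.unitaryGroup (Fin n) ℂ) :=
  borel _

instance unitaryBorelSpace (n : ℕ) : BorelSpace (Matrix.unitaryGroup (Fin n) ℂ) := ⟨rfl⟩

instance unitaryCompactSpace (n : ℕ) : CompactSpace (Matrix.unitaryGroup (Fin n) ℂ) := by
  have hc : IsClosed {A : Matrix (Fin n) (Fin n) ℂ | A ∈ Matrix.unitaryGroup (Fin n) ℂ} := by
    simp only [Matrix.mem_unitaryGroup_iff]
    exact isClosed_eq (by fun_prop) continuous_const
  have hK : IsCompact (Set.univ.pi fun _ : Fin n => Set.univ.pi fun _ : Fin n =>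
      Metric.closedBall (0 : ℂ) 1) :=
    isCompact_univ_pi fun _ => isCompact_univ_pi fun _ => isCompact_closedBall _ _
  refine isCompact_iff_compactSpace.mp (IsCompact.of_isClosed_subset hK hc ?_)
  exact fun A hA i _ j _ => mem_closedBall_zero_iff.mpr (entry_norm_bound_of_unitary hA i j)

/-- The Haar probability measure on `U(n)`. -/
def unitaryHaar (n : ℕ) : Measure (Matrix.unitaryGroup (Fin n) ℂ) :=
  Measure.haarMeasure ⊤

theorem unitaryHaar_univ (n : ℕ) : unitaryHaar n Set.univ = 1 :=
  Measure.haarMeasure_self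

variable {k n : ℕ}

/-- The type of the `k`-tuple `v` of vectors in `ℂⁿ` under a unitary representation `π` of `Γ`:
the map `g ↦ [⟨π(g) v_j, v_i⟩]_{i,j}`, where `⟨x, y⟩ = ∑ x_a * conj y_a`. -/
def typeMap {Γ : Type*} [Group Γ] (π : Γ →* Matrix.unitaryGroup (Fin n) ℂ)
    (v : Fin k → Fin n → ℂ) (g : Γ) : Matrix (Fin k) (Fin k) ℂ :=
  Matrix.of fun i j => star (v i) ⬝ᵥ (π g : Matrix (Fin n) (Fin n) ℂ).mulVec (v j)

/-- The set `𝒳(π, O)` of `O`-typical `k`-tuples of vectors. -/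
def typical {Γ : Type*} [Group Γ] (π : Γ →* Matrix.unitaryGroup (Fin n) ℂ)
    (O : Set (Γ → Matrix (Fin k) (Fin k) ℂ)) : Set (Fin k → Fin n → ℂ) :=
  {v | typeMap π v ∈ O}

/-- The volume `πⁿ / n!` of the unit ball in `ℂⁿ`. -/
def ballVolume (n : ℕ) : ℝ≥0∞ := ENNReal.ofReal (Real.pi ^ n / n.factorial)

variable {S : Type*} [Fintype S]

/-- The expected normalized volume of the set of `O`-typical tuples, when the generators of the
free group on `S` are sent to independent Haar-distributed random elements of `U(n)`. -/
def expectedVolume (n : ℕ) (O : Set (FreeGroup S → Matrix (Fin k) (Fin k) ℂ)) : ℝ≥0∞ :=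
  ∫⁻ u : S → Matrix.unitaryGroup (Fin n) ℂ,
    volume (typical (FreeGroup.lift u) O) / ballVolume n ^ k
      ∂(Measure.pi fun _ : S => unitaryHaar n)

/-- The annealed almost periodic entropy
`h^ann(φ) = inf_O limsup_n (1/n) log E [vol_{2kn} 𝒳(π_n, O) / v(n)^k]`, where `O` runs over the
open neighbourhoods of `φ` for pointwise convergence. (The expression is monotone in `O`, and on
positive definite maps the topology of pointwise convergence agrees with the weak-star topology.) -/
def annealedEntropy (φ : FreeGroup S → Matrix (Fin k) (Fin k) ℂ) : EReal :=
  ⨅ (O : Set (FreeGroup S → Matrix (Fin k) (Fin k) ℂ)) (_ : IsOpen O) (_ : φ ∈ O),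
    limsup (fun n : ℕ => ENNReal.log (expectedVolume n O) / (n : EReal)) atTop

end Unitary

/-! ### The terms of the expansion -/

/-- The term `H_φ(s_n ⋯ s_1 | P(s_n ⋯ s_1)) - H_φ(s_{n+1} ⋯ s_1 | P(s_{n+1} ⋯ s_1))` attached to the
group element `g = s_{n+1} ⋯ s_1`. -/
def sewardTerm {S : Type*} [Fintype S] [DecidableEq S] {k : ℕ} (r : S × Bool → S × Bool → Prop)
    (φ : FreeGroup S → Matrix (Fin k) (Fin k) ℂ) (g : FreeGroup S) : EReal :=
  entropyDiff (condEntropy φ {deleteFirst g} (predecessors r (deleteFirst g)))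
    (condEntropy φ {g} (predecessors r g))

end AnnealedEntropy

end

open MeasureTheory Filter Topology
open scoped ENNReal ComplexOrder MatrixOrder

noncomputable section

namespace AnnealedEntropy
set_option linter.unusedSectionVars false

/-! ### Gram determinants, orthogonal residuals and Schur complements -/

section GramResidual

open Matrix

/-! All entropies are halves of logarithms of Gram determinants (`entropy_eq`, `condEntropy_eq`).
Schur complements give the chain rule `gramDet_union`, and conditional determinants are invariant
under left translation and decrease when the conditioning set grows (`condGramDet_le`). The
inequality of the claim is an instance: left multiplication by the deleted letter carries the
predecessors of `deleteFirst g` into the predecessors of `g`.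

For the formula, join `h` to `s h`, which makes the free group a tree, and let `F` be a finite
subtree containing the identity, with `F_s = F ∩ s⁻¹F` the sources of its `s`-edges. For small
neighbourhoods given by the entries of `φ[F]` the expected normalized volume behaves like `exp(n
R(F))`, where `R(F) = log det φ[F] - ∑_s log det φ[F_s]` is `windowRate`. To see this, thicken a
typical tuple to the families `X = (X_g)` on `F` that are equivariant up to `ε` along each edge. The
increments along the tree are volume-preserving coordinates, so thickening multiplies the volume by
an explicit product of ball volumes. By Fubini the expected thickened volume is the integral, over
`X` with Gram matrix near `φ[F]`, of the product over `s` of the Haar probabilities that `u_s` moves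
the edge sources to within `ε` of the edge targets. The domain has volume about `det φ[F]^n
v(n)^{k|F|}`, and each probability is about `ε^{2nk|F_s|} / det φ[F_s]^n`. The powers of `ε` cancel
because a tree has one edge fewer than it has vertices.

The upper bound is `exists_expectedVolume_mul_le`, the lower bound `eventually_le_expectedVolume`.
The lower bound needs a correction: in high dimension a displacement of length `ε` is typically
almost orthogonal to any given vectors and adds `ε²` to the diagonal of the Gram matrix. The targets
must therefore have a slightly larger Gram matrix than the sources, and `inflatedBlock` arranges
this along all edges at once.

If every `φ[F]` is nonsingular, the annealed entropy is the infimum of `R(B_n)`. Strong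
subadditivity gives `R(B_{n+1}) ≤ b_n ≤ R(B_n)` for `2 b_n = log det φ[B_{n+1}] - (2|S| - 1) log det
φ[B_n]`, and the chain rule along the order shows that `log det φ[{e}] - b_N` is a partial sum of
the series. Otherwise take the first `g` whose residual determinant given `P(g)` vanishes. The
window `P(g) ∪ {g}` is singular while its edge windows are not, so the annealed entropy is `-∞`. On
the other side, the term of `g` is `+∞`, or `H(B_0) = -∞` when `g = e`. -/

theorem exists_conjTranspose_mul_self_eq {n : Type*} [Fintype n] [DecidableEq n]
    {A : Matrix n n ℂ} (hA : A.PosSemidef) : ∃ S : Matrix n n ℂ, S.PosSemidef ∧ Sᴴ * S = A := by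
  have h0 : 0 ≤ A := hA.nonneg
  have h1 := Matrix.nonneg_iff_posSemidef.mp (CFC.sqrt_nonneg A)
  exact ⟨CFC.sqrt A, h1, by rw [h1.isHermitian.eq, CFC.sqrt_mul_sqrt_self A h0]⟩

theorem one_le_det_one_add {n : Type*} [Fintype n] [DecidableEq n]
    {P : Matrix n n ℂ} (hP : P.PosSemidef) : 1 ≤ (1 + P).det := by
  have h : (1 + P).IsHermitian := isHermitian_one.add hP.isHermitian
  have key : ∀ i, 1 ≤ h.eigenvalues i := by
    intro i
    have hv : star (⇑(h.eigenvectorBasis i)) ⬝ᵥ ⇑(h.eigenvectorBasis i) = 1 := by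
      have := orthonormal_iff_ite.mp h.eigenvectorBasis.orthonormal i i
      rw [EuclideanSpace.inner_eq_star_dotProduct] at this
      rw [dotProduct_comm]
      simpa using this
    rw [h.eigenvalues_eq, add_mulVec, dotProduct_add, one_mulVec, hv]
    have := hP.re_dotProduct_nonneg (⇑(h.eigenvectorBasis i))
    simp only [map_add, RCLike.one_re]
    linarith
  rw [h.det_eq_prod_eigenvalues]
  have : (1 : ℝ) ≤ ∏ i, h.eigenvalues i := by
    simpa using Finset.prod_le_prod (s := Finset.univ) (f := fun _ : n => (1 : ℝ))
      (fun _ _ => zero_le_one) fun i _ => key i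
  simpa [← Complex.ofReal_prod] using Complex.real_le_real.mpr this

/-- Conjugation by `A^{-1/2}` reduces the comparison to `1 + P` with `P ≥ 0`, whose eigenvalues are
all at least one. A singular `A` is trivial since `B` is then a sum of positive semidefinite
matrices. -/
theorem det_le_det_of_posSemidef_sub {n : Type*} [Fintype n] [DecidableEq n]
    {A B : Matrix n n ℂ} (hA : A.PosSemidef) (hAB : (B - A).PosSemidef) : A.det ≤ B.det := by
  by_cases h0 : A.det = 0
  · rw [h0]
    have : B = A + (B - A) := by abel
    rw [this]
    exact (hA.add hAB).det_nonneg
  obtain ⟨S, hS, hSA⟩ := exists_conjTranspose_mul_self_eq hA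
  have hdet : star S.det * S.det = A.det := by rw [← hSA, det_mul, det_conjTranspose]
  have hu : IsUnit S.det := by
    rw [isUnit_iff_ne_zero]
    rintro h
    rw [h, mul_zero] at hdet
    exact h0 hdet.symm
  have hP : (S⁻¹ᴴ * (B - A) * S⁻¹).PosSemidef := hAB.conjTranspose_mul_mul_same _
  have hB : B = Sᴴ * (1 + S⁻¹ᴴ * (B - A) * S⁻¹) * S := by
    have h1 : S⁻¹ * S = 1 := nonsing_inv_mul _ hu
    have h2 : Sᴴ * S⁻¹ᴴ = 1 := by rw [← conjTranspose_mul, h1, conjTranspose_one]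
    calc B = Sᴴ * S + (Sᴴ * S⁻¹ᴴ) * (B - A) * (S⁻¹ * S) := by rw [h1, h2, hSA]; simp
      _ = _ := by noncomm_ring
  rw [hB, det_mul, det_mul, det_conjTranspose, mul_right_comm, hdet]
  exact le_mul_of_one_le_right hA.det_nonneg (one_le_det_one_add hP)

variable {H H' : Type*} [NormedAddCommGroup H] [InnerProductSpace ℂ H]
  [NormedAddCommGroup H'] [InnerProductSpace ℂ H']

theorem norm_sum_smul_eq_of_gram_eq {ι : Type*} [Fintype ι] {u : ι → H} {u' : ι → H'}
    (h : gram ℂ u = gram ℂ u') (c : ι → ℂ) : ‖∑ i, c i • u i‖ = ‖∑ i, c i • u' i‖ := by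
  have h1 := star_dotProduct_gram_mulVec u c c
  have h2 := star_dotProduct_gram_mulVec u' c c
  rw [h, h2] at h1
  rw [@norm_eq_sqrt_re_inner ℂ, @norm_eq_sqrt_re_inner ℂ _ _ _ _ (∑ i, c i • u' i), h1]

variable [FiniteDimensional ℂ H] [FiniteDimensional ℂ H']

/-- The components of the vectors `w i` orthogonal to the span of the vectors `v j`. -/
def residual {ι κ : Type*} [Fintype κ] (w : ι → H) (v : κ → H) (i : ι) : H :=
  w i - (Submodule.span ℂ (Set.range v)).starProjection (w i)

variable {ι κ κ' : Type*} [Fintype ι] [Fintype κ] [Fintype κ']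

theorem sum_smul_residual (w : ι → H) (v : κ → H) (x : ι → ℂ) :
    ∑ i, x i • residual w v i =
      ∑ i, x i • w i - (Submodule.span ℂ (Set.range v)).starProjection (∑ i, x i • w i) := by
  simp only [residual, smul_sub, Finset.sum_sub_distrib, map_sum, map_smul]

/-- A residual norm is a distance to a span. The minimizing combination of the `v'` has the same
coefficients available among the `v`, and equal Gram matrices give equal norms, so the distance for
`v` can only be smaller. The two families may live in different spaces. -/
theorem norm_sum_smul_residual_le {w : ι → H} {v : κ → H} {w' : ι → H'} {v' : κ' → H'}
    (f : κ' → κ) (h : gram ℂ (Sum.elim w (v ∘ f)) = gram ℂ (Sum.elim w' v')) (x : ι → ℂ) :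
    ‖∑ i, x i • residual w v i‖ ≤ ‖∑ i, x i • residual w' v' i‖ := by
  rw [sum_smul_residual, sum_smul_residual]
  obtain ⟨y, hy⟩ := (Submodule.mem_span_range_iff_exists_fun ℂ).mp
    ((Submodule.span ℂ (Set.range v')).starProjection_apply_mem (∑ i, x i • w' i))
  have hmem : ∑ j, y j • v (f j) ∈ Submodule.span ℂ (Set.range v) :=
    Submodule.sum_mem _ fun j _ => Submodule.smul_mem _ _ (Submodule.subset_span ⟨f j, rfl⟩)
  have h1 : ‖∑ i, x i • w i - ∑ j, y j • v (f j)‖ = ‖∑ i, x i • w' i - ∑ j, y j • v' j‖ := by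
    have := norm_sum_smul_eq_of_gram_eq h (Sum.elim x (fun j => - y j))
    simpa [sub_eq_add_neg] using this
  rw [← hy, ← h1, Submodule.starProjection_minimal]
  exact ciInf_le ⟨0, by rintro _ ⟨_, rfl⟩; exact norm_nonneg _⟩
    (⟨_, hmem⟩ : Submodule.span ℂ (Set.range v))

theorem posSemidef_gram_sub_gram {u : ι → H} {u' : ι → H'}
    (h : ∀ x : ι → ℂ, ‖∑ i, x i • u i‖ ≤ ‖∑ i, x i • u' i‖) :
    (gram ℂ u' - gram ℂ u).PosSemidef := by
  refine .of_dotProduct_mulVec_nonneg ((isHermitian_gram ℂ u').sub (isHermitian_gram ℂ u)) fun x => ?_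
  rw [sub_mulVec, dotProduct_sub, star_dotProduct_gram_mulVec, star_dotProduct_gram_mulVec,
    sub_nonneg, inner_self_eq_norm_sq_to_K, inner_self_eq_norm_sq_to_K]
  have := pow_le_pow_left₀ (norm_nonneg _) (h x) 2
  exact_mod_cast this

theorem det_gram_residual_le {w : ι → H} {v : κ → H} {w' : ι → H'} {v' : κ' → H'} [DecidableEq ι]
    (f : κ' → κ) (h : gram ℂ (Sum.elim w (v ∘ f)) = gram ℂ (Sum.elim w' v')) :
    (gram ℂ (residual w v)).det ≤ (gram ℂ (residual w' v')).det :=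
  det_le_det_of_posSemidef_sub (posSemidef_gram ℂ _)
    (posSemidef_gram_sub_gram (norm_sum_smul_residual_le f h))

theorem gram_sum_smul (u : κ → H) (S : Matrix κ ι ℂ) :
    gram ℂ (fun i => ∑ j, S j i • u j) = Sᴴ * gram ℂ u * S := by
  ext i j
  rw [gram_apply, ← star_dotProduct_gram_mulVec, Matrix.mul_assoc, mul_apply, dotProduct]
  refine Finset.sum_congr rfl fun a _ => ?_
  simp [mulVec, dotProduct, mul_apply]

/-- This is the Schur complement formula. Subtracting the projections is a block unipotent column
operation, after which the Gram matrix is block diagonal. -/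
theorem det_gram_sumElim [DecidableEq ι] [DecidableEq κ] (w : ι → H) (v : κ → H) :
    (gram ℂ (Sum.elim w v)).det = (gram ℂ (residual w v)).det * (gram ℂ v).det := by
  have hc : ∀ i, ∃ c : κ → ℂ, ∑ j, c j • v j =
      (Submodule.span ℂ (Set.range v)).starProjection (w i) := fun i =>
    (Submodule.mem_span_range_iff_exists_fun ℂ).mp
      ((Submodule.span ℂ (Set.range v)).starProjection_apply_mem (w i))
  choose c hc using hc
  let S : Matrix (ι ⊕ κ) (ι ⊕ κ) ℂ := fromBlocks 1 0 (Matrix.of fun j i => c i j) 1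
  have h1 : gram ℂ (Sum.elim w v) =
      Sᴴ * gram ℂ (Sum.elim (residual w v) v) * S := by
    rw [← gram_sum_smul]
    congr 1
    ext i
    rcases i with i | i
    · simp [S, hc, residual, Matrix.one_apply, ite_smul]
    · simp [S, Matrix.one_apply, ite_smul]
  have h2 : gram ℂ (Sum.elim (residual w v) v) =
      fromBlocks (gram ℂ (residual w v)) 0 0 (gram ℂ v) := by
    have ho : ∀ i j, inner ℂ (v j) (residual w v i) = 0 := fun i j =>
      (Submodule.mem_orthogonal _ _).mp
        (Submodule.sub_starProjection_mem_orthogonal (K := Submodule.span ℂ (Set.range v)) (w i))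
        _ (Submodule.subset_span ⟨j, rfl⟩)
    ext i j
    rcases i with i | i <;> rcases j with j | j <;> simp [gram_apply, ho]
    rw [← inner_conj_symm, ho, map_zero]
  have hS : S.det = 1 := by simp [S]
  rw [h1, det_mul, det_mul, det_conjTranspose, hS, h2, det_fromBlocks_zero₂₁]
  simp

end GramResidual

/-! ### Entropies as logarithms of determinants: chain rule, invariance, strong subadditivity -/

section EntropyDeterminants

open Matrix

theorem logDetEntropy_eq {K H : Type*} [NormedAddCommGroup K] [InnerProductSpace ℂ K]
    [FiniteDimensional ℂ K] [NormedAddCommGroup H] [InnerProductSpace ℂ H] (T : K →ₗ[ℂ] H) :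
    logDetEntropy T = ENNReal.log (ENNReal.ofReal √(T.normDet ^ 2)) := by
  rw [logDetEntropy, Real.sqrt_sq T.normDet_nonneg]

theorem normDet_tupleMap_sq {H ι : Type*} [NormedAddCommGroup H] [InnerProductSpace ℂ H]
    [Fintype ι] [DecidableEq ι] (w : ι → H) :
    (tupleMap w).normDet ^ 2 = (gram ℂ w).det.re := by
  have h := (tupleMap w).normDet_sq_eq_det_gram (EuclideanSpace.basisFun ι ℂ)
  have h2 : (fun i => tupleMap w (EuclideanSpace.basisFun ι ℂ i)) = w := by
    ext i
    simp [tupleMap, Fintype.linearCombination_apply, Pi.single_apply, ite_smul]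
  rw [h2] at h
  rw [← h]
  exact (Complex.ofReal_re _).symm

variable {Γ : Type*} [Group Γ] {k : ℕ} [DecidableEq Γ] {φ : Γ → Matrix (Fin k) (Fin k) ℂ}

/-- The determinant of the positive semidefinite matrix `φ[F]`. -/
def gramDet (φ : Γ → Matrix (Fin k) (Fin k) ℂ) (F : Finset Γ) : ℝ := (blockMatrix φ F).det.re

/-- The Gram determinant of the components of the vectors indexed by `E` orthogonal to the vectors
indexed by `F`. -/
def condGramDet (φ : Γ → Matrix (Fin k) (Fin k) ℂ) (E F : Finset Γ) : ℝ :=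
  (gram ℂ (residual
    (fun p : E × Fin k => gramTuple φ (E ∪ F) (⟨p.1, Finset.mem_union_left F p.1.2⟩, p.2))
    (fun p : F × Fin k => gramTuple φ (E ∪ F) (⟨p.1, Finset.mem_union_right E p.1.2⟩, p.2)))).det.re

theorem ofReal_re_det_of_posSemidef {ι : Type*} [Fintype ι] [DecidableEq ι]
    {A : Matrix ι ι ℂ} (hA : A.PosSemidef) : ((A.det.re : ℝ) : ℂ) = A.det :=
  Complex.ext rfl (Complex.nonneg_iff.mp hA.det_nonneg).2

/-- Left translation by `γ` as a bijection between finite sets. -/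
def translateEquiv {E E' : Finset Γ} (γ : Γ) (hE : E = E'.image (γ * ·)) : E' ≃ E :=
  Equiv.ofBijective
    (fun x => ⟨γ * x, by rw [hE]; exact Finset.mem_image_of_mem _ x.2⟩)
    ⟨fun x y h => Subtype.ext (mul_left_cancel (Subtype.ext_iff.mp h)), by
      rintro ⟨x, hx⟩
      obtain ⟨y, hy, rfl⟩ := Finset.mem_image.mp (hE ▸ hx)
      exact ⟨⟨y, hy⟩, rfl⟩⟩

@[simp]
theorem coe_translateEquiv {E E' : Finset Γ} (γ : Γ) (hE : E = E'.image (γ * ·)) (x : E') :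
    (translateEquiv γ hE x : Γ) = γ * x := rfl

theorem gramDet_nonneg (hφ : IsPositiveDefinite φ) (F : Finset Γ) : 0 ≤ gramDet φ F :=
  (Complex.nonneg_iff.mp (blockMatrix_posSemidef hφ F).det_nonneg).1

theorem condGramDet_nonneg (E F : Finset Γ) : 0 ≤ condGramDet φ E F :=
  (Complex.nonneg_iff.mp (posSemidef_gram ℂ _).det_nonneg).1

theorem entropy_eq (hφ : IsPositiveDefinite φ) (F : Finset Γ) :
    entropy φ F = ENNReal.log (ENNReal.ofReal √(gramDet φ F)) := by
  rw [entropy, logDetEntropy_eq, normDet_tupleMap_sq, gram_gramTuple hφ, gramDet]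

theorem condEntropy_eq (E F : Finset Γ) :
    condEntropy φ E F = ENNReal.log (ENNReal.ofReal √(condGramDet φ E F)) := by
  rw [condEntropy, condLogDetEntropy, logDetEntropy_eq, condGramDet, ← normDet_tupleMap_sq]
  congr 5
  refine LinearMap.ext fun x => ?_
  simp [tupleMap, Fintype.linearCombination_apply, residual, smul_sub]

theorem inner_gramTuple (hφ : IsPositiveDefinite φ) {F : Finset Γ} (p q : F × Fin k) :
    inner ℂ (gramTuple φ F p) (gramTuple φ F q) = φ ((p.1 : Γ)⁻¹ * q.1) p.2 q.2 := by
  rw [← gram_apply, gram_gramTuple hφ]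
  rfl

/-- Left translates and larger conditioning sets decrease the conditional Gram determinant. -/
theorem condGramDet_le (hφ : IsPositiveDefinite φ) {E E' F F' : Finset Γ} (γ : Γ)
    (hE : E = E'.image (γ * ·)) (hF : F'.image (γ * ·) ⊆ F) :
    condGramDet φ E F ≤ condGramDet φ E' F' := by
  let e : E' ≃ E := translateEquiv γ hE
  let f : F' → F := fun x => ⟨γ * x, hF (Finset.mem_image_of_mem _ x.2)⟩
  let w : E × Fin k → _ := fun p =>
    gramTuple φ (E ∪ F) (⟨p.1, Finset.mem_union_left F p.1.2⟩, p.2)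
  let v : F × Fin k → _ := fun p =>
    gramTuple φ (E ∪ F) (⟨p.1, Finset.mem_union_right E p.1.2⟩, p.2)
  have h1 : (gram ℂ (residual w v)).det =
      (gram ℂ (residual (fun p : E' × Fin k => w (e p.1, p.2)) v)).det :=
    (det_submatrix_equiv_self (e.prodCongr (Equiv.refl (Fin k))) (gram ℂ (residual w v))).symm
  have h2 := det_gram_residual_le (w := fun p : E' × Fin k => w (e p.1, p.2)) (v := v)
    (w' := fun p : E' × Fin k =>
      gramTuple φ (E' ∪ F') (⟨p.1, Finset.mem_union_left F' p.1.2⟩, p.2))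
    (v' := fun p : F' × Fin k =>
      gramTuple φ (E' ∪ F') (⟨p.1, Finset.mem_union_right E' p.1.2⟩, p.2))
    -- Both Gram matrices consist of values of `φ` at elements `h⁻¹ g`, which do not change when `g`
    -- and `h` are multiplied by `γ` on the left.
    (fun p => (f p.1, p.2)) (by
      ext p q
      rcases p with p | p <;> rcases q with q | q <;>
        simp [gram_apply, w, v, inner_gramTuple hφ, e, f, mul_assoc])
  rw [← h1] at h2
  exact (Complex.le_def.mp h2).1

theorem condEntropy_le (hφ : IsPositiveDefinite φ) {E E' F F' : Finset Γ} (γ : Γ)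
    (hE : E = E'.image (γ * ·)) (hF : F'.image (γ * ·) ⊆ F) :
    condEntropy φ E F ≤ condEntropy φ E' F' := by
  rw [condEntropy_eq, condEntropy_eq]
  exact ENNReal.log_le_log (ENNReal.ofReal_le_ofReal
    (Real.sqrt_le_sqrt (condGramDet_le hφ γ hE hF)))

/-- Chain rule for entropy. Disjointness ensures that the two tuples together enumerate the tuple of
`E ∪ F` without repetition. -/
theorem gramDet_union (hφ : IsPositiveDefinite φ) {E F : Finset Γ} (h : Disjoint E F) :
    gramDet φ (E ∪ F) = condGramDet φ E F * gramDet φ F := by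
  let w : E × Fin k → _ := fun p =>
    gramTuple φ (E ∪ F) (⟨p.1, Finset.mem_union_left F p.1.2⟩, p.2)
  let v : F × Fin k → _ := fun p =>
    gramTuple φ (E ∪ F) (⟨p.1, Finset.mem_union_right E p.1.2⟩, p.2)
  have hv : gram ℂ v = blockMatrix φ F := by
    ext p q
    simp [gram_apply, v, inner_gramTuple hφ, blockMatrix]
  let e : (E × Fin k) ⊕ (F × Fin k) ≃ (E ∪ F : Finset Γ) × Fin k :=
    (Equiv.sumProdDistrib E F (Fin k)).symm.trans
      ((Equiv.Finset.union E F h).prodCongr (Equiv.refl _))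
  have hwv : gram ℂ (Sum.elim w v) = (blockMatrix φ (E ∪ F)).submatrix e e := by
    ext p q
    rcases p with p | p <;> rcases q with q | q <;>
      simp [gram_apply, w, v, inner_gramTuple hφ, blockMatrix, e]
  have key := det_gram_sumElim w v
  rw [hwv, det_submatrix_equiv_self, hv] at key
  have h3 : (gram ℂ (residual w v)).det = ((condGramDet φ E F : ℝ) : ℂ) :=
    (ofReal_re_det_of_posSemidef (posSemidef_gram ℂ _)).symm
  rw [gramDet, key, h3, Complex.re_ofReal_mul, gramDet]

theorem gramDet_empty : gramDet φ ∅ = 1 := by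
  simp [gramDet]

theorem gramDet_image_mul_left (γ : Γ) (F : Finset Γ) :
    gramDet φ (F.image (γ * ·)) = gramDet φ F := by
  let e : F ≃ (F.image (γ * ·) : Finset Γ) := translateEquiv γ rfl
  rw [gramDet, ← det_submatrix_equiv_self (e.prodCongr (Equiv.refl (Fin k))), gramDet]
  congr 2
  ext p q
  simp [blockMatrix, e, mul_assoc]

theorem gramDet_pos_mono (hφ : IsPositiveDefinite φ) {F F' : Finset Γ} (h : F' ⊆ F)
    (hF : 0 < gramDet φ F) : 0 < gramDet φ F' := by
  have := gramDet_union hφ (E := F \ F') (F := F') Finset.sdiff_disjoint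
  rw [Finset.sdiff_union_of_subset h] at this
  rw [this] at hF
  exact (gramDet_nonneg hφ F').lt_of_ne' (right_ne_zero_of_mul hF.ne')

/-- Strong subadditivity. Splitting off `A \ B` by the chain rule leaves a comparison of its
conditional determinants given `B` and given the smaller set `A ∩ B`. -/
theorem gramDet_union_mul_inter_le (hφ : IsPositiveDefinite φ) (A B : Finset Γ) :
    gramDet φ (A ∪ B) * gramDet φ (A ∩ B) ≤ gramDet φ A * gramDet φ B := by
  have h1 := gramDet_union hφ (E := A \ B) (F := B) Finset.sdiff_disjoint
  have h2 := gramDet_union hφ (E := A \ B) (F := A ∩ B)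
    (Finset.disjoint_sdiff_inter A B)
  rw [Finset.sdiff_union_self_eq_union] at h1
  rw [Finset.sdiff_union_inter] at h2
  rw [h1, h2]
  have h3 : condGramDet φ (A \ B) B ≤ condGramDet φ (A \ B) (A ∩ B) :=
    condGramDet_le hφ 1 (by simp) (by simp)
  have := mul_le_mul_of_nonneg_right h3
    (mul_nonneg (gramDet_nonneg hφ B) (gramDet_nonneg hφ (A ∩ B)))
  linarith

end EntropyDeterminants

/-! ### Reduced words and left multiplication by a letter -/

section FreeGroupWords

variable {S : Type*} [Fintype S] [DecidableEq S]

theorem mem_ball {n : ℕ} {g : FreeGroup S} : g ∈ ball n ↔ g.norm ≤ n := by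
  simp [ball]

theorem mem_sphere {n : ℕ} {g : FreeGroup S} : g ∈ sphere n ↔ g.norm = n := by
  simp only [sphere, Finset.mem_filter, mem_ball]
  omega

/-- The letter `a` as an element of the free group. -/
def letter (a : S × Bool) : FreeGroup S := FreeGroup.mk [a]

/-- The inverse letter. -/
def flip (a : S × Bool) : S × Bool := (a.1, !a.2)

/-- The reduced word of `g` begins with the letter `a`. -/
def StartsWith (a : S × Bool) (g : FreeGroup S) : Prop := g.toWord.head? = some a

instance (a : S × Bool) : DecidablePred (StartsWith (S := S) a) := fun g =>
  inferInstanceAs (Decidable (g.toWord.head? = some a))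

theorem letter_true (s : S) : letter (s, true) = FreeGroup.of s := rfl

theorem letter_flip (a : S × Bool) : letter (flip a) = (letter a)⁻¹ := by
  simp [letter, flip, FreeGroup.inv_mk, FreeGroup.invRev]

theorem letter_false (s : S) : letter (s, false) = (FreeGroup.of s)⁻¹ :=
  letter_flip (s, true)

theorem flip_flip (a : S × Bool) : flip (flip a) = a := by simp [flip]

theorem flip_ne (a : S × Bool) : flip a ≠ a := by
  rcases a with ⟨s, b⟩
  cases b <;> simp [flip]

theorem startsWith_unique {a b : S × Bool} {g : FreeGroup S} (ha : StartsWith a g)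
    (hb : StartsWith b g) : a = b :=
  Option.some_injective _ (ha.symm.trans hb)

theorem exists_startsWith {g : FreeGroup S} (hg : g ≠ 1) : ∃ a, StartsWith a g := by
  rcases h : g.toWord with _ | ⟨a, w⟩
  · exact absurd (FreeGroup.toWord_eq_nil_iff.mp h) hg
  · exact ⟨a, by simp [StartsWith, h]⟩

theorem StartsWith.ne_one {a : S × Bool} {g : FreeGroup S} (h : StartsWith a g) : g ≠ 1 := by
  rintro rfl
  simp [StartsWith] at h

theorem toWord_deleteFirst (g : FreeGroup S) : (deleteFirst g).toWord = g.toWord.tail := by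
  rw [deleteFirst, FreeGroup.toWord_mk]
  exact (FreeGroup.isReduced_toWord.infix (List.tail_suffix _).isInfix).reduce_eq

theorem StartsWith.toWord_eq {a : S × Bool} {g : FreeGroup S} (h : StartsWith a g) :
    g.toWord = a :: (deleteFirst g).toWord := by
  rw [toWord_deleteFirst]
  unfold StartsWith at h
  rcases hg : g.toWord with _ | ⟨b, w⟩
  · simp [hg] at h
  · simp_all

theorem StartsWith.letter_mul_deleteFirst {a : S × Bool} {g : FreeGroup S} (h : StartsWith a g) :
    letter a * deleteFirst g = g := by
  calc letter a * deleteFirst g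
      = FreeGroup.mk [a] * FreeGroup.mk (deleteFirst g).toWord := by rw [FreeGroup.mk_toWord, letter]
    _ = FreeGroup.mk g.toWord := by rw [FreeGroup.mul_mk, h.toWord_eq, List.singleton_append]
    _ = g := FreeGroup.mk_toWord

theorem StartsWith.norm_eq {a : S × Bool} {g : FreeGroup S} (h : StartsWith a g) :
    g.norm = (deleteFirst g).norm + 1 := by
  simp [FreeGroup.norm, h.toWord_eq]

theorem norm_deleteFirst {g : FreeGroup S} (hg : g ≠ 1) : g.norm = (deleteFirst g).norm + 1 := by
  obtain ⟨a, ha⟩ := exists_startsWith hg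
  exact ha.norm_eq

theorem deleteFirst_one : deleteFirst (1 : FreeGroup S) = 1 := rfl

/-- Left multiplication by a letter that does not cancel. -/
theorem toWord_letter_mul {a : S × Bool} {h : FreeGroup S} (hh : ¬ StartsWith (flip a) h) :
    (letter a * h).toWord = a :: h.toWord := by
  have h1 : letter a * h = FreeGroup.mk (a :: h.toWord) := by
    conv_lhs => rw [← FreeGroup.mk_toWord (x := h)]
    rw [letter, FreeGroup.mul_mk]
    rfl
  rw [h1, FreeGroup.toWord_mk]
  refine FreeGroup.IsReduced.reduce_eq ?_
  rcases hw : h.toWord with _ | ⟨b, w⟩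
  · exact FreeGroup.IsReduced.singleton
  · refine FreeGroup.isReduced_cons_cons.mpr ⟨fun hab => ?_, hw ▸ FreeGroup.isReduced_toWord⟩
    by_contra hne
    apply hh
    simp only [StartsWith, hw, List.head?_cons, Option.some.injEq, flip]
    exact Prod.ext hab.symm (by cases h1 : a.2 <;> cases h2 : b.2 <;> simp_all)

theorem startsWith_letter_mul {a : S × Bool} {h : FreeGroup S} (hh : ¬ StartsWith (flip a) h) :
    StartsWith a (letter a * h) := by
  simp [StartsWith, toWord_letter_mul hh]

theorem deleteFirst_letter_mul {a : S × Bool} {h : FreeGroup S} (hh : ¬ StartsWith (flip a) h) :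
    deleteFirst (letter a * h) = h :=
  FreeGroup.toWord_injective (by rw [toWord_deleteFirst, toWord_letter_mul hh, List.tail_cons])

theorem letter_mul_of_startsWith {a : S × Bool} {h : FreeGroup S} (hh : StartsWith (flip a) h) :
    letter a * h = deleteFirst h := by
  conv_lhs => rw [← hh.letter_mul_deleteFirst, letter_flip, mul_inv_cancel_left]

theorem not_startsWith_flip_deleteFirst {a : S × Bool} {g : FreeGroup S} (h : StartsWith a g) :
    ¬ StartsWith (flip a) (deleteFirst g) := by
  intro hc
  have h1 := letter_mul_of_startsWith hc
  rw [h.letter_mul_deleteFirst] at h1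
  have h2 := h.norm_eq
  have h3 := hc.norm_eq
  rw [← h1] at h3
  omega

theorem norm_letter_mul {a : S × Bool} {h : FreeGroup S} (hh : ¬ StartsWith (flip a) h) :
    (letter a * h).norm = h.norm + 1 := by
  simp [FreeGroup.norm, toWord_letter_mul hh]

end FreeGroupWords

/-! ### The length-lexicographic order and the chain rule along it -/

section Order

variable {S : Type*} [Fintype S] [DecidableEq S] (r : S × Bool → S × Bool → Prop)

/-- The length-lexicographic order on the free group. -/
def Precedes (g h : FreeGroup S) : Prop := List.Shortlex r g.toWord h.toWord

variable {r}

theorem Precedes.norm_le {g h : FreeGroup S} (hgh : Precedes r g h) : g.norm ≤ h.norm := by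
  rcases List.shortlex_def.mp hgh with h | h
  · exact h.le
  · exact h.1.le

theorem mem_predecessors {g h : FreeGroup S} : h ∈ predecessors r g ↔ Precedes r h g := by
  classical
  simp only [predecessors, Finset.mem_filter, mem_ball]
  exact ⟨fun h => h.2, fun h => ⟨h.norm_le, h⟩⟩

theorem precedes_of_norm_lt {g h : FreeGroup S} (hgh : g.norm < h.norm) : Precedes r g h :=
  List.Shortlex.of_length_lt hgh

variable [IsStrictTotalOrder (S × Bool) r]

theorem Precedes.trans {g h l : FreeGroup S} (h1 : Precedes r g h) (h2 : Precedes r h l) :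
    Precedes r g l := by
  rcases List.shortlex_def.mp h1 with h1 | ⟨h1, h1'⟩ <;>
    rcases List.shortlex_def.mp h2 with h2 | ⟨h2, h2'⟩
  · exact .of_length_lt (h1.trans h2)
  · exact .of_length_lt (h2 ▸ h1)
  · exact .of_length_lt (h1 ▸ h2)
  · exact .of_lex (h1.trans h2) (List.lex_trans (fun h h' => _root_.trans h h') h1' h2')

theorem not_precedes_self (g : FreeGroup S) : ¬ Precedes r g g := fun h =>
  (Std.Asymm.asymm (r := List.Shortlex r) _ _ h) h

theorem precedes_trichotomy {g h : FreeGroup S} (hgh : g ≠ h) : Precedes r g h ∨ Precedes r h g := by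
  rcases trichotomous_of (List.Shortlex r) g.toWord h.toWord with h1 | h1 | h1
  · exact .inl h1
  · exact absurd (FreeGroup.toWord_injective h1) hgh
  · exact .inr h1

theorem predecessors_subset {g h : FreeGroup S} (hgh : Precedes r g h) :
    predecessors r g ⊆ predecessors r h := fun _ hl =>
  mem_predecessors.mpr ((mem_predecessors.mp hl).trans hgh)

theorem notMem_predecessors_self (g : FreeGroup S) : g ∉ predecessors r g := fun h =>
  not_precedes_self g (mem_predecessors.mp h)

theorem card_predecessors_lt {g h : FreeGroup S} (hgh : Precedes r g h) :
    (predecessors r g).card < (predecessors r h).card :=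
  Finset.card_lt_card ⟨predecessors_subset hgh, fun hc =>
    notMem_predecessors_self g (hc (mem_predecessors.mpr hgh))⟩

theorem predecessors_one : predecessors r (1 : FreeGroup S) = ∅ := by
  ext h
  simp only [mem_predecessors, Finset.notMem_empty, iff_false]
  exact List.not_shortlex_nil_right

/-- Prepending the common letter `a` preserves the order when nothing cancels. If `a` cancels, the
product is shorter than `g` and precedes it for reasons of length. -/
theorem image_letter_mul_predecessors {a : S × Bool} {g : FreeGroup S} (hg : StartsWith a g) :
    (predecessors r (deleteFirst g)).image (letter a * ·) ⊆ predecessors r g := by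
  intro x hx
  obtain ⟨h, hh, rfl⟩ := Finset.mem_image.mp hx
  rw [mem_predecessors] at hh ⊢
  by_cases hs : StartsWith (flip a) h
  · apply precedes_of_norm_lt
    rw [letter_mul_of_startsWith hs]
    have h1 := hs.norm_eq
    have h2 := hh.norm_le
    have h3 := hg.norm_eq
    omega
  · rw [Precedes, toWord_letter_mul hs, hg.toWord_eq]
    exact List.Shortlex.cons hh

/-- A downward closed finite set is obtained by adding its elements in increasing order. -/
theorem erase_eq_predecessors {F : Finset (FreeGroup S)}
    (hF : ∀ g ∈ F, predecessors r g ⊆ F) (hne : F.Nonempty) :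
    ∃ g ∈ F, F.erase g = predecessors r g := by
  -- The number of predecessors is strictly increasing along the order, so maximizing it picks out
  -- the last element of `F`.
  obtain ⟨g, hg, hmax⟩ := F.exists_max_image (fun g => (predecessors r g).card) hne
  refine ⟨g, hg, Finset.Subset.antisymm (fun h hh => ?_) fun h hh =>
    Finset.mem_erase.mpr ⟨fun e => notMem_predecessors_self g (e ▸ hh), hF g hg hh⟩⟩
  obtain ⟨hne, hh⟩ := Finset.mem_erase.mp hh
  rcases precedes_trichotomy (r := r) hne with h1 | h1
  · exact mem_predecessors.mpr h1
  · exact absurd (hmax h hh) (card_predecessors_lt h1).not_ge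

variable {k : ℕ} {φ : FreeGroup S → Matrix (Fin k) (Fin k) ℂ}

/-- Translation by the first letter of `g` turns the right-hand side into the entropy of `g` given a
subset of its predecessors. Conditioning on all of them can only decrease it. -/
theorem condEntropy_predecessors_le (hφ : IsPositiveDefinite φ) {g : FreeGroup S} (hg : g ≠ 1) :
    condEntropy φ {g} (predecessors r g) ≤
      condEntropy φ {deleteFirst g} (predecessors r (deleteFirst g)) := by
  obtain ⟨a, ha⟩ := exists_startsWith hg
  exact condEntropy_le hφ (letter a) (by simp [ha.letter_mul_deleteFirst])
    (image_letter_mul_predecessors ha)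

/-- The chain rule is applied repeatedly, removing the last element of `F` each time; downward
closure says that what remains is exactly its set of predecessors. -/
theorem gramDet_eq_prod (hφ : IsPositiveDefinite φ) (F : Finset (FreeGroup S))
    (hF : ∀ g ∈ F, predecessors r g ⊆ F) :
    gramDet φ F = ∏ g ∈ F, condGramDet φ {g} (predecessors r g) := by
  induction hn : F.card using Nat.strong_induction_on generalizing F with
  | _ n ih =>
    rcases F.eq_empty_or_nonempty with rfl | hne
    · simp [gramDet_empty]
    obtain ⟨g, hg, he⟩ := erase_eq_predecessors hF hne
    have h1 := gramDet_union hφ (E := {g}) (F := F.erase g)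
      (by simp)
    rw [Finset.singleton_union, Finset.insert_erase hg] at h1
    rw [h1, ← Finset.mul_prod_erase F _ hg, ← ih (F.erase g).card
      (hn ▸ Finset.card_erase_lt_of_mem hg) (F.erase g) (fun h hh => ?_) rfl, he]
    rw [he] at hh ⊢
    exact predecessors_subset (mem_predecessors.mp hh)

theorem predecessors_subset_ball {g : FreeGroup S} {n : ℕ} (hg : g ∈ ball n) :
    predecessors r g ⊆ ball n := fun _ hh =>
  mem_ball.mpr ((mem_predecessors.mp hh).norm_le.trans (mem_ball.mp hg))

end Order

/-! ### Finite subtrees of the left Cayley graph and their edges -/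

section RootedSets

variable {S : Type*} [Fintype S] [DecidableEq S]

/-- The elements `h` of `F` joined to `letter a * h ∈ F` by an edge of the left Cayley graph. -/
def letterEdges (a : S × Bool) (F : Finset (FreeGroup S)) : Finset (FreeGroup S) :=
  F.filter fun h => letter a * h ∈ F

theorem mem_letterEdges {a : S × Bool} {F : Finset (FreeGroup S)} {h : FreeGroup S} :
    h ∈ letterEdges a F ↔ h ∈ F ∧ letter a * h ∈ F := Finset.mem_filter

theorem image_letterEdges (a : S × Bool) (F : Finset (FreeGroup S)) :
    (letterEdges a F).image (letter a * ·) = letterEdges (flip a) F := by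
  ext x
  simp only [Finset.mem_image, mem_letterEdges, letter_flip]
  constructor
  · rintro ⟨h, ⟨h1, h2⟩, rfl⟩
    exact ⟨h2, by simpa using h1⟩
  · rintro ⟨h1, h2⟩
    exact ⟨_, ⟨h2, by simpa using h1⟩, by simp⟩

theorem sum_eq_sum_startsWith {M : Type*} [AddCommMonoid M] {F : Finset (FreeGroup S)}
    (h1 : 1 ∈ F) (f : FreeGroup S → M) :
    ∑ g ∈ F, f g = f 1 + ∑ a : S × Bool, ∑ g ∈ F with StartsWith a g, f g := by
  rw [← Finset.sum_fiberwise F (fun g => g.toWord.head?) f, Fintype.sum_option]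
  congr 1
  rw [Finset.sum_filter, Finset.sum_eq_single_of_mem 1 h1]
  · simp
  · intro g _ hg
    rw [if_neg]
    simpa using hg

/-- `F` contains the identity and is closed under deleting the leftmost letter. -/
structure IsRooted (F : Finset (FreeGroup S)) : Prop where
  one_mem : 1 ∈ F
  deleteFirst_mem : ∀ g ∈ F, deleteFirst g ∈ F

theorem isRooted_ball (n : ℕ) : IsRooted (ball n : Finset (FreeGroup S)) where
  one_mem := by simp [mem_ball]
  deleteFirst_mem g hg := by
    rcases eq_or_ne g 1 with rfl | h
    · exact hg
    · have := norm_deleteFirst h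
      rw [mem_ball] at hg ⊢
      omega

/-- Deleting a letter shortens a word and so moves it down in the order. These windows, which need
not be balls, serve the singular case. -/
theorem isRooted_insert_predecessors {r : S × Bool → S × Bool → Prop}
    [IsStrictTotalOrder (S × Bool) r] (g : FreeGroup S) :
    IsRooted (insert g (predecessors r g)) where
  one_mem := by
    rcases eq_or_ne g 1 with rfl | h
    · exact Finset.mem_insert_self _ _
    · refine Finset.mem_insert_of_mem (mem_predecessors.mpr (precedes_of_norm_lt ?_))
      have := norm_deleteFirst h
      simp only [FreeGroup.norm_one]
      omega
  deleteFirst_mem h hh := by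
    rcases eq_or_ne h 1 with rfl | h1
    · exact hh
    have h2 : Precedes r (deleteFirst h) h :=
      precedes_of_norm_lt (by rw [norm_deleteFirst h1]; omega)
    refine Finset.mem_insert_of_mem (mem_predecessors.mpr ?_)
    rcases Finset.mem_insert.mp hh with rfl | h3
    · exact h2
    · exact h2.trans (mem_predecessors.mp h3)

/-- Exactly one endpoint of an edge from `h` to `a h` is the child of the other: either `a h` begins
with `a`, or `h` begins with the inverse of `a`. Counting edges by their children gives the two
terms. -/
theorem card_letterEdges {F : Finset (FreeGroup S)} (hF : IsRooted F) (a : S × Bool) :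
    (letterEdges a F).card =
      (F.filter (StartsWith a)).card + (F.filter (StartsWith (flip a))).card := by
  have h1 : letterEdges a F =
      (F.filter (StartsWith a)).image deleteFirst ∪ F.filter (StartsWith (flip a)) := by
    ext h
    simp only [mem_letterEdges, Finset.mem_union, Finset.mem_image, Finset.mem_filter]
    constructor
    · rintro ⟨h1, h2⟩
      by_cases hs : StartsWith (flip a) h
      · exact .inr ⟨h1, hs⟩
      · exact .inl ⟨_, ⟨h2, startsWith_letter_mul hs⟩, deleteFirst_letter_mul hs⟩
    · rintro (⟨g, ⟨h1, h2⟩, rfl⟩ | ⟨h1, h2⟩)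
      · exact ⟨hF.deleteFirst_mem g h1, h2.letter_mul_deleteFirst.symm ▸ h1⟩
      · exact ⟨h1, letter_mul_of_startsWith h2 ▸ hF.deleteFirst_mem h h1⟩
  rw [h1, Finset.card_union_of_disjoint, Finset.card_image_of_injOn]
  · intro g hg g' hg' he
    have hg := (Finset.mem_filter.mp hg).2
    have hg' := (Finset.mem_filter.mp hg').2
    rw [← hg.letter_mul_deleteFirst, ← hg'.letter_mul_deleteFirst]
    exact congrArg _ he
  · rw [Finset.disjoint_left]
    intro h hh hh'
    obtain ⟨g, hg, rfl⟩ := Finset.mem_image.mp hh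
    exact not_startsWith_flip_deleteFirst (Finset.mem_filter.mp hg).2 (Finset.mem_filter.mp hh').2

/-- A tree has one edge fewer than it has vertices, since each vertex other than the root is the
child of exactly one edge. This makes the powers of `ε` cancel in the volume estimates. -/
theorem sum_card_letterEdges {F : Finset (FreeGroup S)} (hF : IsRooted F) :
    ∑ s : S, (letterEdges (s, true) F).card + 1 = F.card := by
  have h := sum_eq_sum_startsWith hF.one_mem (fun _ => 1)
  rw [← Finset.card_eq_sum_ones, Fintype.sum_prod_type] at h
  rw [h, add_comm]
  congr 1
  refine Finset.sum_congr rfl fun s _ => ?_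
  rw [card_letterEdges hF, Fintype.sum_bool, Finset.card_eq_sum_ones, Finset.card_eq_sum_ones]
  rfl

theorem letterEdges_ball (a : S × Bool) (n : ℕ) :
    letterEdges a (ball (n + 1)) = ball n ∪ (sphere (n + 1)).filter (StartsWith (flip a)) := by
  ext h
  simp only [mem_letterEdges, Finset.mem_union, Finset.mem_filter, mem_ball, mem_sphere]
  by_cases hs : StartsWith (flip a) h
  · have h1 := hs.norm_eq
    rw [letter_mul_of_startsWith hs]
    simp only [hs, and_true]
    omega
  · rw [norm_letter_mul hs]
    simp only [hs, and_false, or_false]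
    omega

end RootedSets

/-! ### Comparison of the window rates of balls with the partial sums of the series -/

section Interlacing

variable {S : Type*} [Fintype S] [DecidableEq S]
variable {k : ℕ} {φ : FreeGroup S → Matrix (Fin k) (Fin k) ℂ}

/-- The logarithm of the determinant of `φ[F]`. -/
def logGramDet (φ : FreeGroup S → Matrix (Fin k) (Fin k) ℂ) (F : Finset (FreeGroup S)) : ℝ :=
  Real.log (gramDet φ F)

/-- The exponential rate attached to the finite window `F`. -/
def windowRate (φ : FreeGroup S → Matrix (Fin k) (Fin k) ℂ) (F : Finset (FreeGroup S)) : ℝ :=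
  logGramDet φ F - ∑ s : S, logGramDet φ (letterEdges (s, true) F)

theorem logGramDet_letterEdges_flip (a : S × Bool) (F : Finset (FreeGroup S)) :
    logGramDet φ (letterEdges (flip a) F) = logGramDet φ (letterEdges a F) := by
  rw [logGramDet, ← image_letterEdges, gramDet_image_mul_left, logGramDet]

theorem sum_logGramDet_letterEdges (F : Finset (FreeGroup S)) :
    ∑ a : S × Bool, logGramDet φ (letterEdges a F) =
      2 * ∑ s : S, logGramDet φ (letterEdges (s, true) F) := by
  rw [Fintype.sum_prod_type, Finset.mul_sum]
  refine Finset.sum_congr rfl fun s _ => ?_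
  rw [Fintype.sum_bool, two_mul]
  congr 1
  exact logGramDet_letterEdges_flip (s, true) F

theorem logGramDet_union_add_inter_le (hφ : IsPositiveDefinite φ) (hpos : ∀ F, 0 < gramDet φ F)
    (A B : Finset (FreeGroup S)) :
    logGramDet φ (A ∪ B) + logGramDet φ (A ∩ B) ≤ logGramDet φ A + logGramDet φ B := by
  simp only [logGramDet]
  rw [← Real.log_mul (hpos _).ne' (hpos _).ne', ← Real.log_mul (hpos _).ne' (hpos _).ne']
  exact Real.log_le_log (mul_pos (hpos _) (hpos _)) (gramDet_union_mul_inter_le hφ A B)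

/-- Given `B`, the conditional entropy of a union is at most the sum of the conditional entropies.
The hypotheses make the sets `E a` meet only in `B`, so each new set costs one application of strong
subadditivity. -/
theorem logGramDet_biUnion_le (hφ : IsPositiveDefinite φ) (hpos : ∀ F, 0 < gramDet φ F)
    {ι : Type*} [DecidableEq ι] (B : Finset (FreeGroup S)) (E : ι → Finset (FreeGroup S))
    (hB : ∀ a, B ⊆ E a) (hE : ∀ a b, a ≠ b → E a ∩ E b ⊆ B) (A : Finset ι) :
    logGramDet φ (B ∪ A.biUnion E) - logGramDet φ B ≤
      ∑ a ∈ A, (logGramDet φ (E a) - logGramDet φ B) := by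
  induction A using Finset.induction_on with
  | empty => simp
  | insert a A ha ih =>
    rw [Finset.sum_insert ha, Finset.biUnion_insert]
    have h1 := logGramDet_union_add_inter_le hφ hpos (E a) (B ∪ A.biUnion E)
    have h2 : E a ∩ (B ∪ A.biUnion E) = B := by
      refine Finset.Subset.antisymm ?_
        (Finset.subset_inter (hB a) Finset.subset_union_left)
      rw [Finset.inter_union_distrib_left]
      refine Finset.union_subset Finset.inter_subset_right fun x hx => ?_
      obtain ⟨hx1, hx2⟩ := Finset.mem_inter.mp hx
      obtain ⟨b, hb, hxb⟩ := Finset.mem_biUnion.mp hx2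
      exact hE a b (fun h => ha (h ▸ hb)) (Finset.mem_inter.mpr ⟨hx1, hxb⟩)
    have h3 : E a ∪ (B ∪ A.biUnion E) = B ∪ (E a ∪ A.biUnion E) := by
      rw [← Finset.union_assoc, Finset.union_comm (E a) B, Finset.union_assoc]
    rw [h2, h3] at h1
    linarith

/-- For each letter `a`, the source set of the edges labelled by the inverse of `a` is `B_n`
together with the part of the outer sphere beginning with `a`. These `2|S|` sets cover `B_{n+1}` and
meet pairwise in `B_n`. -/
theorem two_mul_windowRate_ball_succ_le (hφ : IsPositiveDefinite φ)
    (hpos : ∀ F, 0 < gramDet φ F) (n : ℕ) :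
    2 * windowRate φ (ball (n + 1)) ≤
      logGramDet φ (ball (n + 1)) - (2 * Fintype.card S - 1) * logGramDet φ (ball n) := by
  have h := logGramDet_biUnion_le hφ hpos (ball n)
    (fun a : S × Bool => letterEdges (flip a) (ball (n + 1)))
    (fun a => by rw [letterEdges_ball]; exact Finset.subset_union_left)
    (fun a b hab x hx => by
      simp only [letterEdges_ball, flip_flip, Finset.mem_inter, Finset.mem_union,
        Finset.mem_filter] at hx
      rcases hx.1 with h1 | h1
      · exact h1
      rcases hx.2 with h2 | h2
      · exact h2
      · exact absurd (startsWith_unique h1.2 h2.2) hab) Finset.univ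
  have h2 : ball n ∪ Finset.univ.biUnion
      (fun a : S × Bool => letterEdges (flip a) (ball (n + 1))) = ball (n + 1) := by
    ext x
    simp only [letterEdges_ball, flip_flip, Finset.mem_union, Finset.mem_biUnion, mem_ball,
      Finset.mem_univ, true_and, Finset.mem_filter, mem_sphere]
    constructor
    · rintro (h | ⟨a, h | h⟩) <;> omega
    · intro hx
      rcases Nat.lt_or_ge n x.norm with h1 | h1
      · obtain ⟨a, ha⟩ := exists_startsWith (g := x)
          (by rintro rfl; simp at h1)
        exact .inr ⟨a, .inr ⟨by omega, ha⟩⟩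
      · exact .inl h1
  rw [h2, Finset.sum_sub_distrib] at h
  simp only [logGramDet_letterEdges_flip] at h
  rw [sum_logGramDet_letterEdges] at h
  simp only [Finset.sum_const, Finset.card_univ, Fintype.card_prod, Fintype.card_bool,
    nsmul_eq_mul] at h
  push_cast at h
  rw [windowRate]
  linarith

/-- The sets `aB_n ∪ B_n` cover `B_{n+1}` and meet pairwise in `B_n`. Each is bounded by strong
subadditivity, where `aB_n ∩ B_n` is an edge window and `aB_n` is a translate of `B_n`. -/
theorem le_two_mul_windowRate_ball (hφ : IsPositiveDefinite φ) (hpos : ∀ F, 0 < gramDet φ F)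
    (n : ℕ) :
    logGramDet φ (ball (n + 1)) - (2 * Fintype.card S - 1) * logGramDet φ (ball n) ≤
      2 * windowRate φ (ball n) := by
  have hE : ∀ (a : S × Bool) (x : FreeGroup S), x ∉ ball n →
      x ∈ (ball n).image (letter a * ·) → StartsWith a x ∧ x.norm = n + 1 := by
    intro a x hx hxa
    obtain ⟨h, hh, rfl⟩ := Finset.mem_image.mp hxa
    rw [mem_ball] at hx hh
    by_cases hs : StartsWith (flip a) h
    · have := hs.norm_eq
      simp only [letter_mul_of_startsWith hs] at hx
      omega
    · have := norm_letter_mul hs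
      refine ⟨startsWith_letter_mul hs, ?_⟩
      simp only [this] at hx ⊢
      omega
  have h := logGramDet_biUnion_le hφ hpos (ball n)
    (fun a : S × Bool => (ball n).image (letter a * ·) ∪ ball n)
    (fun a => Finset.subset_union_right)
    (fun a b hab x hx => by
      by_contra hxn
      simp only [Finset.mem_inter, Finset.mem_union] at hx
      exact hab (startsWith_unique (hE a x hxn (hx.1.resolve_right hxn)).1
        (hE b x hxn (hx.2.resolve_right hxn)).1)) Finset.univ
  have h2 : ball n ∪ Finset.univ.biUnion
      (fun a : S × Bool => (ball n).image (letter a * ·) ∪ ball n) = ball (n + 1) := by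
    ext x
    rw [Finset.mem_union, mem_ball (n := n + 1)]
    constructor
    · intro hx
      by_cases hxn : x ∈ ball n
      · have := mem_ball.mp hxn
        omega
      · obtain ⟨a, -, ha⟩ := Finset.mem_biUnion.mp (hx.resolve_left hxn)
        exact (hE a x hxn ((Finset.mem_union.mp ha).resolve_right hxn)).2.le
    · intro hx
      rcases eq_or_ne x 1 with rfl | h1
      · exact .inl (by simp [mem_ball])
      obtain ⟨a, ha⟩ := exists_startsWith h1
      refine .inr (Finset.mem_biUnion.mpr ⟨a, Finset.mem_univ _, Finset.mem_union_left _
        (Finset.mem_image.mpr ⟨deleteFirst x, ?_, ha.letter_mul_deleteFirst⟩)⟩)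
      have := ha.norm_eq
      rw [mem_ball]
      omega
  rw [h2] at h
  have h3 : ∀ a : S × Bool,
      logGramDet φ ((ball n).image (letter a * ·) ∪ ball n) - logGramDet φ (ball n) ≤
        logGramDet φ (ball n) - logGramDet φ (letterEdges a (ball n)) := by
    intro a
    have h4 := logGramDet_union_add_inter_le hφ hpos ((ball n).image (letter a * ·)) (ball n)
    have h5 : (ball n).image (letter a * ·) ∩ ball n = letterEdges (flip a) (ball n) := by
      ext x
      simp only [Finset.mem_inter, Finset.mem_image, mem_letterEdges, letter_flip]
      constructor
      · rintro ⟨⟨h, hh, rfl⟩, hx⟩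
        exact ⟨hx, by simpa using hh⟩
      · rintro ⟨hx, hh⟩
        exact ⟨⟨_, hh, by simp⟩, hx⟩
    have h6 : logGramDet φ ((ball n).image (letter a * ·)) = logGramDet φ (ball n) := by
      rw [logGramDet, gramDet_image_mul_left, logGramDet]
    rw [h5, logGramDet_letterEdges_flip, h6] at h4
    linarith
  have h7 := h.trans (Finset.sum_le_sum fun a _ => h3 a)
  rw [Finset.sum_sub_distrib, sum_logGramDet_letterEdges] at h7
  simp only [Finset.sum_const, Finset.card_univ, Fintype.card_prod, Fintype.card_bool,
    nsmul_eq_mul] at h7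
  push_cast at h7
  rw [windowRate]
  linarith

variable {r : S × Bool → S × Bool → Prop} [IsStrictTotalOrder (S × Bool) r]

theorem sum_range_sphere (f : FreeGroup S → ℝ) (N : ℕ) :
    ∑ n ∈ Finset.range N, ∑ g ∈ sphere (n + 1), f g = ∑ g ∈ ball N, f g - f 1 := by
  induction N with
  | zero =>
    have : (ball 0 : Finset (FreeGroup S)) = {1} := by
      ext g
      simp [mem_ball]
    simp [this]
  | succ N ih =>
    have h1 : (ball (N + 1) : Finset (FreeGroup S)) = ball N ∪ sphere (N + 1) := by
      ext g
      simp only [Finset.mem_union, mem_ball, mem_sphere]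
      omega
    have h2 : Disjoint (ball N : Finset (FreeGroup S)) (sphere (N + 1)) := by
      rw [Finset.disjoint_left]
      intro g hg hg'
      rw [mem_ball] at hg
      rw [mem_sphere] at hg'
      omega
    rw [Finset.sum_range_succ, ih, h1, Finset.sum_union h2]
    ring

/-- Each vertex of `B_N` is the parent of `2|S| - 1` vertices, except the identity, which has `2|S|`
children. Since `deleteFirst 1 = 1`, the identity also counts itself, whence the term `2 * f 1`. -/
theorem sum_ball_deleteFirst (f : FreeGroup S → ℝ) (N : ℕ) :
    ∑ g ∈ ball (N + 1), f (deleteFirst g) =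
      (2 * Fintype.card S - 1) * ∑ g ∈ ball N, f g + 2 * f 1 := by
  have h1 : ∀ M, (1 : FreeGroup S) ∈ ball M := fun M => (isRooted_ball M).one_mem
  have h2 : ∀ a : S × Bool,
      ∑ g ∈ ball (N + 1) with StartsWith a g, f (deleteFirst g) =
        ∑ g ∈ ball N, f g - ∑ g ∈ ball N with StartsWith (flip a) g, f g := by
    intro a
    rw [← Finset.sum_filter_add_sum_filter_not (ball N) (StartsWith (flip a)) f, add_sub_cancel_left]
    refine Finset.sum_bij' (fun g _ => deleteFirst g) (fun h _ => letter a * h) ?_ ?_ ?_ ?_ ?_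
    · intro g hg
      obtain ⟨hg, ha⟩ := Finset.mem_filter.mp hg
      have := ha.norm_eq
      rw [mem_ball] at hg
      exact Finset.mem_filter.mpr ⟨mem_ball.mpr (by omega), not_startsWith_flip_deleteFirst ha⟩
    · intro h hh
      obtain ⟨hh, ha⟩ := Finset.mem_filter.mp hh
      have := norm_letter_mul ha
      rw [mem_ball] at hh
      exact Finset.mem_filter.mpr ⟨mem_ball.mpr (by omega), startsWith_letter_mul ha⟩
    · intro g hg
      exact (Finset.mem_filter.mp hg).2.letter_mul_deleteFirst
    · intro h hh
      exact deleteFirst_letter_mul (Finset.mem_filter.mp hh).2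
    · intro g _
      rfl
  have h3 := sum_eq_sum_startsWith (h1 (N + 1)) (fun g => f (deleteFirst g))
  have h4 := sum_eq_sum_startsWith (h1 N) f
  have h5 : ∑ a : S × Bool, ∑ g ∈ ball N with StartsWith (flip a) g, f g =
      ∑ a : S × Bool, ∑ g ∈ ball N with StartsWith a g, f g :=
    Fintype.sum_equiv ⟨flip, flip, flip_flip, flip_flip⟩ _ _ fun _ => rfl
  rw [h3, Finset.sum_congr rfl fun a _ => h2 a, Finset.sum_sub_distrib, h5, deleteFirst_one]
  simp only [Finset.sum_const, Finset.card_univ, Fintype.card_prod, Fintype.card_bool,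
    nsmul_eq_mul]
  push_cast
  linarith

/-- The sum over children and the sum over parents are both expressed through ball determinants by
the chain rule. The surplus at the root produces the factor 2 of the singleton determinant. -/
theorem sum_range_sphere_condGramDet (hφ : IsPositiveDefinite φ) (hpos : ∀ F, 0 < gramDet φ F)
    (N : ℕ) :
    ∑ n ∈ Finset.range (N + 1), ∑ g ∈ sphere (n + 1),
      (Real.log (condGramDet φ {deleteFirst g} (predecessors r (deleteFirst g))) -
        Real.log (condGramDet φ {g} (predecessors r g))) =
    2 * logGramDet φ {1} -
      (logGramDet φ (ball (N + 1)) - (2 * Fintype.card S - 1) * logGramDet φ (ball N)) := by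
  have h1 : ∀ M, logGramDet φ (ball M) =
      ∑ g ∈ ball M, Real.log (condGramDet φ {g} (predecessors r g)) := by
    intro M
    have h := gramDet_eq_prod (r := r) hφ (ball M) fun g hg => predecessors_subset_ball hg
    rw [logGramDet, h, Real.log_prod]
    intro g hg h0
    rw [Finset.prod_eq_zero hg h0] at h
    exact (hpos _).ne' h
  have h2 : logGramDet φ {1} = Real.log (condGramDet φ {1} (predecessors r 1)) := by
    have h := gramDet_union hφ (E := {1}) (F := ∅) (Finset.disjoint_empty_right _)
    rw [gramDet_empty, mul_one, Finset.union_empty] at h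
    rw [logGramDet, h, predecessors_one]
  rw [sum_range_sphere, Finset.sum_sub_distrib, sum_ball_deleteFirst
    (fun g => Real.log (condGramDet φ {g} (predecessors r g))), ← h1, ← h1, deleteFirst_one]
  simp only [← h2]
  ring

end Interlacing

/-! ### Tuples of vectors in complex space, their Gram matrices, and the two actions on them -/

section Tuples

open Matrix

variable {n : ℕ}

/-- The Euclidean norm of a vector in `ℂⁿ`. -/
def vnorm (v : Fin n → ℂ) : ℝ := ‖(WithLp.toLp 2 v : EuclideanSpace ℂ (Fin n))‖

theorem vnorm_nonneg (v : Fin n → ℂ) : 0 ≤ vnorm v := norm_nonneg _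

theorem vnorm_add_le (v w : Fin n → ℂ) : vnorm (v + w) ≤ vnorm v + vnorm w := norm_add_le _ _

theorem vnorm_sub_comm (v w : Fin n → ℂ) : vnorm (v - w) = vnorm (w - v) := norm_sub_rev _ _

theorem vnorm_sub_le (u v w : Fin n → ℂ) : vnorm (u - w) ≤ vnorm (u - v) + vnorm (v - w) := by
  simpa using vnorm_add_le (u - v) (v - w)

theorem vnorm_smul (c : ℂ) (v : Fin n → ℂ) : vnorm (c • v) = ‖c‖ * vnorm v := norm_smul c _

theorem vnorm_sum_le {ι : Type*} (s : Finset ι) (f : ι → Fin n → ℂ) :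
    vnorm (∑ i ∈ s, f i) ≤ ∑ i ∈ s, vnorm (f i) := by
  simp only [vnorm, WithLp.toLp_sum]
  exact norm_sum_le _ _

theorem continuous_vnorm : Continuous (vnorm (n := n)) :=
  (PiLp.continuous_toLp 2 _).norm

/-- The Gram matrix of a tuple of vectors in `ℂⁿ`. -/
def tgram {ι : Type*} (x : ι → Fin n → ℂ) : Matrix ι ι ℂ :=
  gram ℂ fun i => (WithLp.toLp 2 (x i) : EuclideanSpace ℂ (Fin n))

theorem tgram_apply {ι : Type*} (x : ι → Fin n → ℂ) (i j : ι) :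
    tgram x i j = star (x i) ⬝ᵥ x j := by
  rw [tgram, gram_apply, EuclideanSpace.inner_eq_star_dotProduct, dotProduct_comm]

theorem posSemidef_tgram {ι : Type*} [Finite ι] (x : ι → Fin n → ℂ) : (tgram x).PosSemidef :=
  posSemidef_gram ℂ _

theorem norm_dotProduct_le (v w : Fin n → ℂ) : ‖star v ⬝ᵥ w‖ ≤ vnorm v * vnorm w := by
  rw [dotProduct_comm]
  exact norm_inner_le_norm (𝕜 := ℂ) (WithLp.toLp 2 v : EuclideanSpace ℂ (Fin n)) (WithLp.toLp 2 w)

theorem dotProduct_self_eq (v : Fin n → ℂ) : star v ⬝ᵥ v = ((vnorm v ^ 2 : ℝ) : ℂ) := by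
  have := inner_self_eq_norm_sq_to_K (𝕜 := ℂ) (WithLp.toLp 2 v : EuclideanSpace ℂ (Fin n))
  rw [EuclideanSpace.inner_eq_star_dotProduct, dotProduct_comm] at this
  simpa [vnorm] using this

theorem continuous_tgram {ι : Type*} : Continuous (tgram (n := n) (ι := ι)) := by
  refine continuous_pi fun i => continuous_pi fun j => ?_
  simp only [tgram_apply, dotProduct]
  fun_prop

/-- The tuple obtained by the right action of a matrix. -/
def tmul {ι κ : Type*} [Fintype κ] (x : κ → Fin n → ℂ) (S : Matrix κ ι ℂ) : ι → Fin n → ℂ :=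
  fun i => ∑ j, S j i • x j

theorem tgram_tmul {ι κ : Type*} [Fintype ι] [Fintype κ] (x : κ → Fin n → ℂ) (S : Matrix κ ι ℂ) :
    tgram (tmul x S) = Sᴴ * tgram x * S := by
  rw [tgram, tgram, ← gram_sum_smul]
  congr 1
  ext i : 1
  simp [tmul, WithLp.toLp_sum]

theorem tmul_mul {ι κ μ : Type*} [Fintype κ] [Fintype μ] (x : κ → Fin n → ℂ) (S : Matrix κ μ ℂ)
    (T : Matrix μ ι ℂ) : tmul (tmul x S) T = tmul x (S * T) := by
  ext i a
  simp only [tmul, Finset.sum_apply, Pi.smul_apply, smul_eq_mul, mul_apply, Finset.mul_sum,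
    Finset.sum_mul]
  rw [Finset.sum_comm]
  exact Finset.sum_congr rfl fun j _ => Finset.sum_congr rfl fun l _ => by ring

theorem tmul_one {ι : Type*} [Fintype ι] [DecidableEq ι] (x : ι → Fin n → ℂ) :
    tmul x 1 = x := by
  ext i : 1
  simp [tmul, Matrix.one_apply, ite_smul]

theorem tmul_sub {ι κ : Type*} [Fintype κ] (x y : κ → Fin n → ℂ) (S : Matrix κ ι ℂ) :
    tmul (x - y) S = tmul x S - tmul y S := by
  ext i a
  simp [tmul, mul_sub]

theorem vnorm_tmul_le {ι κ : Type*} [Fintype κ] (x : κ → Fin n → ℂ) (S : Matrix κ ι ℂ) {δ : ℝ}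
    (hx : ∀ j, vnorm (x j) ≤ δ) (i : ι) : vnorm (tmul x S i) ≤ (∑ j, ‖S j i‖) * δ := by
  refine (vnorm_sum_le _ _).trans ?_
  rw [Finset.sum_mul]
  refine Finset.sum_le_sum fun j _ => ?_
  rw [vnorm_smul]
  exact mul_le_mul_of_nonneg_left (hx j) (norm_nonneg _)

/-- The diagonal action of a unitary matrix on tuples of vectors. -/
def uact {ι : Type*} (u : unitaryGroup (Fin n) ℂ) (x : ι → Fin n → ℂ) : ι → Fin n → ℂ :=
  fun i => (u : Matrix (Fin n) (Fin n) ℂ) *ᵥ x i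

theorem dotProduct_mulVec_unitary (u : unitaryGroup (Fin n) ℂ) (v w : Fin n → ℂ) :
    star ((u : Matrix (Fin n) (Fin n) ℂ) *ᵥ v) ⬝ᵥ ((u : Matrix (Fin n) (Fin n) ℂ) *ᵥ w) =
      star v ⬝ᵥ w := by
  rw [star_mulVec, dotProduct_mulVec, vecMul_vecMul, ← star_eq_conjTranspose,
    UnitaryGroup.star_mul_self, vecMul_one]

theorem tgram_uact {ι : Type*} (u : unitaryGroup (Fin n) ℂ) (x : ι → Fin n → ℂ) :
    tgram (uact u x) = tgram x := by
  ext i j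
  rw [tgram_apply, tgram_apply]
  exact dotProduct_mulVec_unitary u _ _

theorem vnorm_mulVec_unitary (u : unitaryGroup (Fin n) ℂ) (v : Fin n → ℂ) :
    vnorm ((u : Matrix (Fin n) (Fin n) ℂ) *ᵥ v) = vnorm v := by
  have h := dotProduct_mulVec_unitary u v v
  rw [dotProduct_self_eq, dotProduct_self_eq] at h
  exact (pow_left_inj₀ (vnorm_nonneg _) (vnorm_nonneg _) two_ne_zero).mp (by exact_mod_cast h)

theorem uact_tmul {ι κ : Type*} [Fintype κ] (u : unitaryGroup (Fin n) ℂ) (x : κ → Fin n → ℂ)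
    (S : Matrix κ ι ℂ) : uact u (tmul x S) = tmul (uact u x) S := by
  ext i : 1
  simp only [uact, tmul, mulVec_sum, mulVec_smul]

theorem uact_mul {ι : Type*} (u w : unitaryGroup (Fin n) ℂ) (x : ι → Fin n → ℂ) :
    uact (u * w) x = uact u (uact w x) := by
  ext i : 1
  simp [uact, mulVec_mulVec]

theorem continuous_uact {ι : Type*} :
    Continuous fun p : unitaryGroup (Fin n) ℂ × (ι → Fin n → ℂ) => uact p.1 p.2 := by
  refine continuous_pi fun i => ?_
  exact (continuous_subtype_val.comp continuous_fst).matrix_mulVec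
    ((continuous_apply i).comp continuous_snd)

end Tuples

/-! ### Lebesgue volumes and Jacobians on spaces of tuples -/

section Volumes

open Matrix

variable {n : ℕ}

/-- The closed Euclidean ball of radius `ε` around the origin of `ℂⁿ`. -/
def cball (n : ℕ) (ε : ℝ) : Set (Fin n → ℂ) := {v | vnorm v ≤ ε}

theorem measurableSet_cball (ε : ℝ) : MeasurableSet (cball n ε) :=
  (isClosed_le continuous_vnorm continuous_const).measurableSet

theorem volume_cball {ε : ℝ} (hε : 0 ≤ ε) :
    volume (cball n ε) = ENNReal.ofReal ε ^ (2 * n) * ballVolume n := by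
  rcases Nat.eq_zero_or_pos n with rfl | hn
  · have : cball 0 ε = Set.univ := by
      ext v
      simp [cball, vnorm, EuclideanSpace.norm_eq, hε]
    rw [this]
    simp [ballVolume, volume_pi]
  have : Nonempty (Fin n) := ⟨⟨0, hn⟩⟩
  have h := Complex.volume_sum_rpow_le (ι := Fin n) one_le_two ε
  have h2 : {x : Fin n → ℂ | (∑ i, ‖x i‖ ^ (2 : ℝ)) ^ (1 / (2 : ℝ)) ≤ ε} = cball n ε := by
    ext v
    simp [cball, vnorm, EuclideanSpace.norm_eq, Real.sqrt_eq_rpow]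
  rw [h2] at h
  rw [h, ballVolume, Fintype.card_fin]
  congr 3
  · rw [div_self two_ne_zero, Real.Gamma_add_one one_ne_zero, Real.Gamma_one]
    ring
  · rw [mul_div_cancel_left₀ _ two_ne_zero, Real.Gamma_nat_eq_factorial]

theorem ballVolume_ne_zero (n : ℕ) : ballVolume n ≠ 0 := by
  rw [ballVolume, Ne, ENNReal.ofReal_eq_zero, not_le]
  positivity

theorem ballVolume_ne_top (n : ℕ) : ballVolume n ≠ ⊤ := ENNReal.ofReal_ne_top

theorem abs_det_restrictScalars {E : Type*} [AddCommGroup E] [Module ℂ E] (f : E →ₗ[ℂ] E) :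
    LinearMap.det (f.restrictScalars ℝ) = ‖LinearMap.det f‖ ^ 2 := by
  rw [LinearMap.det_restrictScalars, Algebra.norm_complex_apply, Complex.normSq_eq_norm_sq]

theorem measurePreserving_of_norm_det_eq_one {E : Type*} [NormedAddCommGroup E] [NormedSpace ℂ E]
    [FiniteDimensional ℂ E] [MeasurableSpace E] [BorelSpace E] (μ : Measure E)
    [μ.IsAddHaarMeasure] (f : E →ₗ[ℂ] E) (hf : ‖LinearMap.det f‖ = 1) :
    MeasurePreserving f μ μ := by
  have : FiniteDimensional ℝ E := FiniteDimensional.complexToReal E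
  have h := abs_det_restrictScalars f
  rw [hf, one_pow] at h
  refine ⟨(f.restrictScalars ℝ).continuous_of_finiteDimensional.measurable, ?_⟩
  have := Measure.map_linearMap_addHaar_eq_smul_addHaar μ (f := f.restrictScalars ℝ)
    (by rw [h]; exact one_ne_zero)
  rw [h] at this
  simpa using this

theorem measurePreserving_mulVec (u : unitaryGroup (Fin n) ℂ) :
    MeasurePreserving fun v : Fin n → ℂ => (u : Matrix (Fin n) (Fin n) ℂ) *ᵥ v := by
  refine measurePreserving_of_norm_det_eq_one volume (Matrix.toLin' u.1) ?_
  rw [LinearMap.det_toLin']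
  have := (Unitary.mem_iff.mp (det_of_mem_unitary u.2)).1
  exact CStarRing.norm_of_mem_unitary (det_of_mem_unitary u.2)

theorem measurePreserving_uact {ι : Type*} [Fintype ι] (u : unitaryGroup (Fin n) ℂ) :
    MeasurePreserving (uact u : (ι → Fin n → ℂ) → ι → Fin n → ℂ) :=
  volume_preserving_pi fun _ => measurePreserving_mulVec u

instance isAddHaarMeasure_volume_tuple {ι : Type*} [Fintype ι] :
    (volume : Measure (ι → Fin n → ℂ)).IsAddHaarMeasure :=
  Measure.pi.isAddHaarMeasure _

instance isAddHaarMeasure_volume_tuples {ι κ : Type*} [Fintype ι] [Fintype κ] :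
    (volume : Measure (ι → κ → Fin n → ℂ)).IsAddHaarMeasure :=
  Measure.pi.isAddHaarMeasure _

/-- The right action of a square matrix on tuples, as a linear map. -/
def tmulLin {ι : Type*} [Fintype ι] (n : ℕ) (S : Matrix ι ι ℂ) :
    (ι → Fin n → ℂ) →ₗ[ℂ] (ι → Fin n → ℂ) where
  toFun x := tmul x S
  map_add' x y := by ext i a; simp [tmul, Finset.sum_add_distrib]
  map_smul' c x := by ext i a; simp [tmul, Finset.mul_sum, mul_left_comm]

/-- Read coordinate by coordinate in `ℂⁿ`, the right action consists of `n` independent copies of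
the transpose of `S`. -/
theorem det_tmulLin {ι : Type*} [Fintype ι] [DecidableEq ι] (S : Matrix ι ι ℂ) :
    LinearMap.det (tmulLin n S) = S.det ^ n := by
  let e : (ι → Fin n → ℂ) ≃ₗ[ℂ] (Fin n → ι → ℂ) :=
    { toFun := fun x a i => x i a
      invFun := fun x i a => x a i
      map_add' := fun _ _ => rfl
      map_smul' := fun _ _ => rfl
      left_inv := fun _ => rfl
      right_inv := fun _ => rfl }
  have h : (e : (ι → Fin n → ℂ) →ₗ[ℂ] (Fin n → ι → ℂ)) ∘ₗ tmulLin n S ∘ₗ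
      (e.symm : (Fin n → ι → ℂ) →ₗ[ℂ] (ι → Fin n → ℂ)) =
      LinearMap.pi fun a => (Matrix.toLin' Sᵀ).comp (LinearMap.proj a) := by
    refine LinearMap.ext fun x => ?_
    ext a i
    simp [e, tmulLin, tmul, mulVec, dotProduct]
  rw [← LinearMap.det_conj (tmulLin n S) e, h, LinearMap.det_pi]
  simp

theorem volume_preimage_tmul {ι : Type*} [Fintype ι] [DecidableEq ι] {S : Matrix ι ι ℂ}
    (hS : S.det ≠ 0) (A : Set (ι → Fin n → ℂ)) :
    ENNReal.ofReal (‖S.det‖ ^ 2) ^ n * volume ((fun x => tmul x S) ⁻¹' A) = volume A := by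
  have hd : LinearMap.det ((tmulLin n S).restrictScalars ℝ) = (‖S.det‖ ^ 2) ^ n := by
    rw [abs_det_restrictScalars, det_tmulLin, norm_pow, ← pow_mul, ← pow_mul, mul_comm]
  have hpos : (0 : ℝ) < (‖S.det‖ ^ 2) ^ n := by positivity
  have h := Measure.addHaar_preimage_linearMap (volume : Measure (ι → Fin n → ℂ))
    (f := (tmulLin n S).restrictScalars ℝ) (by rw [hd]; exact hpos.ne') A
  rw [hd] at h
  rw [show (fun x => tmul x S) ⁻¹' A = (tmulLin n S).restrictScalars ℝ ⁻¹' A from rfl, h,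
    abs_of_pos (inv_pos.mpr hpos), ← mul_assoc, ← ENNReal.ofReal_pow (by positivity),
    ← ENNReal.ofReal_mul hpos.le, mul_inv_cancel₀ hpos.ne', ENNReal.ofReal_one, one_mul]

theorem volume_translate_pi_cball {ι : Type*} [Fintype ι] (c : ι → Fin n → ℂ) {ε : ℝ}
    (hε : 0 ≤ ε) :
    volume {x : ι → Fin n → ℂ | ∀ i, vnorm (c i - x i) ≤ ε} =
      (ENNReal.ofReal ε ^ (2 * n) * ballVolume n) ^ Fintype.card ι := by
  have h1 : {x : ι → Fin n → ℂ | ∀ i, vnorm (c i - x i) ≤ ε} =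
      (fun x => x + -c) ⁻¹' Set.univ.pi fun _ => cball n ε := by
    ext x
    simp [cball, vnorm_sub_comm, ← sub_eq_add_neg]
  rw [h1, measure_preimage_add_right, volume_pi_pi]
  simp [volume_cball hε]

end Volumes

/-! ### Nearly orthonormal tuples are unitarily equivalent up to a small error -/

section Stiefel

open Matrix

variable {n : ℕ} {ι : Type*} [Fintype ι] [DecidableEq ι]

/-- The tuples whose Gram matrix is close to the identity matrix. -/
def nearOrthonormal (n : ℕ) (ι : Type*) [DecidableEq ι] (δ : ℝ) : Set (ι → Fin n → ℂ) :=
  {Z | ∀ i j, ‖tgram Z i j - (1 : Matrix ι ι ℂ) i j‖ ≤ δ}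

theorem measurableSet_nearOrthonormal (δ : ℝ) : MeasurableSet (nearOrthonormal n ι δ) := by
  refine IsClosed.measurableSet ?_
  simp only [nearOrthonormal, Set.ofPred_forall]
  exact isClosed_iInter fun i => isClosed_iInter fun j => isClosed_le
    (((continuous_tgram.matrix_elem i j).sub continuous_const).norm) continuous_const

/-- The orthonormal tuple is the polar part `Z B⁻¹`, with `B` the positive square root of the Gram
matrix. The error is governed by `B - 1`, which is dominated by `B² - 1`. -/
theorem exists_orthonormal_near {δ : ℝ} {Z : ι → Fin n → ℂ} (hZ : Z ∈ nearOrthonormal n ι δ)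
    (hdet : (tgram Z).det ≠ 0) :
    ∃ e : ι → Fin n → ℂ, tgram e = 1 ∧ ∀ i, vnorm (Z i - e i) ≤ Fintype.card ι * δ := by
  obtain ⟨B, hB, hBM⟩ := exists_conjTranspose_mul_self_eq (posSemidef_tgram Z)
  have hBH : Bᴴ = B := hB.isHermitian
  have hu : IsUnit B.det := by
    rw [isUnit_iff_ne_zero]
    rintro h
    rw [← hBM, det_mul, h, mul_zero] at hdet
    exact hdet rfl
  have h1 : B * B⁻¹ = 1 := mul_nonsing_inv _ hu
  have he : tgram (tmul Z B⁻¹) = 1 := by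
    rw [tgram_tmul, ← hBM]
    calc B⁻¹ᴴ * (Bᴴ * B) * B⁻¹ = (B * B⁻¹)ᴴ * (B * B⁻¹) := by
          rw [conjTranspose_mul]; noncomm_ring
      _ = 1 := by rw [h1]; simp
  refine ⟨tmul Z B⁻¹, he, fun i => ?_⟩
  have hδ : 0 ≤ δ := (norm_nonneg _).trans (hZ i i)
  have h2 : Z - tmul Z B⁻¹ = tmul (tmul Z B⁻¹) (B - 1) := by
    have : tmul (tmul Z B⁻¹) B = Z := by
      rw [tmul_mul, nonsing_inv_mul _ hu, tmul_one]
    ext j a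
    have h3 := congrFun (congrFun this j) a
    simp only [tmul, Pi.sub_apply, Finset.sum_apply, Pi.smul_apply, smul_eq_mul, Matrix.sub_apply,
      sub_mul, Finset.sum_sub_distrib] at h3 ⊢
    rw [h3]
    simp [Matrix.one_apply]
  have h3 : ((vnorm (Z i - tmul Z B⁻¹ i) ^ 2 : ℝ) : ℂ) =
      ((B - 1)ᴴ * (B - 1) : Matrix ι ι ℂ) i i := by
    rw [← dotProduct_self_eq, ← Pi.sub_apply, h2, ← tgram_apply, tgram_tmul, he, Matrix.mul_one]
  have h4 : (((tgram Z - 1)ᴴ * (tgram Z - 1)) - ((B - 1)ᴴ * (B - 1))).PosSemidef := by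
    -- With `tgram Z = B²`, the identity is `(B² - 1)² - (B - 1)² = (B - 1)(B² + 2B)(B - 1)`, and
    -- each summand on the right is positive semidefinite.
    have h5 : ((tgram Z - 1)ᴴ * (tgram Z - 1)) - ((B - 1)ᴴ * (B - 1)) =
        (B - 1)ᴴ * (Bᴴ * B) * (B - 1) + ((B - 1)ᴴ * B * (B - 1) + (B - 1)ᴴ * B * (B - 1)) := by
      rw [← hBM]
      simp only [conjTranspose_sub, conjTranspose_mul, conjTranspose_one, hBH]
      noncomm_ring
    rw [h5]
    have h6 := hB.conjTranspose_mul_mul_same (B - 1)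
    exact ((posSemidef_conjTranspose_mul_self B).conjTranspose_mul_mul_same (B - 1)).add
      (h6.add h6)
  have h7 := (Complex.le_def.mp (h4.diag_nonneg (i := i))).1
  rw [Matrix.sub_apply, ← h3, Complex.sub_re, Complex.ofReal_re, Complex.zero_re, sub_nonneg,
    mul_apply, Complex.re_sum] at h7
  have h8 : ∀ j, (((tgram Z - 1)ᴴ i j) * (tgram Z - 1) j i).re ≤ δ ^ 2 := by
    intro j
    have h9 := hZ j i
    rw [conjTranspose_apply, RCLike.star_def, mul_comm, Complex.mul_conj, Complex.ofReal_re,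
      Complex.normSq_eq_norm_sq, Matrix.sub_apply]
    exact pow_le_pow_left₀ (norm_nonneg _) h9 2
  have h10 := h7.trans (Finset.sum_le_sum fun j _ => h8 j)
  rw [Finset.sum_const, Finset.card_univ, nsmul_eq_mul] at h10
  -- The column sum yields the square root of the cardinality times `δ`; this is rounded up to the
  -- cardinality times `δ`.
  have hc : (1 : ℝ) ≤ Fintype.card ι := by
    exact_mod_cast Fintype.card_pos_iff.mpr ⟨i⟩
  refine (pow_le_pow_iff_left₀ (vnorm_nonneg _) (by positivity) two_ne_zero).mp ?_
  rw [mul_pow]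
  nlinarith [sq_nonneg δ]

theorem exists_unitary_single (ψ : ι ↪ Fin n) {e : ι → Fin n → ℂ} (he : tgram e = 1) :
    ∃ u : unitaryGroup (Fin n) ℂ, ∀ i,
      (u : Matrix (Fin n) (Fin n) ℂ) *ᵥ Pi.single (ψ i) 1 = e i := by
  let v : ι → EuclideanSpace ℂ (Fin n) := fun i => WithLp.toLp 2 (e i)
  have hv : Orthonormal ℂ v := gram_eq_one_iff_orthonormal.mp he
  let v' : Fin n → EuclideanSpace ℂ (Fin n) := Function.extend ψ v 0
  have hv' : Orthonormal ℂ ((Set.range ψ).domRestrict v') := by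
    have h1 : (Set.range ψ).domRestrict v' = v ∘ (Equiv.ofInjective ψ ψ.injective).symm := by
      ext1 ⟨_, i, rfl⟩
      simp [v', Set.domRestrict, ψ.injective.extend_apply]
    rw [h1]
    exact hv.comp _ (Equiv.injective _)
  obtain ⟨b, hb⟩ := hv'.exists_orthonormalBasis_extension_of_card_eq (by simp)
  refine ⟨⟨(EuclideanSpace.basisFun (Fin n) ℂ).toBasis.toMatrix b,
    OrthonormalBasis.toMatrix_orthonormalBasis_mem_unitary _ b⟩, fun i => ?_⟩
  ext a
  have h2 := hb (ψ i) ⟨i, rfl⟩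
  simp [Module.Basis.toMatrix_apply, h2, v', ψ.injective.extend_apply, v]

/-- `U(n)` acts transitively on orthonormal frames: both frames are images of the same coordinate
vectors. That there are at most `n` of them follows from the existence of a frame. -/
theorem exists_unitary_of_tgram_eq_one {e f : ι → Fin n → ℂ} (he : tgram e = 1)
    (hf : tgram f = 1) : ∃ u : unitaryGroup (Fin n) ℂ, uact u e = f := by
  have hc : Fintype.card ι ≤ Fintype.card (Fin n) := by
    have h := (gram_eq_one_iff_orthonormal.mp he).linearIndependent.fintype_card_le_finrank
    simpa using h
  obtain ⟨ψ⟩ := Function.Embedding.nonempty_of_card_le hc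
  obtain ⟨u, hu⟩ := exists_unitary_single ψ he
  obtain ⟨w, hw⟩ := exists_unitary_single ψ hf
  refine ⟨w * u⁻¹, ?_⟩
  have h1 : e = uact u fun i => Pi.single (ψ i) 1 := by ext i : 1; exact (hu i).symm
  rw [h1, ← uact_mul, inv_mul_cancel_right]
  ext i : 1
  exact hw i

theorem exists_unitary_near {δ : ℝ} {J Z : ι → Fin n → ℂ} (hJ : J ∈ nearOrthonormal n ι δ)
    (hZ : Z ∈ nearOrthonormal n ι δ) (hJd : (tgram J).det ≠ 0) (hZd : (tgram Z).det ≠ 0) :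
    ∃ u : unitaryGroup (Fin n) ℂ, ∀ i, vnorm (uact u J i - Z i) ≤ 2 * (Fintype.card ι * δ) := by
  obtain ⟨e, he, hJe⟩ := exists_orthonormal_near hJ hJd
  obtain ⟨f, hf, hZf⟩ := exists_orthonormal_near hZ hZd
  obtain ⟨u, hu⟩ := exists_unitary_of_tgram_eq_one he hf
  refine ⟨u, fun i => ?_⟩
  have h1 : vnorm (uact u J i - f i) ≤ Fintype.card ι * δ := by
    have : uact u J i - f i = (u : Matrix (Fin n) (Fin n) ℂ) *ᵥ (J i - e i) := by
      rw [mulVec_sub, ← hu]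
      rfl
    rw [this, vnorm_mulVec_unitary]
    exact hJe i
  have h2 := hZf i
  rw [vnorm_sub_comm] at h2
  have := vnorm_sub_le (uact u J i) (f i) (Z i)
  linarith

end Stiefel

/-! ### Haar probabilities expressed through Lebesgue volumes -/

section HaarAverage

open Matrix

variable {n : ℕ} {ι : Type*} [Fintype ι]

instance isHaarMeasure_unitaryHaar (n : ℕ) : (unitaryHaar n).IsHaarMeasure :=
  inferInstanceAs (Measure.haarMeasure _).IsHaarMeasure

instance isProbabilityMeasure_unitaryHaar (n : ℕ) : IsProbabilityMeasure (unitaryHaar n) :=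
  ⟨unitaryHaar_univ n⟩

theorem continuous_tmul {κ : Type*} [Fintype κ] (S : Matrix κ ι ℂ) :
    Continuous fun x : κ → Fin n → ℂ => tmul x S := by
  unfold tmul
  fun_prop

/-- After Fubini, the rotation of `Z` by `u` preserves both Lebesgue measure and `R`, so the inner
volume does not depend on `u`. -/
theorem lintegral_unitaryHaar_tmul {R : Set (ι → Fin n → ℂ)} (hR : MeasurableSet R)
    (hRu : ∀ u Z, uact u Z ∈ R ↔ Z ∈ R) (S : Matrix ι ι ℂ) (x : ι → Fin n → ℂ) (ε : ℝ) :
    ∫⁻ Z in R, unitaryHaar n {u | ∀ i, vnorm (tmul Z S i - uact u x i) ≤ ε} =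
      volume (R ∩ {Z | ∀ i, vnorm (tmul Z S i - x i) ≤ ε}) := by
  let T : Set ((ι → Fin n → ℂ) × unitaryGroup (Fin n) ℂ) :=
    {p | ∀ i, vnorm (tmul p.1 S i - uact p.2 x i) ≤ ε}
  have hcont : ∀ i, Continuous fun p : (ι → Fin n → ℂ) × unitaryGroup (Fin n) ℂ =>
      vnorm (tmul p.1 S i - uact p.2 x i) := fun i =>
    continuous_vnorm.comp (((continuous_apply i).comp ((continuous_tmul S).comp continuous_fst)).sub
      ((continuous_apply i).comp (continuous_uact.comp (continuous_snd.prodMk continuous_const))))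
  have hT : MeasurableSet T := by
    refine IsClosed.measurableSet ?_
    simp only [T, Set.ofPred_forall]
    exact isClosed_iInter fun i => isClosed_le (hcont i) continuous_const
  have h1 := Measure.prod_apply (μ := (volume : Measure (ι → Fin n → ℂ)).restrict R)
    (ν := unitaryHaar n) hT
  have h2 := Measure.prod_apply_symm (μ := (volume : Measure (ι → Fin n → ℂ)).restrict R)
    (ν := unitaryHaar n) hT
  have h3 : ∀ u : unitaryGroup (Fin n) ℂ,
      (volume : Measure (ι → Fin n → ℂ)).restrict R ((fun Z => (Z, u)) ⁻¹' T) =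
        volume (R ∩ {Z | ∀ i, vnorm (tmul Z S i - x i) ≤ ε}) := by
    intro u
    have hm : MeasurableSet ((fun Z => (Z, u)) ⁻¹' T) := measurable_prodMk_right hT
    rw [Measure.restrict_apply hm, ← (measurePreserving_uact u).measure_preimage
      (hm.inter hR).nullMeasurableSet]
    congr 1
    ext Z
    simp only [T, Set.mem_preimage, Set.mem_inter_iff, Set.mem_ofPred_eq, hRu, ← uact_tmul]
    rw [and_comm]
    refine and_congr_right fun _ => forall_congr' fun i => ?_
    rw [uact, uact, ← mulVec_sub, vnorm_mulVec_unitary]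
  simp only [h3, lintegral_const, measure_univ, mul_one] at h2
  rw [← h2, h1]
  rfl

theorem unitaryHaar_near_translate (w : unitaryGroup (Fin n) ℂ) (x y : ι → Fin n → ℂ) (ε : ℝ) :
    unitaryHaar n {u | ∀ i, vnorm (uact w y i - uact u x i) ≤ ε} =
      unitaryHaar n {u | ∀ i, vnorm (y i - uact u x i) ≤ ε} := by
  rw [← measure_preimage_mul (unitaryHaar n) w]
  congr 1
  ext u
  simp only [Set.mem_preimage, Set.mem_ofPred_eq, uact_mul]
  refine forall_congr' fun i => ?_
  rw [uact, uact, ← mulVec_sub, vnorm_mulVec_unitary]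

/-- By left invariance the Haar probability for `y` is that for `w y`, which for a suitable `w` is
within `θ` of `Z S`. Averaging over `Z ∈ R` turns it into a Lebesgue volume, so no density on the
Stiefel manifold is needed. -/
theorem unitaryHaar_near_mul_volume_le {R : Set (ι → Fin n → ℂ)} (hR : MeasurableSet R)
    (hRu : ∀ u Z, uact u Z ∈ R ↔ Z ∈ R) {S : Matrix ι ι ℂ} {x y : ι → Fin n → ℂ} {θ : ℝ}
    (hy : ∀ Z ∈ R, ∃ w : unitaryGroup (Fin n) ℂ, ∀ i, vnorm (uact w y i - tmul Z S i) ≤ θ)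
    (ε : ℝ) :
    unitaryHaar n {u | ∀ i, vnorm (y i - uact u x i) ≤ ε} * volume R ≤
      volume (R ∩ {Z | ∀ i, vnorm (tmul Z S i - x i) ≤ ε + θ}) := by
  rw [← lintegral_unitaryHaar_tmul hR hRu, ← setLIntegral_const]
  refine setLIntegral_mono_ae' hR (ae_of_all _ fun Z hZ => ?_)
  obtain ⟨w, hw⟩ := hy Z hZ
  rw [← unitaryHaar_near_translate w]
  refine measure_mono fun u hu i => ?_
  have h1 := hu i
  have h2 := hw i
  rw [vnorm_sub_comm] at h2
  have := vnorm_sub_le (tmul Z S i) (uact w y i) (uact u x i)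
  linarith

theorem volume_le_unitaryHaar_near_mul {R : Set (ι → Fin n → ℂ)} (hR : MeasurableSet R)
    (hRu : ∀ u Z, uact u Z ∈ R ↔ Z ∈ R) {S : Matrix ι ι ℂ} {x y : ι → Fin n → ℂ} {θ : ℝ}
    (hy : ∀ Z ∈ R, ∃ w : unitaryGroup (Fin n) ℂ, ∀ i, vnorm (uact w y i - tmul Z S i) ≤ θ)
    (ε : ℝ) :
    volume (R ∩ {Z | ∀ i, vnorm (tmul Z S i - x i) ≤ ε}) ≤
      unitaryHaar n {u | ∀ i, vnorm (y i - uact u x i) ≤ ε + θ} * volume R := by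
  rw [← lintegral_unitaryHaar_tmul hR hRu, ← setLIntegral_const]
  refine setLIntegral_mono_ae' hR (ae_of_all _ fun Z hZ => ?_)
  obtain ⟨w, hw⟩ := hy Z hZ
  rw [← unitaryHaar_near_translate w x y]
  refine measure_mono fun u hu i => ?_
  have h1 := hu i
  have h2 := hw i
  have := vnorm_sub_le (uact w y i) (tmul Z S i) (uact u x i)
  linarith

end HaarAverage

/-! ### Concentration in the unit ball: random vectors are long and nearly orthogonal -/

section UniformBall

open Matrix

variable {n : ℕ}

/-- The uniform probability measure on the unit ball of `ℂⁿ`. -/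
def unifBall (n : ℕ) : Measure (Fin n → ℂ) :=
  (ballVolume n)⁻¹ • (volume : Measure (Fin n → ℂ)).restrict (cball n 1)

theorem unifBall_cball {t : ℝ} (h0 : 0 ≤ t) (h1 : t ≤ 1) :
    unifBall n (cball n t) = ENNReal.ofReal t ^ (2 * n) := by
  rw [unifBall, Measure.smul_apply, Measure.restrict_apply (measurableSet_cball t),
    Set.inter_eq_self_of_subset_left (show cball n t ⊆ cball n 1 from fun v hv => le_trans hv h1),
    volume_cball h0,
    smul_eq_mul, mul_comm, mul_assoc, ENNReal.mul_inv_cancel (ballVolume_ne_zero n)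
    (ballVolume_ne_top n), mul_one]

instance isProbabilityMeasure_unifBall (n : ℕ) : IsProbabilityMeasure (unifBall n) where
  measure_univ := by
    rw [unifBall, Measure.smul_apply, Measure.restrict_apply_univ, volume_cball zero_le_one]
    simp [ENNReal.inv_mul_cancel (ballVolume_ne_zero n) (ballVolume_ne_top n)]

theorem measurePreserving_mulVec_unifBall (u : unitaryGroup (Fin n) ℂ) :
    MeasurePreserving (fun v : Fin n → ℂ => (u : Matrix (Fin n) (Fin n) ℂ) *ᵥ v)
      (unifBall n) (unifBall n) := by
  have h := ((measurePreserving_mulVec u).restrict_preimage (measurableSet_cball 1)).smul_measure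
    (ballVolume n)⁻¹
  have h2 : (fun v : Fin n → ℂ => (u : Matrix (Fin n) (Fin n) ℂ) *ᵥ v) ⁻¹' cball n 1 =
      cball n 1 := by
    ext v
    simp [cball, vnorm_mulVec_unitary]
  rw [h2] at h
  exact h

theorem measurable_sq_norm_dotProduct (w : Fin n → ℂ) :
    Measurable fun v : Fin n → ℂ => ENNReal.ofReal (‖star w ⬝ᵥ v‖ ^ 2) := by
  refine (Continuous.measurable ?_).ennreal_ofReal
  unfold dotProduct
  fun_prop

/-- By unitary invariance the second moment is the same in every direction, and over the `n`
coordinate directions these moments sum to the mean of `‖v‖² ≤ 1`. -/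
theorem card_mul_lintegral_unifBall_le {w : Fin n → ℂ} (hw : vnorm w = 1) :
    n * ∫⁻ v, ENNReal.ofReal (‖star w ⬝ᵥ v‖ ^ 2) ∂unifBall n ≤ 1 := by
  have h1 : ∀ a : Fin n, ∫⁻ v, ENNReal.ofReal (‖star w ⬝ᵥ v‖ ^ 2) ∂unifBall n =
      ∫⁻ v, ENNReal.ofReal (‖v a‖ ^ 2) ∂unifBall n := by
    intro a
    obtain ⟨u, hu⟩ := exists_unitary_single (ι := Unit)
      ⟨fun _ => a, fun _ _ _ => rfl⟩ (e := fun _ => w) (by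
        ext i j
        rw [tgram_apply, dotProduct_self_eq, hw]
        simp)
    have hu : (u : Matrix (Fin n) (Fin n) ℂ) *ᵥ Pi.single a 1 = w := hu ()
    rw [← (measurePreserving_mulVec_unifBall u).lintegral_comp (measurable_sq_norm_dotProduct w)]
    refine lintegral_congr fun v => ?_
    rw [← hu, dotProduct_mulVec_unitary]
    simp
  have h2 : n * ∫⁻ v, ENNReal.ofReal (‖star w ⬝ᵥ v‖ ^ 2) ∂unifBall n =
      ∫⁻ v, ∑ a, ENNReal.ofReal (‖v a‖ ^ 2) ∂unifBall n := by
    rw [lintegral_finsetSum, Finset.sum_congr rfl fun a _ => (h1 a).symm]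
    · simp
    · intro a _
      exact (by fun_prop : Measurable fun v : Fin n → ℂ => ‖v a‖ ^ 2).ennreal_ofReal
  rw [h2, unifBall, lintegral_smul_measure]
  have h3 : ∫⁻ v in cball n 1, ∑ a, ENNReal.ofReal (‖v a‖ ^ 2) ≤ ∫⁻ _ in cball n 1, 1 := by
    refine setLIntegral_mono_ae' (measurableSet_cball 1) (ae_of_all _ fun v hv => ?_)
    rw [← ENNReal.ofReal_sum_of_nonneg fun _ _ => by positivity, ← ENNReal.ofReal_one]
    refine ENNReal.ofReal_le_ofReal ?_
    have h4 : ∑ a, ‖v a‖ ^ 2 = vnorm v ^ 2 := by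
      rw [vnorm, EuclideanSpace.norm_sq_eq]
    rw [h4]
    exact pow_le_one₀ (vnorm_nonneg v) hv
  refine (mul_le_mul_right h3 _).trans ?_
  rw [setLIntegral_const, one_mul, volume_cball zero_le_one]
  simp [ENNReal.inv_mul_cancel (ballVolume_ne_zero n) (ballVolume_ne_top n)]

/-- Chebyshev's inequality, applied to `w` rescaled to unit length; a zero `w` is treated
separately. -/
theorem unifBall_inner_ge_le (hn : 0 < n) {w : Fin n → ℂ} {C t : ℝ} (hw : vnorm w ≤ C)
    (ht : 0 < t) :
    unifBall n {v | t ≤ ‖star w ⬝ᵥ v‖} ≤ ENNReal.ofReal (C ^ 2 / t ^ 2 / n) := by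
  have hC : 0 ≤ C := (vnorm_nonneg w).trans hw
  have hn' : (0 : ℝ) < n := by exact_mod_cast hn
  rcases eq_or_ne (vnorm w) 0 with h0 | h0
  · have : {v : Fin n → ℂ | t ≤ ‖star w ⬝ᵥ v‖} = ∅ := by
      refine Set.eq_empty_of_forall_notMem fun v (hv : t ≤ _) => ?_
      have := norm_dotProduct_le w v
      rw [h0, zero_mul] at this
      linarith
    rw [this, measure_empty]
    exact zero_le
  have hpos : 0 < vnorm w := (vnorm_nonneg w).lt_of_ne' h0
  let w1 : Fin n → ℂ := ((vnorm w)⁻¹ : ℂ) • w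
  have hw1 : vnorm w1 = 1 := by
    rw [vnorm_smul]
    simp [abs_of_pos hpos, h0]
  let s : ℝ := t / vnorm w
  have hs : 0 < s := div_pos ht hpos
  have h1 : {v : Fin n → ℂ | t ≤ ‖star w ⬝ᵥ v‖} ⊆
      {v | ENNReal.ofReal (s ^ 2) ≤ ENNReal.ofReal (‖star w1 ⬝ᵥ v‖ ^ 2)} := by
    intro v (hv : t ≤ _)
    refine ENNReal.ofReal_le_ofReal (pow_le_pow_left₀ hs.le ?_ 2)
    have : ‖star w1 ⬝ᵥ v‖ = ‖star w ⬝ᵥ v‖ / vnorm w := by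
      simp only [w1, star_smul, smul_dotProduct, smul_eq_mul, norm_mul, norm_star, norm_inv,
        Complex.norm_real, Real.norm_eq_abs, abs_of_pos hpos]
      field_simp
    rw [this]
    exact div_le_div_of_nonneg_right hv hpos.le
  refine (measure_mono h1).trans ?_
  have h2 := mul_meas_ge_le_lintegral (μ := unifBall n) (measurable_sq_norm_dotProduct w1)
    (ENNReal.ofReal (s ^ 2))
  have h3 := (mul_le_mul_right h2 (n : ℝ≥0∞)).trans (card_mul_lintegral_unifBall_le hw1)
  rw [← ENNReal.ofReal_natCast, ← mul_assoc, ← ENNReal.ofReal_mul hn'.le] at h3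
  have h4 : (0 : ℝ) < n * s ^ 2 := by positivity
  have h5 := ENNReal.le_div_iff_mul_le (.inl (ENNReal.ofReal_pos.mpr h4).ne')
    (.inl ENNReal.ofReal_ne_top) |>.mpr ((mul_comm _ _).trans_le h3)
  refine h5.trans ?_
  rw [← ENNReal.ofReal_one, ← ENNReal.ofReal_div_of_pos h4]
  refine ENNReal.ofReal_le_ofReal ?_
  have h6 : vnorm w ^ 2 ≤ C ^ 2 := pow_le_pow_left₀ hpos.le hw 2
  have h7 : 1 / (n * s ^ 2) = vnorm w ^ 2 / t ^ 2 / n := by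
    simp only [s]
    field_simp
  rw [h7]
  gcongr

variable {ι α : Type*} [Fintype ι] [Fintype α]

theorem pi_unifBall_pair_le (hn : 0 < n) {i j : ι} (hij : i ≠ j) {t : ℝ} (ht : 0 < t) :
    Measure.pi (fun _ : ι => unifBall n) {κ | t ≤ ‖star (κ i) ⬝ᵥ κ j‖} ≤
      ENNReal.ofReal (1 ^ 2 / t ^ 2 / n) := by
  have h1 : ProbabilityTheory.iIndepFun (fun (i : ι) (κ : ι → Fin n → ℂ) => κ i)
      (Measure.pi fun _ : ι => unifBall n) :=
    ProbabilityTheory.iIndepFun_pi (X := fun _ v => v) fun _ => aemeasurable_id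
  have h2 := (ProbabilityTheory.indepFun_iff_map_prod_eq_prod_map_map
    (measurable_pi_apply i).aemeasurable (measurable_pi_apply j).aemeasurable).mp
    (h1.indepFun hij)
  rw [(measurePreserving_eval (fun _ : ι => unifBall n) i).map_eq,
    (measurePreserving_eval (fun _ : ι => unifBall n) j).map_eq] at h2
  have hm : MeasurableSet {p : (Fin n → ℂ) × (Fin n → ℂ) | t ≤ ‖star p.1 ⬝ᵥ p.2‖} := by
    refine (isClosed_le continuous_const ?_).measurableSet
    unfold dotProduct
    fun_prop
  have h3 : Measure.pi (fun _ : ι => unifBall n) {κ | t ≤ ‖star (κ i) ⬝ᵥ κ j‖} =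
      (unifBall n).prod (unifBall n) {p | t ≤ ‖star p.1 ⬝ᵥ p.2‖} := by
    rw [← h2, Measure.map_apply (by fun_prop) hm]
    rfl
  rw [h3, Measure.prod_apply hm]
  have h4 : ∀ᵐ v ∂unifBall n, v ∈ cball n 1 := by
    refine Measure.ae_smul_measure ?_ _
    exact ae_restrict_mem (measurableSet_cball 1)
  calc ∫⁻ v, unifBall n (Prod.mk v ⁻¹' {p | t ≤ ‖star p.1 ⬝ᵥ p.2‖}) ∂unifBall n
      ≤ ∫⁻ _, ENNReal.ofReal (1 ^ 2 / t ^ 2 / n) ∂unifBall n := by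
        refine lintegral_mono_ae (h4.mono fun v hv => ?_)
        exact unifBall_inner_ge_le hn hv ht
    _ = _ := by simp

/-- Tuples in the unit ball that are nearly orthogonal, not too short, and nearly orthogonal to
given vectors. -/
def spreadTuples (w : α → Fin n → ℂ) (ρ t : ℝ) : Set (ι → Fin n → ℂ) :=
  {κ | (∀ j, ρ ≤ vnorm (κ j)) ∧ (∀ i j, i ≠ j → ‖star (κ i) ⬝ᵥ κ j‖ ≤ t) ∧
    ∀ a j, ‖star (w a) ⬝ᵥ κ j‖ ≤ t}

theorem measurableSet_spreadTuples (w : α → Fin n → ℂ) (ρ t : ℝ) :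
    MeasurableSet (spreadTuples w ρ t : Set (ι → Fin n → ℂ)) := by
  refine IsClosed.measurableSet ?_
  simp only [spreadTuples, Set.ofPred_and, Set.ofPred_forall, dotProduct]
  refine ((isClosed_iInter fun j => isClosed_le continuous_const
    (continuous_vnorm.comp (continuous_apply j))).inter
    ((isClosed_iInter fun i => isClosed_iInter fun j => isClosed_iInter fun _ =>
      isClosed_le (by fun_prop) continuous_const).inter
    (isClosed_iInter fun a => isClosed_iInter fun j =>
      isClosed_le (by fun_prop) continuous_const)))

theorem pi_unifBall_compl_spreadTuples_le (hn : 0 < n) {w : α → Fin n → ℂ} {C ρ t : ℝ}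
    (hw : ∀ a, vnorm (w a) ≤ C) (h0 : 0 ≤ ρ) (h1 : ρ ≤ 1) (ht : 0 < t) :
    Measure.pi (fun _ : ι => unifBall n) (spreadTuples w ρ t)ᶜ ≤
      ENNReal.ofReal (Fintype.card ι * ρ ^ (2 * n) +
        (Fintype.card ι * Fintype.card ι * (1 ^ 2 / t ^ 2 / n) +
          Fintype.card α * Fintype.card ι * (C ^ 2 / t ^ 2 / n))) := by
  classical
  have hsub : (spreadTuples w ρ t : Set (ι → Fin n → ℂ))ᶜ ⊆
      (⋃ j, {κ | vnorm (κ j) ≤ ρ}) ∪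
      ((⋃ i, ⋃ j, {κ | i ≠ j ∧ t ≤ ‖star (κ i) ⬝ᵥ κ j‖}) ∪
      (⋃ a, ⋃ j, {κ | t ≤ ‖star (w a) ⬝ᵥ κ j‖})) := by
    intro κ hκ
    simp only [spreadTuples, Set.mem_compl_iff, Set.mem_ofPred_eq, not_and_or, not_forall,
      not_le] at hκ
    simp only [Set.mem_union, Set.mem_iUnion, Set.mem_ofPred_eq]
    rcases hκ with ⟨j, hj⟩ | ⟨i, j, hij, h⟩ | ⟨a, j, h⟩
    · exact .inl ⟨j, hj.le⟩
    · exact .inr (.inl ⟨i, j, hij, h.le⟩)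
    · exact .inr (.inr ⟨a, j, h.le⟩)
  have e1 : ∀ j : ι, Measure.pi (fun _ : ι => unifBall n) {κ | vnorm (κ j) ≤ ρ} =
      ENNReal.ofReal (ρ ^ (2 * n)) := by
    intro j
    rw [ENNReal.ofReal_pow h0, ← unifBall_cball h0 h1]
    exact (measurePreserving_eval (fun _ : ι => unifBall n) j).measure_preimage
      (measurableSet_cball ρ).nullMeasurableSet
  have e2 : ∀ i j : ι, Measure.pi (fun _ : ι => unifBall n)
      {κ | i ≠ j ∧ t ≤ ‖star (κ i) ⬝ᵥ κ j‖} ≤ ENNReal.ofReal (1 ^ 2 / t ^ 2 / n) := by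
    intro i j
    rcases eq_or_ne i j with h | h
    · simp [h]
    · simpa only [ne_eq, h, not_false_eq_true, true_and] using pi_unifBall_pair_le hn h ht
  have e3 : ∀ (a : α) (j : ι), Measure.pi (fun _ : ι => unifBall n)
      {κ | t ≤ ‖star (w a) ⬝ᵥ κ j‖} ≤ ENNReal.ofReal (C ^ 2 / t ^ 2 / n) := by
    intro a j
    have hm : MeasurableSet {v : Fin n → ℂ | t ≤ ‖star (w a) ⬝ᵥ v‖} := by
      refine (isClosed_le continuous_const ?_).measurableSet
      unfold dotProduct
      fun_prop
    have := (measurePreserving_eval (fun _ : ι => unifBall n) j).measure_preimage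
      hm.nullMeasurableSet
    exact this.trans_le (unifBall_inner_ge_le hn (hw a) ht)
  refine (measure_mono hsub).trans ((measure_union_le _ _).trans ?_)
  rw [ENNReal.ofReal_add (by positivity) (by positivity),
    ENNReal.ofReal_add (by positivity) (by positivity)]
  refine add_le_add ?_ ((measure_union_le _ _).trans (add_le_add ?_ ?_))
  · refine (measure_iUnion_fintype_le _ _).trans ?_
    simp only [e1, Finset.sum_const, Finset.card_univ, nsmul_eq_mul]
    rw [ENNReal.ofReal_mul (by positivity), ENNReal.ofReal_natCast]
  · refine (measure_iUnion_fintype_le _ _).trans ((Finset.sum_le_sum fun i _ =>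
      (measure_iUnion_fintype_le _ _).trans (Finset.sum_le_sum fun j _ => e2 i j)).trans ?_)
    simp only [Finset.sum_const, Finset.card_univ, nsmul_eq_mul]
    rw [ENNReal.ofReal_mul (by positivity), ENNReal.ofReal_mul (by positivity),
      ENNReal.ofReal_natCast, mul_assoc]
  · refine (measure_iUnion_fintype_le _ _).trans ((Finset.sum_le_sum fun i _ =>
      (measure_iUnion_fintype_le _ _).trans (Finset.sum_le_sum fun j _ => e3 i j)).trans ?_)
    simp only [Finset.sum_const, Finset.card_univ, nsmul_eq_mul]
    rw [ENNReal.ofReal_mul (by positivity), ENNReal.ofReal_mul (by positivity),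
      ENNReal.ofReal_natCast, ENNReal.ofReal_natCast, mul_assoc]

theorem volume_inter_pi_cball (G : Set (ι → Fin n → ℂ)) (hG : MeasurableSet G) :
    volume ((Set.univ.pi fun _ => cball n 1) ∩ G) =
      ballVolume n ^ Fintype.card ι * Measure.pi (fun _ : ι => unifBall n) G := by
  have h1 : (volume : Measure (Fin n → ℂ)).restrict (cball n 1) = ballVolume n • unifBall n := by
    rw [unifBall, smul_smul, ENNReal.mul_inv_cancel (ballVolume_ne_zero n) (ballVolume_ne_top n),
      one_smul]
  have h2 : (volume : Measure (ι → Fin n → ℂ)).restrict (Set.univ.pi fun _ => cball n 1) =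
      ballVolume n ^ Fintype.card ι • Measure.pi (fun _ : ι => unifBall n) := by
    rw [volume_pi, Measure.restrict_pi_pi]
    refine Measure.pi_eq fun s _ => ?_
    rw [Measure.smul_apply, Measure.pi_pi, h1]
    simp [Finset.prod_mul_distrib, smul_eq_mul]
  rw [Set.inter_comm, ← Measure.restrict_apply hG, h2, Measure.smul_apply, smul_eq_mul]

/-- A union bound shows that the bad tuples have probability tending to zero. The bound is uniform
in `w`, which matters because `w` will be a tuple in `ℂⁿ` that varies with `n`. -/
theorem eventually_volume_spreadTuples_ge (ι α : Type*) [Fintype ι] [Fintype α] (C : ℝ) {ρ t : ℝ}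
    (h0 : 0 ≤ ρ) (h1 : ρ < 1) (ht : 0 < t) :
    ∀ᶠ n : ℕ in atTop, ∀ w : α → Fin n → ℂ, (∀ a, vnorm (w a) ≤ C) →
      ballVolume n ^ Fintype.card ι ≤
        2 * volume ((Set.univ.pi fun _ => cball n 1) ∩
          (spreadTuples w ρ t : Set (ι → Fin n → ℂ))) := by
  have hlim : Tendsto (fun n : ℕ => Fintype.card ι * ρ ^ (2 * n) +
        (Fintype.card ι * Fintype.card ι * (1 ^ 2 / t ^ 2 / n) +
          Fintype.card α * Fintype.card ι * (C ^ 2 / t ^ 2 / n))) atTop (𝓝 0) := by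
    have a1 : Tendsto (fun n : ℕ => ρ ^ (2 * n)) atTop (𝓝 0) := by
      simp only [pow_mul]
      exact tendsto_pow_atTop_nhds_zero_of_lt_one (by positivity) (pow_lt_one₀ h0 h1 two_ne_zero)
    have a2 : ∀ c : ℝ, Tendsto (fun n : ℕ => c / (n : ℝ)) atTop (𝓝 0) :=
      fun c => tendsto_const_div_atTop_nhds_zero_nat c
    have h := (a1.const_mul (Fintype.card ι : ℝ)).add
      (((a2 (1 ^ 2 / t ^ 2)).const_mul (Fintype.card ι * Fintype.card ι : ℝ)).add
        ((a2 (C ^ 2 / t ^ 2)).const_mul (Fintype.card α * Fintype.card ι : ℝ)))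
    simp only [mul_zero, add_zero] at h
    exact h
  filter_upwards [hlim.eventually (gt_mem_nhds (by norm_num : (0 : ℝ) < 1 / 2)),
    eventually_gt_atTop 0] with n hn hn0 w hw
  have hG := measurableSet_spreadTuples (ι := ι) w ρ t
  rw [volume_inter_pi_cball _ hG, mul_left_comm]
  have h2 := (pi_unifBall_compl_spreadTuples_le (ι := ι) hn0 hw h0 h1.le ht).trans
    (ENNReal.ofReal_le_ofReal hn.le)
  have h3 := prob_add_prob_compl (μ := Measure.pi fun _ : ι => unifBall n) hG
  have h4 : (1 : ℝ≥0∞) ≤ 2 * Measure.pi (fun _ : ι => unifBall n) (spreadTuples w ρ t) := by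
    have h5 : ENNReal.ofReal (1 / 2) = 2⁻¹ := by
      rw [one_div, ENNReal.ofReal_inv_of_pos two_pos]; simp
    rw [h5] at h2
    have h6 : (1 : ℝ≥0∞) ≤ Measure.pi (fun _ : ι => unifBall n) (spreadTuples w ρ t) + 2⁻¹ :=
      h3.symm.le.trans (by gcongr)
    have h7 : (2 : ℝ≥0∞)⁻¹ ≤ Measure.pi (fun _ : ι => unifBall n) (spreadTuples w ρ t) := by
      have h8 := tsub_le_iff_right.mpr h6
      rwa [ENNReal.one_sub_inv_two] at h8
    calc (1 : ℝ≥0∞) = 2 * 2⁻¹ := (ENNReal.mul_inv_cancel two_ne_zero ENNReal.ofNat_ne_top).symm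
      _ ≤ _ := by gcongr
  calc ballVolume n ^ Fintype.card ι = ballVolume n ^ Fintype.card ι * 1 := (mul_one _).symm
    _ ≤ _ := by gcongr

end UniformBall

/-! ### Increments along the tree as volume-preserving coordinates -/

section TreeCoordinates

open Matrix

variable {S : Type*} [Fintype S] [DecidableEq S] {n k : ℕ} {F : Finset (FreeGroup S)}

theorem det_one_sub_of_isNilpotent {E : Type*} [AddCommGroup E] [Module ℂ E]
    [FiniteDimensional ℂ E] {N : E →ₗ[ℂ] E} (hN : IsNilpotent N) :
    LinearMap.det (LinearMap.id - N) = 1 := by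
  have h1 := LinearMap.eval_charpoly N 1
  rw [hN.charpoly_eq_X_pow_finrank] at h1
  simpa [Module.algebraMap_end_eq_smul_id] using h1.symm

/-- The Gram matrix of a family of tuples indexed by `F`. -/
def blockGram (X : F → Fin k → Fin n → ℂ) : Matrix (F × Fin k) (F × Fin k) ℂ :=
  tgram fun p : F × Fin k => X p.1 p.2

/-- The part of the orbit of the tuple `v` that is indexed by `F`. -/
def orbit (F : Finset (FreeGroup S)) (u : S → unitaryGroup (Fin n) ℂ) (v : Fin k → Fin n → ℂ) :
    F → Fin k → Fin n → ℂ :=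
  fun g => uact (FreeGroup.lift u (g : FreeGroup S)) v

theorem blockGram_orbit (u : S → unitaryGroup (Fin n) ℂ) (v : Fin k → Fin n → ℂ)
    (p q : F × Fin k) :
    blockGram (orbit F u v) p q =
      typeMap (FreeGroup.lift u) v ((p.1 : FreeGroup S)⁻¹ * q.1) p.2 q.2 := by
  have h : uact (FreeGroup.lift u (q.1 : FreeGroup S)) v q.2 =
      ((FreeGroup.lift u (p.1 : FreeGroup S) : unitaryGroup (Fin n) ℂ) :
        Matrix (Fin n) (Fin n) ℂ) *ᵥ
      uact (FreeGroup.lift u ((p.1 : FreeGroup S)⁻¹ * q.1)) v q.2 := by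
    have := congrFun (uact_mul (FreeGroup.lift u (p.1 : FreeGroup S))
      (FreeGroup.lift u ((p.1 : FreeGroup S)⁻¹ * q.1)) v) q.2
    rwa [← map_mul, mul_inv_cancel_left] at this
  rw [blockGram, tgram_apply, orbit, orbit, h]
  exact dotProduct_mulVec_unitary _ _ _

/-- The vectors of the family at the sources of the edges labelled `s`. -/
def edgeSource (s : S) (X : F → Fin k → Fin n → ℂ) :
    letterEdges (s, true) F × Fin k → Fin n → ℂ :=
  fun p => X ⟨p.1, (mem_letterEdges.mp p.1.2).1⟩ p.2

/-- The vectors of the family at the targets of the edges labelled `s`. -/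
def edgeTarget (s : S) (X : F → Fin k → Fin n → ℂ) :
    letterEdges (s, true) F × Fin k → Fin n → ℂ :=
  fun p => X ⟨letter (s, true) * p.1, (mem_letterEdges.mp p.1.2).2⟩ p.2

/-- The families that are almost equivariant along all edges inside `F`. -/
def nearEquivariant (F : Finset (FreeGroup S)) (k : ℕ) (u : S → unitaryGroup (Fin n) ℂ) (ε : ℝ) :
    Set (F → Fin k → Fin n → ℂ) :=
  {X | ∀ s p, vnorm (edgeTarget s X p - uact (u s) (edgeSource s X) p) ≤ ε}

/-- The hypothesis says that `N` raises the order of vanishing with respect to word length by one,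
and lengths are bounded on the finite set `F`. -/
theorem isNilpotent_of_norm {E : Type*} [AddCommGroup E] [Module ℂ E]
    (N : (F → E) →ₗ[ℂ] (F → E))
    (hN : ∀ (m : ℕ) (X : F → E), (∀ g : F, (g : FreeGroup S).norm < m → X g = 0) →
      ∀ g : F, (g : FreeGroup S).norm < m + 1 → N X g = 0) : IsNilpotent N := by
  have h1 : ∀ (m : ℕ) (X : F → E) (g : F), (g : FreeGroup S).norm < m → (N ^ m) X g = 0 := by
    intro m
    induction m with
    | zero => intro X g hg; omega
    | succ m ih =>
      intro X g hg
      rw [pow_succ', Module.End.mul_apply]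
      exact hN m _ (ih X) g hg
  refine ⟨F.sup FreeGroup.norm + 1, LinearMap.ext fun X => funext fun g => ?_⟩
  exact h1 _ X g (Nat.lt_succ_of_le (Finset.le_sup (f := FreeGroup.norm) g.2))

/-- The vertex at the other end of the edge from `g` towards the identity. -/
def parent (hF : IsRooted F) (g : F) : F := ⟨deleteFirst g, hF.deleteFirst_mem g g.2⟩

/-- The value at `g` predicted by equivariance from the value at the parent of `g`. -/
def predictLin (hF : IsRooted F) (k : ℕ) (u : S → unitaryGroup (Fin n) ℂ) :
    (F → Fin k → Fin n → ℂ) →ₗ[ℂ] (F → Fin k → Fin n → ℂ) where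
  -- The factor `g * (deleteFirst g)⁻¹` is the deleted letter, written without naming it.
  toFun X g := if (g : FreeGroup S) = 1 then 0 else
    uact (FreeGroup.lift u ((g : FreeGroup S) * (deleteFirst (g : FreeGroup S))⁻¹)) (X (parent hF g))
  map_add' X Y := by
    ext g i : 2
    by_cases h : (g : FreeGroup S) = 1 <;> simp [h, uact, mulVec_add]
  map_smul' c X := by
    ext g i : 2
    by_cases h : (g : FreeGroup S) = 1 <;> simp [h, uact, mulVec_smul]

/-- The increments of a family along the edges towards the identity, together with its value at
the identity. -/
def incrementLin (hF : IsRooted F) (k : ℕ) (u : S → unitaryGroup (Fin n) ℂ) :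
    (F → Fin k → Fin n → ℂ) →ₗ[ℂ] (F → Fin k → Fin n → ℂ) :=
  LinearMap.id - predictLin hF k u

/-- Prediction from the parent is nilpotent, so passing to increments is unipotent, of determinant
one. -/
theorem measurePreserving_incrementLin (hF : IsRooted F) (u : S → unitaryGroup (Fin n) ℂ) :
    MeasurePreserving (incrementLin hF k u) := by
  refine measurePreserving_of_norm_det_eq_one volume _ ?_
  rw [incrementLin, det_one_sub_of_isNilpotent, norm_one]
  refine isNilpotent_of_norm _ fun m X hX g hg => ?_
  by_cases h : (g : FreeGroup S) = 1
  · simp [predictLin, h]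
  · have h1 := norm_deleteFirst h
    have h2 : X (parent hF g) = 0 := hX _ (by
      change (deleteFirst (g : FreeGroup S)).norm < m
      omega)
    ext i : 1
    simp [predictLin, h, h2, uact]

theorem incrementLin_one (hF : IsRooted F) (u : S → unitaryGroup (Fin n) ℂ)
    (X : F → Fin k → Fin n → ℂ) :
    incrementLin hF k u X ⟨1, hF.one_mem⟩ = X ⟨1, hF.one_mem⟩ := by
  simp [incrementLin, predictLin]

theorem incrementLin_of_startsWith (hF : IsRooted F) (u : S → unitaryGroup (Fin n) ℂ)
    (X : F → Fin k → Fin n → ℂ) {g : F} {a : S × Bool} (ha : StartsWith a (g : FreeGroup S))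
    (i : Fin k) :
    incrementLin hF k u X g i = X g i - uact (FreeGroup.lift u (letter a)) (X (parent hF g)) i := by
  have h1 : (g : FreeGroup S) * (deleteFirst (g : FreeGroup S))⁻¹ = letter a := by
    rw [mul_inv_eq_iff_eq_mul, ha.letter_mul_deleteFirst]
  simp [incrementLin, predictLin, ha.ne_one, -map_mul, -map_inv, h1]

theorem lift_letter_true (u : S → unitaryGroup (Fin n) ℂ) (s : S) :
    FreeGroup.lift u (letter (s, true)) = u s := by
  rw [letter_true, FreeGroup.lift_apply_of]

theorem vnorm_sub_uact_inv (w : unitaryGroup (Fin n) ℂ) (x y : Fin k → Fin n → ℂ) (i : Fin k) :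
    vnorm (x i - uact w⁻¹ y i) = vnorm (y i - uact w x i) := by
  rw [← vnorm_mulVec_unitary w, mulVec_sub]
  have h : (w : Matrix (Fin n) (Fin n) ℂ) *ᵥ uact w⁻¹ y i = y i := by
    have := congrFun (uact_mul w w⁻¹ y) i
    rw [mul_inv_cancel] at this
    refine Eq.trans this.symm ?_
    simp [uact]
  rw [h, vnorm_sub_comm]
  rfl

/-- Each edge inside `F` joins a vertex to its parent. If the child is the source of the edge, the
condition is transported by the unitary of the generator, which preserves norms. -/
theorem mem_nearEquivariant_iff (hF : IsRooted F) (u : S → unitaryGroup (Fin n) ℂ) {ε : ℝ}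
    (X : F → Fin k → Fin n → ℂ) :
    X ∈ nearEquivariant F k u ε ↔
      ∀ g : F, (g : FreeGroup S) ≠ 1 → ∀ i, vnorm (incrementLin hF k u X g i) ≤ ε := by
  constructor
  · intro hX g hg i
    obtain ⟨⟨s, b⟩, ha⟩ := exists_startsWith hg
    rw [incrementLin_of_startsWith hF u X ha]
    cases b with
    | true =>
      have h1 : (deleteFirst (g : FreeGroup S)) ∈ letterEdges (s, true) F :=
        mem_letterEdges.mpr ⟨hF.deleteFirst_mem g g.2, by rw [ha.letter_mul_deleteFirst]; exact g.2⟩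
      have h2 := hX s (⟨_, h1⟩, i)
      have h3 : (⟨letter (s, true) * deleteFirst (g : FreeGroup S), (mem_letterEdges.mp h1).2⟩ : F)
          = g := Subtype.ext ha.letter_mul_deleteFirst
      rw [lift_letter_true]
      simp only [edgeTarget, h3] at h2
      exact h2
    | false =>
      have hs : letter (s, true) * (g : FreeGroup S) = deleteFirst (g : FreeGroup S) :=
        letter_mul_of_startsWith (a := (s, true)) ha
      have h1 : (g : FreeGroup S) ∈ letterEdges (s, true) F :=
        mem_letterEdges.mpr ⟨g.2, by rw [hs]; exact hF.deleteFirst_mem g g.2⟩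
      have h2 := hX s (⟨_, h1⟩, i)
      have h3 : (⟨letter (s, true) * (g : FreeGroup S), (mem_letterEdges.mp h1).2⟩ : F)
          = parent hF g := Subtype.ext hs
      rw [letter_false, map_inv, FreeGroup.lift_apply_of, vnorm_sub_uact_inv]
      simpa only [edgeTarget, edgeSource, uact, h3] using h2
  · rintro hX s ⟨⟨h, hh⟩, i⟩
    obtain ⟨h1, h2⟩ := mem_letterEdges.mp hh
    by_cases hs : StartsWith (flip (s, true)) h
    · have h3 := hX ⟨h, h1⟩ hs.ne_one i
      rw [incrementLin_of_startsWith hF u X (g := ⟨h, h1⟩) hs, letter_flip, map_inv,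
        lift_letter_true, vnorm_sub_uact_inv] at h3
      have h4 : (⟨letter (s, true) * h, h2⟩ : F) = parent hF ⟨h, h1⟩ :=
        Subtype.ext (letter_mul_of_startsWith hs)
      simpa only [edgeTarget, edgeSource, uact, h4] using h3
    · have h3 := hX ⟨_, h2⟩ (startsWith_letter_mul hs).ne_one i
      rw [incrementLin_of_startsWith hF u X (g := ⟨_, h2⟩) (startsWith_letter_mul hs),
        lift_letter_true] at h3
      have h4 : parent hF ⟨letter (s, true) * h, h2⟩ = ⟨h, h1⟩ :=
        Subtype.ext (deleteFirst_letter_mul hs)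
      rw [h4] at h3
      exact h3

/-- Errors add up along the path from `g` to the root, and transport by unitaries does not enlarge
them. -/
theorem vnorm_sub_orbit_le (hF : IsRooted F) (u : S → unitaryGroup (Fin n) ℂ) {ε : ℝ}
    (X : F → Fin k → Fin n → ℂ)
    (hX : ∀ g : F, (g : FreeGroup S) ≠ 1 → ∀ i, vnorm (incrementLin hF k u X g i) ≤ ε)
    (g : F) (i : Fin k) :
    vnorm (X g i - orbit F u (X ⟨1, hF.one_mem⟩) g i) ≤ (g : FreeGroup S).norm * ε := by
  induction hm : (g : FreeGroup S).norm generalizing g with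
  | zero =>
    obtain ⟨g, hg⟩ := g
    obtain rfl : g = 1 := FreeGroup.norm_eq_zero.mp hm
    simp [orbit, uact, vnorm]
  | succ m ih =>
    have hg : (g : FreeGroup S) ≠ 1 := by
      intro h
      rw [h, FreeGroup.norm_one] at hm
      omega
    obtain ⟨a, ha⟩ := exists_startsWith hg
    have h1 := hX g hg i
    rw [incrementLin_of_startsWith hF u X ha] at h1
    have h2 := ih (parent hF g) (by
      have := ha.norm_eq
      change (deleteFirst (g : FreeGroup S)).norm = m
      omega)
    rw [← vnorm_mulVec_unitary (FreeGroup.lift u (letter a)), mulVec_sub] at h2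
    have h3 : ((FreeGroup.lift u (letter a) : unitaryGroup (Fin n) ℂ) : Matrix (Fin n) (Fin n) ℂ) *ᵥ
        orbit F u (X ⟨1, hF.one_mem⟩) (parent hF g) i = orbit F u (X ⟨1, hF.one_mem⟩) g i := by
      have := congrFun (uact_mul (FreeGroup.lift u (letter a))
        (FreeGroup.lift u (deleteFirst (g : FreeGroup S))) (X ⟨1, hF.one_mem⟩)) i
      rw [← map_mul, ha.letter_mul_deleteFirst] at this
      exact this.symm
    rw [h3] at h2
    have h4 := vnorm_sub_le (X g i) (uact (FreeGroup.lift u (letter a)) (X (parent hF g)) i)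
      (orbit F u (X ⟨1, hF.one_mem⟩) g i)
    have h5 : vnorm (uact (FreeGroup.lift u (letter a)) (X (parent hF g)) i -
        orbit F u (X ⟨1, hF.one_mem⟩) g i) ≤ m * ε := h2
    push_cast
    linarith

theorem norm_tgram_sub_le {ι : Type*} {x y : ι → Fin n → ℂ} {C d : ℝ}
    (hy : ∀ i, vnorm (y i) ≤ C) (hxy : ∀ i, vnorm (x i - y i) ≤ d) (i j : ι) :
    ‖tgram x i j - tgram y i j‖ ≤ d * (2 * C + d) := by
  have hC : 0 ≤ C := (vnorm_nonneg _).trans (hy i)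
  have hd : 0 ≤ d := (vnorm_nonneg _).trans (hxy i)
  have h1 : tgram x i j - tgram y i j =
      star (x i - y i) ⬝ᵥ (x j - y j) + star (x i - y i) ⬝ᵥ y j + star (y i) ⬝ᵥ (x j - y j) := by
    rw [tgram_apply, tgram_apply]
    simp only [star_sub, sub_dotProduct, dotProduct_sub]
    ring
  rw [h1]
  have e1 := (norm_dotProduct_le (x i - y i) (x j - y j)).trans
    (mul_le_mul (hxy i) (hxy j) (vnorm_nonneg _) hd)
  have e2 := (norm_dotProduct_le (x i - y i) (y j)).trans
    (mul_le_mul (hxy i) (hy j) (vnorm_nonneg _) hd)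
  have e3 := (norm_dotProduct_le (y i) (x j - y j)).trans
    (mul_le_mul (hy i) (hxy j) (vnorm_nonneg _) hC)
  have := norm_add₃_le (a := star (x i - y i) ⬝ᵥ (x j - y j)) (b := star (x i - y i) ⬝ᵥ y j)
    (c := star (y i) ⬝ᵥ (x j - y j))
  linarith

/-- The volume of a box in the increment coordinates. -/
theorem volume_preimage_incrementLin (hF : IsRooted F) (u : S → unitaryGroup (Fin n) ℂ)
    {T : Set (Fin k → Fin n → ℂ)} (hT : MeasurableSet T) {ε : ℝ} (hε : 0 ≤ ε) :
    volume {X : F → Fin k → Fin n → ℂ | X ⟨1, hF.one_mem⟩ ∈ T ∧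
        ∀ g : F, (g : FreeGroup S) ≠ 1 → ∀ i, vnorm (incrementLin hF k u X g i) ≤ ε} =
      volume T * (ENNReal.ofReal ε ^ (2 * n) * ballVolume n) ^ (k * (F.card - 1)) := by
  classical
  let B : F → Set (Fin k → Fin n → ℂ) := fun g =>
    if (g : FreeGroup S) = 1 then T else Set.univ.pi fun _ => cball n ε
  have h1 : {X : F → Fin k → Fin n → ℂ | X ⟨1, hF.one_mem⟩ ∈ T ∧
        ∀ g : F, (g : FreeGroup S) ≠ 1 → ∀ i, vnorm (incrementLin hF k u X g i) ≤ ε} =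
      incrementLin hF k u ⁻¹' Set.univ.pi B := by
    ext X
    simp only [Set.mem_ofPred_eq, Set.mem_preimage, Set.mem_univ_pi]
    constructor
    · rintro ⟨h1, h2⟩ g
      by_cases hg : (g : FreeGroup S) = 1
      · obtain ⟨g, hgF⟩ := g
        obtain rfl : g = 1 := hg
        simpa [B, incrementLin_one] using h1
      · simpa [B, hg, cball] using h2 g hg
    · intro h
      refine ⟨?_, fun g hg i => ?_⟩
      · have := h ⟨1, hF.one_mem⟩
        rw [incrementLin_one] at this
        simpa [B] using this
      · have := h g
        simp only [B, hg, if_false, Set.mem_univ_pi] at this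
        exact this i
  have hBm : ∀ g, MeasurableSet (B g) := by
    intro g
    by_cases hg : (g : FreeGroup S) = 1
    · simpa [B, hg] using hT
    · simpa only [B, hg, if_false] using MeasurableSet.univ_pi fun _ => measurableSet_cball ε
  rw [h1, (measurePreserving_incrementLin hF u).measure_preimage
    (MeasurableSet.univ_pi hBm).nullMeasurableSet, volume_pi_pi]
  have h2 : ∀ g : F, volume (B g) = if g = ⟨1, hF.one_mem⟩ then volume T else
      (ENNReal.ofReal ε ^ (2 * n) * ballVolume n) ^ k := by
    intro g
    by_cases hg : g = ⟨1, hF.one_mem⟩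
    · simp [B, hg]
    · have hg' : (g : FreeGroup S) ≠ 1 := fun h => hg (Subtype.ext h)
      simp only [B, hg', hg, if_false]
      rw [volume_pi_pi]
      simp [volume_cball hε]
  -- The root contributes `volume T`; each of the other `F.card - 1` vertices contributes `k` balls
  -- of radius `ε`.
  rw [Finset.prod_congr rfl fun g _ => h2 g,
    ← Finset.mul_prod_erase Finset.univ _ (Finset.mem_univ (⟨1, hF.one_mem⟩ : F)), if_pos rfl,
    Finset.prod_congr rfl fun g hg => if_neg (Finset.ne_of_mem_erase hg), Finset.prod_const,
    Finset.card_erase_of_mem (Finset.mem_univ _), Finset.card_univ, Fintype.card_coe, ← pow_mul]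

end TreeCoordinates

/-! ### From typical tuples to almost equivariant families -/

section Coupling

open Matrix

variable {S : Type*} [Fintype S] [DecidableEq S] {n k : ℕ} {F : Finset (FreeGroup S)}

instance secondCountableTopology_unitaryGroup (n : ℕ) :
    SecondCountableTopology (unitaryGroup (Fin n) ℂ) :=
  have : SecondCountableTopology (Matrix (Fin n) (Fin n) ℂ) :=
    inferInstanceAs (SecondCountableTopology (Fin n → Fin n → ℂ))
  TopologicalSpace.Subtype.secondCountableTopology _

/-- The families whose Gram matrix is entrywise within `ζ` of `Q`. -/
def gramNear (n : ℕ) (Q : Matrix (F × Fin k) (F × Fin k) ℂ) (ζ : ℝ) :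
    Set (F → Fin k → Fin n → ℂ) :=
  {X | ∀ p q, ‖blockGram X p q - Q p q‖ ≤ ζ}

theorem continuous_blockGram : Continuous (blockGram (F := F) (k := k) (n := n)) :=
  continuous_tgram.comp (by fun_prop)

theorem measurableSet_gramNear (Q : Matrix (F × Fin k) (F × Fin k) ℂ) (ζ : ℝ) :
    MeasurableSet (gramNear n Q ζ) := by
  refine IsClosed.measurableSet ?_
  simp only [gramNear, Set.ofPred_forall]
  exact isClosed_iInter fun i => isClosed_iInter fun j => isClosed_le
    (((continuous_blockGram.matrix_elem i j).sub continuous_const).norm) continuous_const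

/-- The expected volume of the almost equivariant families with Gram matrix close to `Q`. -/
def couplingVolume (n : ℕ) (Q : Matrix (F × Fin k) (F × Fin k) ℂ) (ζ ε : ℝ) : ℝ≥0∞ :=
  ∫⁻ u : S → unitaryGroup (Fin n) ℂ, volume (gramNear n Q ζ ∩ nearEquivariant F k u ε)
    ∂(Measure.pi fun _ : S => unitaryHaar n)

/-- Fubini exchanges the unitaries with the family. For a fixed family the condition on edges
labelled `s` involves only `u s`, so independence yields a product. -/
theorem couplingVolume_eq (Q : Matrix (F × Fin k) (F × Fin k) ℂ) (ζ ε : ℝ) :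
    couplingVolume n Q ζ ε = ∫⁻ X in gramNear n Q ζ, ∏ s : S,
      unitaryHaar n {u | ∀ p, vnorm (edgeTarget s X p - uact u (edgeSource s X) p) ≤ ε} := by
  let T : Set ((S → unitaryGroup (Fin n) ℂ) × (F → Fin k → Fin n → ℂ)) :=
    {p | p.2 ∈ nearEquivariant F k p.1 ε}
  have hsrc : ∀ s : S, Continuous fun X : F → Fin k → Fin n → ℂ => edgeSource s X := fun s => by
    unfold edgeSource
    fun_prop
  have htgt : ∀ s : S, Continuous fun X : F → Fin k → Fin n → ℂ => edgeTarget s X := fun s => by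
    unfold edgeTarget
    fun_prop
  have hT : MeasurableSet T := by
    refine IsClosed.measurableSet ?_
    change IsClosed {q : (S → unitaryGroup (Fin n) ℂ) × (F → Fin k → Fin n → ℂ) | ∀ s p,
      vnorm (edgeTarget s q.2 p - uact (q.1 s) (edgeSource s q.2) p) ≤ ε}
    simp only [Set.ofPred_forall]
    refine isClosed_iInter fun s => isClosed_iInter fun p => isClosed_le
      (continuous_vnorm.comp (Continuous.sub ?_ ?_)) continuous_const
    · exact (continuous_apply p).comp ((htgt s).comp continuous_snd)
    · have h1 : Continuous fun q : (S → unitaryGroup (Fin n) ℂ) × (F → Fin k → Fin n → ℂ) =>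
          (q.1 s, edgeSource s q.2) :=
        ((continuous_apply s).comp continuous_fst).prodMk ((hsrc s).comp continuous_snd)
      exact (continuous_apply p).comp (continuous_uact.comp h1)
  have h1 := Measure.prod_apply (μ := Measure.pi fun _ : S => unitaryHaar n)
    (ν := (volume : Measure (F → Fin k → Fin n → ℂ)).restrict (gramNear n Q ζ)) hT
  have h2 := Measure.prod_apply_symm (μ := Measure.pi fun _ : S => unitaryHaar n)
    (ν := (volume : Measure (F → Fin k → Fin n → ℂ)).restrict (gramNear n Q ζ)) hT
  have h3 : couplingVolume n Q ζ ε =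
      ∫⁻ u, (volume : Measure (F → Fin k → Fin n → ℂ)).restrict (gramNear n Q ζ)
        (Prod.mk u ⁻¹' T) ∂(Measure.pi fun _ : S => unitaryHaar n) := by
    refine lintegral_congr fun u => ?_
    rw [Measure.restrict_apply (measurable_prodMk_left hT), Set.inter_comm]
    rfl
  rw [h3, ← h1, h2]
  refine lintegral_congr fun X => ?_
  rw [← Measure.pi_pi]
  congr 1
  ext u
  simp [T, nearEquivariant]

/-- The basic neighbourhood of `φ` determined by the entries of `φ[F]`. -/
def windowNhd (φ : FreeGroup S → Matrix (Fin k) (Fin k) ℂ) (F : Finset (FreeGroup S)) (η : ℝ) :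
    Set (FreeGroup S → Matrix (Fin k) (Fin k) ℂ) :=
  {ψ | ∀ p q : F × Fin k, ‖ψ ((p.1 : FreeGroup S)⁻¹ * q.1) p.2 q.2 - blockMatrix φ F p q‖ < η}

theorem isOpen_windowNhd (φ : FreeGroup S → Matrix (Fin k) (Fin k) ℂ) (η : ℝ) :
    IsOpen (windowNhd φ F η) := by
  simp only [windowNhd, Set.ofPred_forall]
  refine isOpen_iInter_of_finite fun p => isOpen_iInter_of_finite fun q =>
    isOpen_lt (Continuous.norm (Continuous.sub ?_ continuous_const)) continuous_const
  exact (continuous_apply ((p.1 : FreeGroup S)⁻¹ * q.1)).matrix_elem p.2 q.2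

theorem mem_windowNhd_self (φ : FreeGroup S → Matrix (Fin k) (Fin k) ℂ) {η : ℝ} (hη : 0 < η) :
    φ ∈ windowNhd φ F η := fun p q => by
  simpa [blockMatrix] using hη

theorem mem_typical_windowNhd {φ : FreeGroup S → Matrix (Fin k) (Fin k) ℂ} {η : ℝ}
    {u : S → unitaryGroup (Fin n) ℂ} {v : Fin k → Fin n → ℂ} :
    v ∈ typical (FreeGroup.lift u) (windowNhd φ F η) ↔
      ∀ p q, ‖blockGram (orbit F u v) p q - blockMatrix φ F p q‖ < η := by
  simp only [blockGram_orbit]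
  rfl

theorem measurableSet_typical_windowNhd (φ : FreeGroup S → Matrix (Fin k) (Fin k) ℂ) (η : ℝ)
    (u : S → unitaryGroup (Fin n) ℂ) :
    MeasurableSet (typical (k := k) (FreeGroup.lift u) (windowNhd φ F η)) := by
  refine IsOpen.measurableSet ?_
  have h1 : typical (k := k) (FreeGroup.lift u) (windowNhd φ F η) =
      {v | ∀ p q, ‖blockGram (orbit F u v) p q - blockMatrix φ F p q‖ < η} :=
    Set.ext fun v => mem_typical_windowNhd
  rw [h1]
  simp only [Set.ofPred_forall]
  have hc : Continuous fun v : Fin k → Fin n → ℂ => orbit F u v := by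
    refine continuous_pi fun g => ?_
    exact continuous_uact.comp (continuous_const.prodMk continuous_id)
  exact isOpen_iInter_of_finite fun p => isOpen_iInter_of_finite fun q =>
    isOpen_lt (Continuous.norm (Continuous.sub
      ((continuous_blockGram.comp hc).matrix_elem p q) continuous_const)) continuous_const

theorem vnorm_le_of_blockGram {X : F → Fin k → Fin n → ℂ} {C : ℝ} (hC : 0 ≤ C) (p : F × Fin k)
    (h : ‖blockGram X p p‖ ≤ C ^ 2) : vnorm (X p.1 p.2) ≤ C := by
  rw [blockGram, tgram_apply, dotProduct_self_eq, Complex.norm_real, Real.norm_eq_abs,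
    abs_of_nonneg (by positivity)] at h
  exact (pow_le_pow_iff_left₀ (vnorm_nonneg _) hC two_ne_zero).mp h

/-- The volume of the increments of size at most `ε`, times the normalization. -/
def incrementVolume (F : Finset (FreeGroup S)) (k n : ℕ) (ε : ℝ) : ℝ≥0∞ :=
  ballVolume n ^ k * (ENNReal.ofReal ε ^ (2 * n) * ballVolume n) ^ (k * (F.card - 1))

theorem incrementVolume_ne_top (ε : ℝ) : incrementVolume F k n ε ≠ ⊤ := by
  have := ballVolume_ne_top n
  unfold incrementVolume
  finiteness

theorem expectedVolume_mul_incrementVolume (O : Set (FreeGroup S → Matrix (Fin k) (Fin k) ℂ))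
    (ε : ℝ) :
    expectedVolume n O * incrementVolume F k n ε =
      ∫⁻ u : S → unitaryGroup (Fin n) ℂ, volume (typical (FreeGroup.lift u) O) *
        (ENNReal.ofReal ε ^ (2 * n) * ballVolume n) ^ (k * (F.card - 1))
          ∂(Measure.pi fun _ : S => unitaryHaar n) := by
  rw [expectedVolume, ← lintegral_mul_const' _ _ (incrementVolume_ne_top ε)]
  refine lintegral_congr fun u => ?_
  rw [incrementVolume, ← mul_assoc, ENNReal.div_mul_cancel
    (pow_ne_zero _ (ballVolume_ne_zero n)) (ENNReal.pow_ne_top (ballVolume_ne_top n))]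

variable {φ : FreeGroup S → Matrix (Fin k) (Fin k) ℂ} {Q : Matrix (F × Fin k) (F × Fin k) ℂ}
  {m : ℕ} {C ε ζ η : ℝ}

/-- The left side is the expected volume of a box in increment coordinates: typical value at the
root, small increments elsewhere. Such a family stays within `m * ε` of a true orbit, so its Gram
matrix is near `φ[F]`. -/
theorem expectedVolume_le_couplingVolume (hF : IsRooted F) (hm : ∀ g ∈ F, g.norm ≤ m)
    (hC : 0 ≤ C) (hε : 0 ≤ ε) (hdiag : ∀ p, ‖blockMatrix φ F p p‖ + η ≤ C ^ 2)
    (hζ : m * ε * (2 * C + m * ε) + η ≤ ζ) :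
    expectedVolume n (windowNhd φ F η) * incrementVolume F k n ε ≤
      couplingVolume n (blockMatrix φ F) ζ ε := by
  rw [expectedVolume_mul_incrementVolume]
  refine lintegral_mono fun u => ?_
  rw [← volume_preimage_incrementLin hF u (measurableSet_typical_windowNhd φ η u) hε]
  refine measure_mono ?_
  rintro X ⟨hX1, hX2⟩
  rw [mem_typical_windowNhd] at hX1
  refine ⟨fun p q => ?_, (mem_nearEquivariant_iff hF u X).mpr hX2⟩
  have hy : ∀ p : F × Fin k, vnorm (orbit F u (X ⟨1, hF.one_mem⟩) p.1 p.2) ≤ C := fun p => by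
    refine vnorm_le_of_blockGram hC p (le_trans ?_ (hdiag p))
    have h1 := hX1 p p
    have h2 := norm_sub_norm_le (blockGram (orbit F u (X ⟨1, hF.one_mem⟩)) p p)
      (blockMatrix φ F p p)
    linarith
  have hxy : ∀ p : F × Fin k, vnorm (X p.1 p.2 - orbit F u (X ⟨1, hF.one_mem⟩) p.1 p.2) ≤
      m * ε := fun p => (vnorm_sub_orbit_le hF u X hX2 p.1 p.2).trans
        (mul_le_mul_of_nonneg_right (by exact_mod_cast hm _ p.1.2) hε)
  have h1 := norm_tgram_sub_le hy hxy p q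
  have h2 := hX1 p q
  have h3 := norm_sub_le_norm_sub_add_norm_sub (blockGram X p q)
    (blockGram (orbit F u (X ⟨1, hF.one_mem⟩)) p q) (blockMatrix φ F p q)
  exact h3.trans ((add_le_add h1 h2.le).trans hζ)

/-- The reverse inclusion: an almost equivariant family with Gram matrix near `Q` has a typical
value at the root. The matrix `Q` is left free because the lower bound uses a perturbation of
`φ[F]`. -/
theorem couplingVolume_le_expectedVolume (hF : IsRooted F) (hm : ∀ g ∈ F, g.norm ≤ m)
    (hC : 0 ≤ C) (hε : 0 ≤ ε) (hdiag : ∀ p, ‖Q p p‖ + ζ ≤ C ^ 2)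
    (hη : ∀ p q, m * ε * (2 * C + m * ε) + ζ + ‖Q p q - blockMatrix φ F p q‖ < η) :
    couplingVolume n Q ζ ε ≤
      expectedVolume n (windowNhd φ F η) * incrementVolume F k n ε := by
  rw [expectedVolume_mul_incrementVolume]
  refine lintegral_mono fun u => ?_
  rw [← volume_preimage_incrementLin hF u (measurableSet_typical_windowNhd φ η u) hε]
  refine measure_mono ?_
  rintro X ⟨hX1, hX2⟩
  rw [mem_nearEquivariant_iff hF] at hX2
  refine ⟨mem_typical_windowNhd.mpr fun p q => ?_, hX2⟩
  have hx : ∀ p : F × Fin k, vnorm (X p.1 p.2) ≤ C := fun p => by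
    refine vnorm_le_of_blockGram hC p (le_trans ?_ (hdiag p))
    have h1 := hX1 p p
    have h2 := norm_sub_norm_le (blockGram X p p) (Q p p)
    linarith
  have hxy : ∀ p : F × Fin k, vnorm (orbit F u (X ⟨1, hF.one_mem⟩) p.1 p.2 - X p.1 p.2) ≤
      m * ε := fun p => by
    rw [vnorm_sub_comm]
    exact (vnorm_sub_orbit_le hF u X hX2 p.1 p.2).trans
        (mul_le_mul_of_nonneg_right (by exact_mod_cast hm _ p.1.2) hε)
  have h1 := norm_tgram_sub_le hx hxy p q
  have h2 := hX1 p q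
  have h3 := norm_sub_le_norm_sub_add_norm_sub
    (blockGram (orbit F u (X ⟨1, hF.one_mem⟩)) p q) (blockGram X p q) (blockMatrix φ F p q)
  have h4 := norm_sub_le_norm_sub_add_norm_sub (blockGram X p q) (Q p q) (blockMatrix φ F p q)
  have h5 := hη p q
  have h6 : ‖blockGram (orbit F u (X ⟨1, hF.one_mem⟩)) p q - blockGram X p q‖ ≤
    m * ε * (2 * C + m * ε) := h1
  linarith

end Coupling

/-! ### The volume of the tuples with prescribed Gram matrix -/

section GramVolume

open Matrix

variable {n : ℕ} {ι : Type*} [Fintype ι] [DecidableEq ι]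

theorem exists_entrywise_of_mem_nhds {A : Matrix ι ι ℂ} {U : Set (Matrix ι ι ℂ)} (hU : U ∈ 𝓝 A) :
    ∃ δ : ℝ, 0 < δ ∧ ∀ M : Matrix ι ι ℂ, (∀ i j, ‖M i j - A i j‖ ≤ δ) → M ∈ U := by
  have h : ∀ (A : ι → ι → ℂ) (U : Set (ι → ι → ℂ)), U ∈ 𝓝 A →
      ∃ δ : ℝ, 0 < δ ∧ ∀ M : ι → ι → ℂ, (∀ i j, ‖M i j - A i j‖ ≤ δ) → M ∈ U := by
    intro A U hU
    obtain ⟨δ, hδ, h⟩ := Metric.nhds_basis_closedBall.mem_iff.mp hU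
    refine ⟨δ, hδ, fun M hM => h ?_⟩
    rw [Metric.mem_closedBall, dist_pi_le_iff hδ.le]
    refine fun i => (dist_pi_le_iff hδ.le).mpr fun j => ?_
    rw [dist_eq_norm]
    exact hM i j
  exact h A U hU

theorem posSemidef_smul_one_sub {E : Matrix ι ι ℂ} (hE : E.IsHermitian) {ζ : ℝ}
    (h : ∀ i j, ‖E i j‖ ≤ ζ) : (((Fintype.card ι * ζ : ℝ) : ℂ) • 1 - E).PosSemidef := by
  have hd : (((Fintype.card ι * ζ : ℝ) : ℂ) • (1 : Matrix ι ι ℂ)).IsHermitian := by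
    rw [IsHermitian, conjTranspose_smul, conjTranspose_one]
    simp
  refine .of_dotProduct_mulVec_nonneg (hd.sub hE) fun x => ?_
  rw [sub_mulVec, dotProduct_sub, sub_nonneg, smul_mulVec, one_mulVec, dotProduct_smul, smul_eq_mul]
  have h1 : star x ⬝ᵥ x = ((∑ i, ‖x i‖ ^ 2 : ℝ) : ℂ) := by
    simp only [dotProduct, Pi.star_apply, RCLike.star_def, RCLike.conj_mul]
    push_cast
    rfl
  have h2 : star x ⬝ᵥ E *ᵥ x = ((star x ⬝ᵥ E *ᵥ x).re : ℂ) :=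
    Complex.ext rfl (by simpa using hE.im_star_dotProduct_mulVec_self x)
  rw [h1, h2, ← Complex.ofReal_mul, Complex.real_le_real]
  calc (star x ⬝ᵥ E *ᵥ x).re ≤ ‖star x ⬝ᵥ E *ᵥ x‖ := Complex.re_le_norm _
    _ ≤ ∑ i, ∑ j, ‖x i‖ * (ζ * ‖x j‖) := by
      simp only [dotProduct, mulVec, Finset.mul_sum]
      refine (norm_sum_le _ _).trans (Finset.sum_le_sum fun i _ => (norm_sum_le _ _).trans
        (Finset.sum_le_sum fun j _ => ?_))
      rw [norm_mul, norm_mul, Pi.star_apply, norm_star]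
      exact mul_le_mul_of_nonneg_left (mul_le_mul_of_nonneg_right (h i j) (norm_nonneg _))
        (norm_nonneg _)
    _ ≤ ∑ i, ∑ j, ζ * ((‖x i‖ ^ 2 + ‖x j‖ ^ 2) / 2) := by
      refine Finset.sum_le_sum fun i _ => Finset.sum_le_sum fun j _ => ?_
      have hζ : 0 ≤ ζ := (norm_nonneg _).trans (h i j)
      nlinarith [mul_nonneg hζ (sq_nonneg (‖x i‖ - ‖x j‖))]
    _ = Fintype.card ι * ζ * ∑ i, ‖x i‖ ^ 2 := by
      simp only [← Finset.mul_sum, ← Finset.sum_div, Finset.sum_add_distrib, Finset.sum_const,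
        Finset.card_univ, nsmul_eq_mul]
      ring

theorem norm_det_of_conjTranspose_mul_self_eq {S Q : Matrix ι ι ℂ} (h : Sᴴ * S = Q) :
    ‖S.det‖ ^ 2 = ‖Q.det‖ := by
  rw [← h, det_mul, det_conjTranspose, norm_mul, norm_star, sq]

/-- An invertible square root of a positive definite matrix. -/
theorem exists_sqrt_of_posDef {Q : Matrix ι ι ℂ} (hQ : Q.PosDef) :
    ∃ S : Matrix ι ι ℂ, Sᴴ * S = Q ∧ IsUnit S.det := by
  obtain ⟨S, -, hS⟩ := exists_conjTranspose_mul_self_eq hQ.posSemidef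
  refine ⟨S, hS, isUnit_iff_ne_zero.mpr fun h0 => hQ.det_pos.ne' ?_⟩
  rw [← hS, det_mul, h0, mul_zero]

theorem volume_preimage_tmul_inv {S Q : Matrix ι ι ℂ} (hS : Sᴴ * S = Q) (hu : IsUnit S.det)
    (A : Set (ι → Fin n → ℂ)) :
    volume ((fun x => tmul x S⁻¹) ⁻¹' A) = ENNReal.ofReal ‖Q.det‖ ^ n * volume A := by
  have h1 : S⁻¹.det * S.det = 1 := by rw [← det_mul, nonsing_inv_mul S hu, det_one]
  have h2 := volume_preimage_tmul (left_ne_zero_of_mul_eq_one h1) A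
  rw [← h2, ← mul_assoc, ← mul_pow, ← ENNReal.ofReal_mul (norm_nonneg _),
    ← norm_det_of_conjTranspose_mul_self_eq hS, ← mul_pow, ← norm_mul, mul_comm S.det, h1]
  simp

theorem vnorm_sq_eq (x : ι → Fin n → ℂ) (i : ι) : vnorm (x i) ^ 2 = (tgram x i i).re := by
  rw [tgram_apply, dotProduct_self_eq, Complex.ofReal_re]

/-- The substitution `x ↦ x A^{-1/2}` reduces to Gram matrices below the identity, whose diagonal
forces every vector into the unit ball. -/
theorem volume_tgram_le_le {A : Matrix ι ι ℂ} (hA : A.PosDef) :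
    volume {x : ι → Fin n → ℂ | (A - tgram x).PosSemidef} ≤
      ENNReal.ofReal ‖A.det‖ ^ n * ballVolume n ^ Fintype.card ι := by
  obtain ⟨S, hS, hu⟩ := exists_sqrt_of_posDef hA
  have h2 : volume (Set.univ.pi fun _ : ι => cball n 1) = ballVolume n ^ Fintype.card ι := by
    simp [volume_pi_pi, volume_cball zero_le_one]
  rw [← h2, ← volume_preimage_tmul_inv hS hu]
  refine measure_mono fun x (hx : (A - tgram x).PosSemidef) i _ => ?_
  have h1 : (S⁻¹ᴴ * (A - tgram x) * S⁻¹).PosSemidef := hx.conjTranspose_mul_mul_same _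
  have h3 : S⁻¹ᴴ * (A - tgram x) * S⁻¹ = 1 - tgram (tmul x S⁻¹) := by
    rw [tgram_tmul, Matrix.mul_sub, Matrix.sub_mul, ← hS, Matrix.mul_assoc, Matrix.mul_assoc,
      mul_nonsing_inv S hu, Matrix.mul_one, ← conjTranspose_mul, mul_nonsing_inv S hu,
      conjTranspose_one]
  rw [h3] at h1
  have h4 := h1.diag_nonneg (i := i)
  rw [Matrix.sub_apply, one_apply_eq, Complex.nonneg_iff] at h4
  have h5 := h4.1
  rw [Complex.sub_re, Complex.one_re, ← vnorm_sq_eq] at h5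
  exact (sq_le_one_iff₀ (vnorm_nonneg _)).mp (by linarith)

theorem volume_nearOrthonormal_le {δ : ℝ} (hδ : 0 ≤ δ) :
    volume (nearOrthonormal n ι δ) ≤
      (ENNReal.ofReal (1 + δ) ^ n * ballVolume n) ^ Fintype.card ι := by
  have h2 : volume (Set.univ.pi fun _ : ι => cball n √(1 + δ)) =
      (ENNReal.ofReal (1 + δ) ^ n * ballVolume n) ^ Fintype.card ι := by
    rw [volume_pi_pi]
    simp only [volume_cball (Real.sqrt_nonneg _), Finset.prod_const, Finset.card_univ, pow_mul]
    rw [← ENNReal.ofReal_pow (Real.sqrt_nonneg _), Real.sq_sqrt (by linarith)]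
  rw [← h2]
  refine measure_mono fun Z (hZ : ∀ i j, _) i _ => ?_
  refine Real.le_sqrt_of_sq_le ?_
  have h := (Complex.abs_re_le_norm _).trans (hZ i i)
  rw [one_apply_eq, Complex.sub_re, Complex.one_re, ← vnorm_sq_eq] at h
  linarith [(abs_le.mp h).2]

theorem norm_tgram_sub_one_le_of_spread {α : Type*} {w : α → Fin n → ℂ} {κ : ι → Fin n → ℂ} {t : ℝ}
    (ht : 0 ≤ t) (h1 : κ ∈ Set.univ.pi fun _ : ι => cball n 1)
    (h2 : κ ∈ (spreadTuples w (max 0 (1 - t / 2)) t : Set (ι → Fin n → ℂ))) (i j : ι) :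
    ‖tgram κ i j - (1 : Matrix ι ι ℂ) i j‖ ≤ t := by
  rcases eq_or_ne i j with rfl | hij
  · rw [one_apply_eq, tgram_apply, dotProduct_self_eq, ← Complex.ofReal_one, ← Complex.ofReal_sub,
      Complex.norm_real, Real.norm_eq_abs, abs_le]
    have a1 : vnorm (κ i) ≤ 1 := h1 i (Set.mem_univ i)
    have a2 := (le_max_right _ _).trans (h2.1 i)
    have a3 := vnorm_nonneg (κ i)
    constructor <;> nlinarith
  · rw [one_apply_ne hij, sub_zero, tgram_apply]
    exact h2.2.1 i j hij

theorem eventually_volume_nearOrthonormal_ge (ι : Type*) [Fintype ι] [DecidableEq ι] {δ : ℝ}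
    (hδ : 0 < δ) :
    ∀ᶠ n : ℕ in atTop, ballVolume n ^ Fintype.card ι ≤ 2 * volume (nearOrthonormal n ι δ) := by
  filter_upwards [eventually_volume_spreadTuples_ge ι Empty 0 (le_max_left 0 (1 - δ / 2))
    (max_lt one_pos (by linarith)) hδ] with n hn
  refine (hn Empty.elim (fun a => a.elim)).trans ?_
  gcongr
  rintro κ ⟨h1, h2⟩
  exact fun i j => norm_tgram_sub_one_le_of_spread hδ.le h1 h2 i j

theorem exists_entrywise_conj {S Q : Matrix ι ι ℂ} (hS : Sᴴ * S = Q) {ζ : ℝ} (hζ : 0 < ζ) :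
    ∃ δ : ℝ, 0 < δ ∧ ∀ M : Matrix ι ι ℂ, (∀ i j, ‖M i j - (1 : Matrix ι ι ℂ) i j‖ ≤ δ) →
      ∀ i j, ‖(Sᴴ * M * S) i j - Q i j‖ ≤ ζ := by
  refine exists_entrywise_of_mem_nhds (U := {M : Matrix ι ι ℂ | ∀ i j, ‖(Sᴴ * M * S) i j - Q i j‖ ≤ ζ}) ?_
  have hc : ∀ i j, Continuous fun M : Matrix ι ι ℂ => ‖(Sᴴ * M * S) i j - Q i j‖ := fun i j => by
    have h1 : Continuous fun M : Matrix ι ι ℂ => Sᴴ * M * S := by fun_prop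
    exact ((h1.matrix_elem i j).sub continuous_const).norm
  refine eventually_all.mpr fun i => eventually_all.mpr fun j =>
    ((hc i j).tendsto' 1 0 ?_).eventually (ge_mem_nhds hζ)
  rw [Matrix.mul_one, hS, sub_self, norm_zero]

/-- Multiplication by a square root of `Q` sends nearly orthonormal tuples to tuples with Gram
matrix near `Q`, and the former fill at least half of a product of balls. -/
theorem eventually_volume_tgram_near_ge {Q : Matrix ι ι ℂ} (hQ : Q.PosDef) {ζ : ℝ} (hζ : 0 < ζ) :
    ∀ᶠ n : ℕ in atTop, ENNReal.ofReal ‖Q.det‖ ^ n * ballVolume n ^ Fintype.card ι ≤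
      2 * volume {x : ι → Fin n → ℂ | ∀ i j, ‖tgram x i j - Q i j‖ ≤ ζ} := by
  obtain ⟨S, hS, hu⟩ := exists_sqrt_of_posDef hQ
  obtain ⟨δ, hδ, h⟩ := exists_entrywise_conj hS hζ
  filter_upwards [eventually_volume_nearOrthonormal_ge ι hδ] with n hn
  calc _ ≤ ENNReal.ofReal ‖Q.det‖ ^ n * (2 * volume (nearOrthonormal n ι δ)) := by gcongr
    _ = 2 * volume ((fun x => tmul x S⁻¹) ⁻¹' nearOrthonormal n ι δ) := by
      rw [volume_preimage_tmul_inv hS hu]; ring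
    _ ≤ _ := by
      gcongr
      intro x hx i j
      have h1 := h _ hx i j
      rwa [← tgram_tmul, tmul_mul, nonsing_inv_mul S hu, tmul_one] at h1

theorem volume_tgram_near_le {Q : Matrix ι ι ℂ} (hQ : Q.PosSemidef) {a : ℝ} (ha : ‖Q.det‖ < a) :
    ∃ ζ₀ : ℝ, 0 < ζ₀ ∧ ∀ ζ ≤ ζ₀, ∀ n : ℕ,
      volume {x : ι → Fin n → ℂ | ∀ i j, ‖tgram x i j - Q i j‖ ≤ ζ} ≤
        ENNReal.ofReal a ^ n * ballVolume n ^ Fintype.card ι := by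
  have hc : Continuous fun ζ : ℝ =>
      ‖(Q + ((Fintype.card ι * ζ + ζ : ℝ) : ℂ) • (1 : Matrix ι ι ℂ)).det‖ := by
    refine Continuous.norm (Continuous.matrix_det ?_)
    fun_prop
  obtain ⟨ζ₀, hζ₀, h⟩ := Metric.nhds_basis_closedBall.mem_iff.mp
    ((hc.tendsto' 0 ‖Q.det‖ (by simp)).eventually (gt_mem_nhds ha))
  have h0 := h (show ζ₀ ∈ Metric.closedBall (0 : ℝ) ζ₀ by simp [abs_of_pos hζ₀])
  refine ⟨ζ₀, hζ₀, fun ζ hζ n => ?_⟩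
  -- The first summand dominates the perturbation of the Gram matrix; the second makes `A` positive
  -- definite even for singular `Q`.
  let A := Q + ((Fintype.card ι * ζ₀ + ζ₀ : ℝ) : ℂ) • (1 : Matrix ι ι ℂ)
  have hA : A.PosDef := by
    refine PosDef.posSemidef_add hQ (PosDef.one.smul ?_)
    rw [Complex.zero_lt_real]
    positivity
  refine le_trans (measure_mono fun x hx => ?_) ((volume_tgram_le_le hA).trans ?_)
  · have h1 : (tgram x - Q).IsHermitian := (posSemidef_tgram x).isHermitian.sub hQ.isHermitian
    have h2 := posSemidef_smul_one_sub h1 (ζ := ζ₀) fun i j => (hx i j).trans hζ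
    have h3 : ((ζ₀ : ℂ) • (1 : Matrix ι ι ℂ)).PosSemidef :=
      PosSemidef.one.smul (by rw [Complex.zero_le_real]; exact hζ₀.le)
    have h4 : A - tgram x =
        (((Fintype.card ι * ζ₀ : ℝ) : ℂ) • 1 - (tgram x - Q)) + (ζ₀ : ℂ) • 1 := by
      simp only [A, Complex.ofReal_add, add_smul]
      abel
    change (A - tgram x).PosSemidef
    rw [h4]
    exact h2.add h3
  · gcongr
    exact le_of_lt h0

end GramVolume

/-! ### The Haar probability of moving one tuple close to another -/

section EdgeProbability

open Matrix

variable {n : ℕ} {ι : Type*} [Fintype ι] [DecidableEq ι]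

theorem uact_mem_nearOrthonormal {δ : ℝ} (u : unitaryGroup (Fin n) ℂ) (Z : ι → Fin n → ℂ) :
    uact u Z ∈ nearOrthonormal n ι δ ↔ Z ∈ nearOrthonormal n ι δ := by
  simp only [nearOrthonormal, Set.mem_ofPred_eq, tgram_uact]

theorem exists_det_ne_zero (ι : Type*) [Fintype ι] [DecidableEq ι] :
    ∃ δ : ℝ, 0 < δ ∧ ∀ M : Matrix ι ι ℂ, (∀ i j, ‖M i j - (1 : Matrix ι ι ℂ) i j‖ ≤ δ) →
      M.det ≠ 0 := by
  refine exists_entrywise_of_mem_nhds (U := {M : Matrix ι ι ℂ | M.det ≠ 0}) ?_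
  have hc : Continuous fun M : Matrix ι ι ℂ => M.det := continuous_id.matrix_det
  exact hc.continuousAt.eventually_ne (by simp)

theorem exists_unitary_near_tmul {δ D : ℝ}
    (hδ : ∀ M : Matrix ι ι ℂ, (∀ i j, ‖M i j - (1 : Matrix ι ι ℂ) i j‖ ≤ δ) → M.det ≠ 0)
    {S : Matrix ι ι ℂ} (hu : IsUnit S.det) (hS : ∀ i, ∑ j, ‖S j i‖ ≤ D) {y : ι → Fin n → ℂ}
    (hy : tmul y S⁻¹ ∈ nearOrthonormal n ι δ) {Z : ι → Fin n → ℂ}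
    (hZ : Z ∈ nearOrthonormal n ι δ) :
    ∃ w : unitaryGroup (Fin n) ℂ, ∀ i,
      vnorm (uact w y i - tmul Z S i) ≤ D * (2 * (Fintype.card ι * δ)) := by
  obtain ⟨w, hw⟩ := exists_unitary_near hy hZ (hδ _ hy) (hδ _ hZ)
  refine ⟨w, fun i => ?_⟩
  have h1 : uact w y - tmul Z S = tmul (uact w (tmul y S⁻¹) - Z) S := by
    rw [tmul_sub, ← uact_tmul, tmul_mul, nonsing_inv_mul S hu, tmul_one]
  rw [← Pi.sub_apply, h1]
  refine (vnorm_tmul_le _ S hw i).trans (mul_le_mul_of_nonneg_right (hS i) ?_)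
  exact (vnorm_nonneg _).trans (hw i)

theorem norm_entry_le_of_conjTranspose_mul_self_eq {S : Matrix ι ι ℂ} {y : ι → Fin n → ℂ}
    (hS : Sᴴ * S = tgram y) (i j : ι) : ‖S j i‖ ≤ vnorm (y i) := by
  have h := vnorm_sq_eq y i
  rw [← hS, mul_apply, Complex.re_sum] at h
  have h1 : ∀ l, (Sᴴ i l * S l i).re = ‖S l i‖ ^ 2 := fun l => by
    rw [conjTranspose_apply, RCLike.star_def, RCLike.conj_mul]
    norm_cast
  simp only [h1] at h
  refine (pow_le_pow_iff_left₀ (norm_nonneg _) (vnorm_nonneg _) two_ne_zero).mp ?_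
  rw [h]
  exact Finset.single_le_sum (f := fun l => ‖S l i‖ ^ 2) (fun l _ => sq_nonneg _)
    (Finset.mem_univ j)

/-- With `S` a square root of `tgram y`, the tuple `y S⁻¹` is orthonormal, hence approximately a
rotation of any nearly orthonormal `Z`. Comparing averages bounds the probability by the volume of
`{Z | Z S ≈ x}`, a product of balls up to the Jacobian of `S`. -/
theorem det_mul_unitaryHaar_near_mul_le {δ C ε : ℝ} (hδ0 : 0 ≤ δ) (hε : 0 ≤ ε)
    (hδ : ∀ M : Matrix ι ι ℂ, (∀ i j, ‖M i j - (1 : Matrix ι ι ℂ) i j‖ ≤ δ) → M.det ≠ 0)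
    {x y : ι → Fin n → ℂ} (hy : (tgram y).det ≠ 0) (hC : ∀ i, vnorm (y i) ≤ C) (hC0 : 0 ≤ C) :
    ENNReal.ofReal ‖(tgram y).det‖ ^ n *
      (unitaryHaar n {u | ∀ i, vnorm (y i - uact u x i) ≤ ε} * volume (nearOrthonormal n ι δ)) ≤
    (ENNReal.ofReal (ε + Fintype.card ι * C * (2 * (Fintype.card ι * δ))) ^ (2 * n) *
      ballVolume n) ^ Fintype.card ι := by
  obtain ⟨S, -, hS⟩ := exists_conjTranspose_mul_self_eq (posSemidef_tgram y)
  have hu : IsUnit S.det := isUnit_iff_ne_zero.mpr fun h0 => hy (by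
    rw [← hS, det_mul, h0, mul_zero])
  have hD : ∀ i, ∑ j, ‖S j i‖ ≤ Fintype.card ι * C := fun i => by
    refine (Finset.sum_le_card_nsmul _ _ C fun j _ =>
      (norm_entry_le_of_conjTranspose_mul_self_eq hS i j).trans (hC i)).trans_eq ?_
    rw [Finset.card_univ, nsmul_eq_mul]
  have hJ : tmul y S⁻¹ ∈ nearOrthonormal n ι δ := by
    have h1 : tgram (tmul y S⁻¹) = 1 := by
      rw [tgram_tmul, ← hS, Matrix.mul_assoc, Matrix.mul_assoc, mul_nonsing_inv S hu,
        Matrix.mul_one, ← conjTranspose_mul, mul_nonsing_inv S hu, conjTranspose_one]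
    intro i j
    rw [h1, sub_self, norm_zero]
    exact hδ0
  have h1 := unitaryHaar_near_mul_volume_le (measurableSet_nearOrthonormal δ)
    uact_mem_nearOrthonormal (S := S) (x := x) (y := y)
    (fun Z hZ => exists_unitary_near_tmul hδ hu hD hJ hZ) ε
  refine (mul_le_mul_right h1 _).trans ?_
  rw [← norm_det_of_conjTranspose_mul_self_eq hS]
  rw [← volume_translate_pi_cball x (by positivity)]
  refine le_trans ?_ (volume_preimage_tmul hu.ne_zero _).le
  gcongr
  rintro Z ⟨-, hZ⟩ i
  rw [vnorm_sub_comm]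
  exact hZ i

/-- The two factors `κ ^ n` absorb the variation of `det (tgram y)` near `Q` and the enlargement of
the radius `ε`. The tolerance `ζ₀` depends only on the former, so it can be fixed before `ε`. -/
theorem unitaryHaar_near_le {Q : Matrix ι ι ℂ} (hQ : Q.PosDef) {κ : ℝ} (hκ : 1 < κ) :
    ∃ ζ₀ : ℝ, 0 < ζ₀ ∧ ∀ ε : ℝ, 0 < ε → ∀ᶠ n : ℕ in atTop, ∀ x y : ι → Fin n → ℂ,
      (∀ i j, ‖tgram y i j - Q i j‖ ≤ ζ₀) →
      ENNReal.ofReal ‖Q.det‖ ^ n * unitaryHaar n {u | ∀ i, vnorm (y i - uact u x i) ≤ ε} ≤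
        2 * ENNReal.ofReal (κ ^ 2) ^ n * (ENNReal.ofReal ε ^ (2 * n)) ^ Fintype.card ι := by
  have hQd : 0 < ‖Q.det‖ := norm_pos_iff.mpr hQ.det_pos.ne'
  have hc : Continuous fun M : Matrix ι ι ℂ => κ * ‖M.det‖ :=
    continuous_const.mul (continuous_id.matrix_det).norm
  obtain ⟨ζ₁, hζ₁, h1⟩ := exists_entrywise_of_mem_nhds
    (hc.continuousAt.eventually (lt_mem_nhds (lt_mul_of_one_lt_left hQd hκ)))
  refine ⟨ζ₁, hζ₁, fun ε hε => ?_⟩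
  set p := Fintype.card ι
  obtain ⟨C, hC0, hC⟩ : ∃ C : ℝ, 1 ≤ C ∧ ∀ i, ‖Q i i‖ + ζ₁ ≤ C := by
    refine ⟨1 + ζ₁ + ∑ i, ‖Q i i‖, ?_, fun i => ?_⟩
    · have : 0 ≤ ∑ i, ‖Q i i‖ := by positivity
      linarith
    · have := Finset.single_le_sum (f := fun i => ‖Q i i‖) (fun i _ => norm_nonneg _)
        (Finset.mem_univ i)
      linarith
  obtain ⟨δ₀, hδ₀, hdet⟩ := exists_det_ne_zero ι
  -- Only now is the orthonormality defect chosen, small relative to `ε`, so that the enlarged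
  -- radius costs at most one factor `κ`.
  obtain ⟨δ, hδ0, hδ1, hδ2⟩ : ∃ δ : ℝ, 0 < δ ∧ δ ≤ δ₀ ∧
      (ε + p * C * (2 * (p * δ))) ^ (2 * p) < κ * ε ^ (2 * p) := by
    have hcont : Continuous fun δ : ℝ => (ε + p * C * (2 * (p * δ))) ^ (2 * p) := by fun_prop
    have h2 := (hcont.tendsto' 0 (ε ^ (2 * p)) (by simp)).eventually
      (gt_mem_nhds (lt_mul_of_one_lt_left (by positivity) hκ))
    have h3 : ∀ᶠ δ : ℝ in 𝓝[>] 0, 0 < δ ∧ δ ≤ δ₀ ∧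
        (ε + p * C * (2 * (p * δ))) ^ (2 * p) < κ * ε ^ (2 * p) := by
      filter_upwards [self_mem_nhdsWithin, nhdsWithin_le_nhds h2,
        nhdsWithin_le_nhds (ge_mem_nhds hδ₀)] with δ a1 a2 a3
      exact ⟨a1, a3, a2⟩
    exact h3.exists
  filter_upwards [eventually_volume_nearOrthonormal_ge ι hδ0] with n hn x y hy
  have hG : ‖Q.det‖ < κ * ‖(tgram y).det‖ := h1 _ hy
  have hGd : (tgram y).det ≠ 0 := fun h0 => by
    rw [h0, norm_zero, mul_zero] at hG
    linarith
  have hyC : ∀ i, vnorm (y i) ≤ C := fun i => by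
    have a1 := vnorm_sq_eq y i
    have a2 := Complex.re_le_norm (tgram y i i)
    have a3 := norm_sub_norm_le (tgram y i i) (Q i i)
    have a4 := hy i i
    have a5 := hC i
    refine abs_le_of_sq_le_sq' ?_ (by linarith) |>.2
    nlinarith
  have h2 := det_mul_unitaryHaar_near_mul_le (x := x) hδ0.le hε.le
    (fun M hM => hdet M fun i j => (hM i j).trans hδ1) hGd hyC (by linarith)
  set P := unitaryHaar n {u | ∀ i, vnorm (y i - uact u x i) ≤ ε}
  have hβ0 : ballVolume n ^ p ≠ 0 := pow_ne_zero _ (ballVolume_ne_zero n)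
  have hβ1 : ballVolume n ^ p ≠ ⊤ := ENNReal.pow_ne_top (ballVolume_ne_top n)
  rw [← ENNReal.mul_le_mul_iff_left hβ0 hβ1]
  have h3 : ENNReal.ofReal ‖Q.det‖ ^ n ≤
      ENNReal.ofReal κ ^ n * ENNReal.ofReal ‖(tgram y).det‖ ^ n := by
    rw [← mul_pow, ← ENNReal.ofReal_mul (by linarith)]
    gcongr
  have h4 : (ENNReal.ofReal (ε + p * C * (2 * (p * δ))) ^ (2 * n) * ballVolume n) ^ p ≤
      ENNReal.ofReal κ ^ n * (ENNReal.ofReal ε ^ (2 * n)) ^ p * ballVolume n ^ p := by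
    have a1 : ∀ t : ℝ, 0 ≤ t →
        (ENNReal.ofReal t ^ (2 * n)) ^ p = ENNReal.ofReal (t ^ (2 * p)) ^ n := fun t ht => by
      rw [ENNReal.ofReal_pow ht, ← pow_mul, ← pow_mul]
      congr 1
      ring
    rw [mul_pow, a1 _ (by positivity), a1 _ hε.le, ← mul_pow, ← ENNReal.ofReal_mul (by linarith)]
    gcongr
  calc ENNReal.ofReal ‖Q.det‖ ^ n * P * ballVolume n ^ p
      ≤ (ENNReal.ofReal κ ^ n * ENNReal.ofReal ‖(tgram y).det‖ ^ n) * P *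
        (2 * volume (nearOrthonormal n ι δ)) := by gcongr
    _ = 2 * ENNReal.ofReal κ ^ n * (ENNReal.ofReal ‖(tgram y).det‖ ^ n *
        (P * volume (nearOrthonormal n ι δ))) := by ring
    _ ≤ 2 * ENNReal.ofReal κ ^ n * (ENNReal.ofReal κ ^ n * (ENNReal.ofReal ε ^ (2 * n)) ^ p *
        ballVolume n ^ p) := by
      exact mul_le_mul_right (h2.trans h4) _
    _ = _ := by
      rw [ENNReal.ofReal_pow (by linarith)]
      ring

/-- Adding `ε κ` to `x` adds about `ε²` times the identity to the Gram matrix, the cross terms being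
small by near orthogonality. -/
theorem norm_tgram_add_smul_sub_le {x κ : ι → Fin n → ℂ} {Q : Matrix ι ι ℂ} {ε ζ t : ℝ}
    (hε : 0 ≤ ε) (hx : ∀ i j, ‖tgram x i j - (Q - ((ε ^ 2 : ℝ) : ℂ) • (1 : Matrix ι ι ℂ)) i j‖ ≤ ζ)
    (hκ : ∀ i j, ‖tgram κ i j - (1 : Matrix ι ι ℂ) i j‖ ≤ t)
    (hxκ : ∀ i j, ‖star (x i) ⬝ᵥ κ j‖ ≤ t) (i j : ι) :
    ‖tgram (fun i => x i + (ε : ℂ) • κ i) i j - Q i j‖ ≤ ζ + (2 * ε + ε ^ 2) * t := by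
  have h1 : tgram (fun i => x i + (ε : ℂ) • κ i) i j - Q i j =
      (tgram x i j - (Q - ((ε ^ 2 : ℝ) : ℂ) • (1 : Matrix ι ι ℂ)) i j) +
      ((ε ^ 2 : ℝ) : ℂ) * (tgram κ i j - (1 : Matrix ι ι ℂ) i j) +
      ((ε : ℂ) * (star (x i) ⬝ᵥ κ j) + (ε : ℂ) * star (star (x j) ⬝ᵥ κ i)) := by
    have h2 : star (star (x j) ⬝ᵥ κ i) = star (κ i) ⬝ᵥ x j := by
      rw [star_dotProduct, star_star]
    have h3 : (Q - ((ε ^ 2 : ℝ) : ℂ) • (1 : Matrix ι ι ℂ)) i j =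
        Q i j - ((ε ^ 2 : ℝ) : ℂ) * (1 : Matrix ι ι ℂ) i j := rfl
    have h4 : star (ε : ℂ) = ε := Complex.conj_ofReal ε
    rw [h3, tgram_apply, tgram_apply, tgram_apply, star_add, star_smul, add_dotProduct,
      dotProduct_add, dotProduct_add, smul_dotProduct, smul_dotProduct, dotProduct_smul,
      dotProduct_smul, h2, h4, Complex.ofReal_pow]
    simp only [smul_eq_mul]
    ring
  rw [h1]
  have e1 := hx i j
  have e2 : ‖((ε ^ 2 : ℝ) : ℂ) * (tgram κ i j - (1 : Matrix ι ι ℂ) i j)‖ ≤ ε ^ 2 * t := by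
    rw [norm_mul, Complex.norm_real, Real.norm_of_nonneg (by positivity)]
    exact mul_le_mul_of_nonneg_left (hκ i j) (by positivity)
  have e3 : ‖(ε : ℂ) * (star (x i) ⬝ᵥ κ j)‖ ≤ ε * t := by
    rw [norm_mul, Complex.norm_real, Real.norm_of_nonneg hε]
    exact mul_le_mul_of_nonneg_left (hxκ i j) hε
  have e4 : ‖(ε : ℂ) * star (star (x j) ⬝ᵥ κ i)‖ ≤ ε * t := by
    rw [norm_mul, norm_star, Complex.norm_real, Real.norm_of_nonneg hε]
    exact mul_le_mul_of_nonneg_left (hxκ j i) hε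
  have e5 := norm_add_le ((ε : ℂ) * (star (x i) ⬝ᵥ κ j)) ((ε : ℂ) * star (star (x j) ⬝ᵥ κ i))
  have e6 := norm_add₃_le (a := tgram x i j - (Q - ((ε ^ 2 : ℝ) : ℂ) • (1 : Matrix ι ι ℂ)) i j)
    (b := ((ε ^ 2 : ℝ) : ℂ) * (tgram κ i j - (1 : Matrix ι ι ℂ) i j))
    (c := (ε : ℂ) * (star (x i) ⬝ᵥ κ j) + (ε : ℂ) * star (star (x j) ⬝ᵥ κ i))
  linarith

/-- The image of a set of tuples under `κ ↦ x + ε κ`. -/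
theorem volume_preimage_add_smul (x : ι → Fin n → ℂ) {ε : ℝ} (hε : 0 < ε)
    (A : Set (ι → Fin n → ℂ)) :
    (ENNReal.ofReal ε ^ (2 * n)) ^ Fintype.card ι *
      volume {κ : ι → Fin n → ℂ | (fun i => x i + (ε : ℂ) • κ i) ∈ A} = volume A := by
  have h1 : IsUnit ((ε : ℂ) • (1 : Matrix ι ι ℂ)).det := by
    simp [hε.ne']
  have h2 := volume_preimage_tmul h1.ne_zero ((fun z => x + z) ⁻¹' A)
  rw [measure_preimage_add] at h2
  rw [← h2]
  congr 1
  · rw [det_smul, det_one, mul_one, norm_pow, Complex.norm_real, Real.norm_of_nonneg hε.le,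
      ENNReal.ofReal_pow (by positivity), ENNReal.ofReal_pow hε.le, ← pow_mul, ← pow_mul, ← pow_mul]
    congr 1
    ring
  · congr 1
    ext κ
    have h3 : tmul κ ((ε : ℂ) • (1 : Matrix ι ι ℂ)) = fun i => (ε : ℂ) • κ i := by
      ext i : 1
      simp [tmul, Matrix.one_apply, ite_smul]
    simp only [Set.mem_preimage, h3]
    rfl

/-- If the Gram matrix of `x` is smaller than `Q` by `ε'² I`, then `x + ε' κ` has Gram matrix near
`Q` for most `κ` in the product of unit balls. Most of the `ε'`-neighbourhood of `x` thus consists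
of `Z S` with `Z` nearly orthonormal. The gap between `ε'` and `ε` absorbs the error in rotating `y`
to `Z S`. -/
theorem le_unitaryHaar_near {Q : Matrix ι ι ℂ} (hQ : Q.PosDef) {ε' ε κ : ℝ} (hε' : 0 < ε')
    (hε : ε' < ε) (hκ : 1 < κ) :
    ∃ ζ₀ : ℝ, 0 < ζ₀ ∧ ∀ᶠ n : ℕ in atTop, ∀ x y : ι → Fin n → ℂ,
      (∀ i j, ‖tgram x i j - (Q - ((ε' ^ 2 : ℝ) : ℂ) • (1 : Matrix ι ι ℂ)) i j‖ ≤ ζ₀) →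
      (∀ i j, ‖tgram y i j - Q i j‖ ≤ ζ₀) →
      (ENNReal.ofReal ε' ^ (2 * n)) ^ Fintype.card ι ≤ 2 * ENNReal.ofReal (κ * ‖Q.det‖) ^ n *
        unitaryHaar n {u | ∀ i, vnorm (y i - uact u x i) ≤ ε} := by
  obtain ⟨S, hS, hu⟩ := exists_sqrt_of_posDef hQ
  set p := Fintype.card ι
  let D : ℝ := ∑ i, ∑ j, ‖S j i‖
  have hD : ∀ i, ∑ j, ‖S j i‖ ≤ D := fun i =>
    Finset.single_le_sum (f := fun i => ∑ j, ‖S j i‖) (fun i _ => by positivity)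
      (Finset.mem_univ i)
  obtain ⟨δ₀, hδ₀, hdet⟩ := exists_det_ne_zero ι
  obtain ⟨δ, hδ0, hδ1, hδ2, hδ3⟩ : ∃ δ : ℝ, 0 < δ ∧ δ ≤ δ₀ ∧
      D * (2 * (p * δ)) < ε - ε' ∧ (1 + δ) ^ p < κ := by
    have hc1 : Continuous fun δ : ℝ => D * (2 * (p * δ)) := by fun_prop
    have hc2 : Continuous fun δ : ℝ => (1 + δ) ^ p := by fun_prop
    have h3 : ∀ᶠ δ : ℝ in 𝓝[>] 0, 0 < δ ∧ δ ≤ δ₀ ∧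
        D * (2 * (p * δ)) < ε - ε' ∧ (1 + δ) ^ p < κ := by
      filter_upwards [self_mem_nhdsWithin, nhdsWithin_le_nhds (ge_mem_nhds hδ₀),
        nhdsWithin_le_nhds ((hc1.tendsto' 0 0 (by simp)).eventually
          (gt_mem_nhds (sub_pos.mpr hε))),
        nhdsWithin_le_nhds ((hc2.tendsto' 0 1 (by simp)).eventually
          (gt_mem_nhds hκ))] with δ a1 a2 a3 a4
      exact ⟨a1, a2, a3, a4⟩
    exact h3.exists
  have hinv : S⁻¹ᴴ * Q * S⁻¹ = 1 := by
    rw [← hS, Matrix.mul_assoc, Matrix.mul_assoc, mul_nonsing_inv S hu,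
        Matrix.mul_one, ← conjTranspose_mul, mul_nonsing_inv S hu, conjTranspose_one]
  obtain ⟨ζ, hζ, hnear⟩ : ∃ ζ : ℝ, 0 < ζ ∧ ∀ M : Matrix ι ι ℂ, (∀ i j, ‖M i j - Q i j‖ ≤ ζ) →
      ∀ i j, ‖(S⁻¹ᴴ * M * S⁻¹) i j - (1 : Matrix ι ι ℂ) i j‖ ≤ δ := by
    refine exists_entrywise_of_mem_nhds (U := {M : Matrix ι ι ℂ |
      ∀ i j, ‖(S⁻¹ᴴ * M * S⁻¹) i j - (1 : Matrix ι ι ℂ) i j‖ ≤ δ}) ?_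
    have hc : ∀ i j, Continuous fun M : Matrix ι ι ℂ =>
        ‖(S⁻¹ᴴ * M * S⁻¹) i j - (1 : Matrix ι ι ℂ) i j‖ := fun i j => by
      have h1 : Continuous fun M : Matrix ι ι ℂ => S⁻¹ᴴ * M * S⁻¹ := by fun_prop
      exact ((h1.matrix_elem i j).sub continuous_const).norm
    refine eventually_all.mpr fun i => eventually_all.mpr fun j =>
      ((hc i j).tendsto' Q 0 ?_).eventually (ge_mem_nhds hδ0)
    rw [hinv, sub_self, norm_zero]
  -- Half of the tolerance `ζ` is for the Gram matrix of `x`; `t` is chosen so that the displacement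
  -- uses exactly the other half.
  let t : ℝ := ζ / 2 / (2 * ε' + ε' ^ 2)
  have ht : 0 < t := by positivity
  have ht2 : (2 * ε' + ε' ^ 2) * t = ζ / 2 := by
    simp only [t]
    field_simp
  obtain ⟨C, hC0, hC⟩ : ∃ C : ℝ, 1 ≤ C ∧
      ∀ i, ‖(Q - ((ε' ^ 2 : ℝ) : ℂ) • (1 : Matrix ι ι ℂ)) i i‖ + ζ / 2 ≤ C := by
    refine ⟨1 + ζ / 2 + ∑ i, ‖(Q - ((ε' ^ 2 : ℝ) : ℂ) • (1 : Matrix ι ι ℂ)) i i‖, ?_,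
      fun i => ?_⟩
    · have : 0 ≤ ∑ i, ‖(Q - ((ε' ^ 2 : ℝ) : ℂ) • (1 : Matrix ι ι ℂ)) i i‖ := by positivity
      linarith
    · have := Finset.single_le_sum
        (f := fun i => ‖(Q - ((ε' ^ 2 : ℝ) : ℂ) • (1 : Matrix ι ι ℂ)) i i‖)
        (fun i _ => norm_nonneg _) (Finset.mem_univ i)
      linarith
  refine ⟨ζ / 2, half_pos hζ, ?_⟩
  filter_upwards [eventually_volume_spreadTuples_ge ι ι C (le_max_left 0 (1 - t / 2))
    (max_lt one_pos (by linarith)) ht] with n hn x y hx hy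
  have hxC : ∀ i, vnorm (x i) ≤ C := fun i => by
    have a1 := vnorm_sq_eq x i
    have a2 := Complex.re_le_norm (tgram x i i)
    have a3 := norm_sub_norm_le (tgram x i i) ((Q - ((ε' ^ 2 : ℝ) : ℂ) • (1 : Matrix ι ι ℂ)) i i)
    have a4 := hx i i
    have a5 := hC i
    refine abs_le_of_sq_le_sq' ?_ (by linarith) |>.2
    nlinarith
  have hJ : tmul y S⁻¹ ∈ nearOrthonormal n ι δ := fun i j => by
    rw [tgram_tmul]
    exact hnear _ (fun i j => (hy i j).trans (by linarith)) i j
  have h1 := volume_le_unitaryHaar_near_mul (measurableSet_nearOrthonormal δ)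
    uact_mem_nearOrthonormal (S := S) (x := x) (y := y)
    (fun Z hZ => exists_unitary_near_tmul (fun M hM => hdet M fun i j => (hM i j).trans hδ1)
      hu hD hJ hZ) ε'
  set R := nearOrthonormal n ι δ
  have h2 : unitaryHaar n {u | ∀ i, vnorm (y i - uact u x i) ≤ ε' + D * (2 * (p * δ))} ≤
      unitaryHaar n {u | ∀ i, vnorm (y i - uact u x i) ≤ ε} :=
    measure_mono fun u hu i => (hu i).trans (by linarith)
  have h3 := volume_preimage_tmul_inv hS hu (R ∩ {Z | ∀ i, vnorm (tmul Z S i - x i) ≤ ε'})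
  have h4 := volume_preimage_add_smul x hε'
    ((fun x => tmul x S⁻¹) ⁻¹' (R ∩ {Z | ∀ i, vnorm (tmul Z S i - x i) ≤ ε'}))
  have h5 : (Set.univ.pi fun _ => cball n 1) ∩
      (spreadTuples x (max 0 (1 - t / 2)) t : Set (ι → Fin n → ℂ)) ⊆
      {κ : ι → Fin n → ℂ | (fun i => x i + (ε' : ℂ) • κ i) ∈
        ((fun x => tmul x S⁻¹) ⁻¹' (R ∩ {Z | ∀ i, vnorm (tmul Z S i - x i) ≤ ε'}))} := by
    rintro κ ⟨k1, k2⟩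
    refine ⟨fun i j => ?_, fun i => ?_⟩
    · rw [tgram_tmul]
      refine hnear _ (fun i j => ?_) i j
      have := norm_tgram_add_smul_sub_le hε'.le hx
        (norm_tgram_sub_one_le_of_spread ht.le k1 k2) k2.2.2 i j
      rw [ht2] at this
      linarith
    · rw [tmul_mul, nonsing_inv_mul S hu, tmul_one, add_sub_cancel_left, vnorm_smul,
        Complex.norm_real, Real.norm_of_nonneg hε'.le]
      have : vnorm (κ i) ≤ 1 := k1 i (Set.mem_univ i)
      nlinarith
  have hβ0 : ballVolume n ^ p ≠ 0 := pow_ne_zero _ (ballVolume_ne_zero n)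
  have hβ1 : ballVolume n ^ p ≠ ⊤ := ENNReal.pow_ne_top (ballVolume_ne_top n)
  rw [← ENNReal.mul_le_mul_iff_left hβ0 hβ1]
  have h6 : volume R ≤ ENNReal.ofReal κ ^ n * ballVolume n ^ p := by
    refine (volume_nearOrthonormal_le hδ0.le).trans ?_
    rw [mul_pow, ← pow_mul, mul_comm n, pow_mul, ← ENNReal.ofReal_pow (by positivity)]
    gcongr
  calc (ENNReal.ofReal ε' ^ (2 * n)) ^ p * ballVolume n ^ p
      ≤ (ENNReal.ofReal ε' ^ (2 * n)) ^ p * (2 *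
        volume {κ : ι → Fin n → ℂ | (fun i => x i + (ε' : ℂ) • κ i) ∈
          ((fun x => tmul x S⁻¹) ⁻¹' (R ∩ {Z | ∀ i, vnorm (tmul Z S i - x i) ≤ ε'}))}) :=
        mul_le_mul_right ((hn x hxC).trans (mul_le_mul_right (measure_mono h5) _)) _
    _ = 2 * (ENNReal.ofReal ‖Q.det‖ ^ n *
        volume (R ∩ {Z | ∀ i, vnorm (tmul Z S i - x i) ≤ ε'})) := by
        rw [← h3, ← h4]; ring
    _ ≤ 2 * (ENNReal.ofReal ‖Q.det‖ ^ n *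
        (unitaryHaar n {u | ∀ i, vnorm (y i - uact u x i) ≤ ε} *
          (ENNReal.ofReal κ ^ n * ballVolume n ^ p))) := by
        gcongr
        exact h1.trans (by gcongr)
    _ = _ := by
        rw [ENNReal.ofReal_mul (by linarith), mul_pow]
        ring

end EdgeProbability

/-! ### Upper bound for the expected volume over a window -/

section UpperBound

open Matrix

variable {S : Type*} [Fintype S] [DecidableEq S] {n k : ℕ} {F : Finset (FreeGroup S)}

theorem volume_curry_preimage {α β E : Type*} [Fintype α] [Fintype β] [MeasureSpace E]
    [SigmaFinite (volume : Measure E)] {A : Set (α × β → E)} (hA : MeasurableSet A) :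
    volume {X : α → β → E | (fun p : α × β => X p.1 p.2) ∈ A} = volume A := by
  have hm : Measurable fun (X : α → β → E) (p : α × β) => X p.1 p.2 := by fun_prop
  have h : Measure.map (fun (X : α → β → E) (p : α × β) => X p.1 p.2) volume =
      (volume : Measure (α × β → E)) := by
    refine (Measure.pi_eq fun s hs => ?_).symm
    rw [Measure.map_apply hm (MeasurableSet.univ_pi hs)]
    have h1 : (fun (X : α → β → E) (p : α × β) => X p.1 p.2) ⁻¹' Set.univ.pi s =
        Set.univ.pi fun a => Set.univ.pi fun b => s (a, b) := by
      ext X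
      simp
    rw [h1, volume_pi_pi]
    simp only [volume_pi_pi, Fintype.prod_prod_type]
  rw [← h, Measure.map_apply hm hA]
  rfl

theorem volume_gramNear (Q : Matrix (F × Fin k) (F × Fin k) ℂ) (ζ : ℝ) :
    volume (gramNear n Q ζ) =
      volume {x : F × Fin k → Fin n → ℂ | ∀ p q, ‖tgram x p q - Q p q‖ ≤ ζ} := by
  refine volume_curry_preimage
    (A := {x : F × Fin k → Fin n → ℂ | ∀ p q, ‖tgram x p q - Q p q‖ ≤ ζ}) ?_
  refine IsClosed.measurableSet ?_
  simp only [Set.ofPred_forall]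
  exact isClosed_iInter fun i => isClosed_iInter fun j => isClosed_le
    (((continuous_tgram.matrix_elem i j).sub continuous_const).norm) continuous_const

theorem norm_det_blockMatrix {φ : FreeGroup S → Matrix (Fin k) (Fin k) ℂ}
    (hφ : IsPositiveDefinite φ) (F : Finset (FreeGroup S)) :
    ‖(blockMatrix φ F).det‖ = gramDet φ F := by
  rw [← ofReal_re_det_of_posSemidef (blockMatrix_posSemidef hφ F), Complex.norm_real]
  exact Real.norm_of_nonneg (gramDet_nonneg hφ F)

theorem posDef_blockMatrix {φ : FreeGroup S → Matrix (Fin k) (Fin k) ℂ}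
    (hφ : IsPositiveDefinite φ) (h : 0 < gramDet φ F) : (blockMatrix φ F).PosDef := by
  rw [(blockMatrix_posSemidef hφ F).posDef_iff_det_ne_zero, ← norm_pos_iff,
    norm_det_blockMatrix hφ]
  exact h

/-- The source of an edge, as an index of `F × Fin k`. -/
def sourceIndex (s : S) (p : letterEdges (s, true) F × Fin k) : F × Fin k :=
  (⟨p.1, (mem_letterEdges.mp p.1.2).1⟩, p.2)

/-- The target of an edge, as an index of `F × Fin k`. -/
def targetIndex (s : S) (p : letterEdges (s, true) F × Fin k) : F × Fin k :=
  (⟨letter (s, true) * p.1, (mem_letterEdges.mp p.1.2).2⟩, p.2)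

theorem tgram_edgeSource (s : S) (X : F → Fin k → Fin n → ℂ)
    (p q : letterEdges (s, true) F × Fin k) :
    tgram (edgeSource s X) p q = blockGram X (sourceIndex s p) (sourceIndex s q) := rfl

theorem tgram_edgeTarget (s : S) (X : F → Fin k → Fin n → ℂ)
    (p q : letterEdges (s, true) F × Fin k) :
    tgram (edgeTarget s X) p q = blockGram X (targetIndex s p) (targetIndex s q) := rfl

theorem blockMatrix_sourceIndex (φ : FreeGroup S → Matrix (Fin k) (Fin k) ℂ) (s : S)
    (p q : letterEdges (s, true) F × Fin k) :
    blockMatrix φ F (sourceIndex s p) (sourceIndex s q) =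
      blockMatrix φ (letterEdges (s, true) F) p q := rfl

theorem blockMatrix_targetIndex (φ : FreeGroup S → Matrix (Fin k) (Fin k) ℂ) (s : S)
    (p q : letterEdges (s, true) F × Fin k) :
    blockMatrix φ F (targetIndex s p) (targetIndex s q) =
      blockMatrix φ (letterEdges (s, true) F) p q := by
  simp only [blockMatrix, targetIndex, of_apply]
  rw [_root_.mul_inv_rev, mul_assoc, inv_mul_cancel_left]

/-- Tree counting: one ball volume per vertex and one power of `ε` per edge, matching the Gram
volume and the edge probabilities respectively. -/
theorem incrementVolume_eq (hF : IsRooted F) (k n : ℕ) (ε : ℝ) :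
    incrementVolume F k n ε = ballVolume n ^ Fintype.card (F × Fin k) *
      ∏ s : S, (ENNReal.ofReal ε ^ (2 * n)) ^
        Fintype.card (letterEdges (s, true) F × Fin k) := by
  have h := sum_card_letterEdges hF
  have h1 : F.card - 1 = ∑ s : S, (letterEdges (s, true) F).card := by omega
  rw [incrementVolume, Finset.prod_pow_eq_pow_sum, mul_pow, h1]
  simp only [Fintype.card_prod, Fintype.card_coe, Fintype.card_fin]
  rw [← h, ← Finset.sum_mul, mul_comm k, add_mul, one_mul, pow_add]
  ring

variable {φ : FreeGroup S → Matrix (Fin k) (Fin k) ℂ}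

theorem exists_diag_bound (Q : Matrix (F × Fin k) (F × Fin k) ℂ) :
    ∃ C : ℝ, 1 ≤ C ∧ ∀ p, ‖Q p p‖ + 2 ≤ C ^ 2 := by
  have h0 : 0 ≤ ∑ p, ‖Q p p‖ := by positivity
  refine ⟨2 + ∑ p, ‖Q p p‖, by linarith, fun p => ?_⟩
  have := Finset.single_le_sum (f := fun p => ‖Q p p‖) (fun p _ => norm_nonneg _)
    (Finset.mem_univ p)
  nlinarith

/-- Exponential upper bound for the expected volume of the tuples typical for a small window
neighbourhood. -/
theorem exists_expectedVolume_mul_le (hφ : IsPositiveDefinite φ) (hF : IsRooted F)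
    (hpos : ∀ s : S, 0 < gramDet φ (letterEdges (s, true) F)) {a κ : ℝ} (ha : gramDet φ F < a)
    (hκ : 1 < κ) :
    ∃ η : ℝ, 0 < η ∧ ∀ᶠ n : ℕ in atTop,
      expectedVolume n (windowNhd φ F η) *
          ∏ s : S, ENNReal.ofReal (gramDet φ (letterEdges (s, true) F)) ^ n ≤
        (2 * ENNReal.ofReal (κ ^ 2) ^ n) ^ Fintype.card S * ENNReal.ofReal a ^ n := by
  rw [← norm_det_blockMatrix hφ] at ha
  obtain ⟨ζv, hζv, hvol⟩ := volume_tgram_near_le (blockMatrix_posSemidef hφ F) ha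
  choose ζe hζe hedge using fun s : S => unitaryHaar_near_le (posDef_blockMatrix hφ (hpos s)) hκ
  obtain ⟨C, hC1, hC⟩ := exists_diag_bound (blockMatrix φ F)
  let m := F.sup FreeGroup.norm
  have hm : ∀ g ∈ F, g.norm ≤ m := fun g hg => Finset.le_sup (f := FreeGroup.norm) hg
  -- The Gram tolerance `ζ` comes first, then `ε` with orbit error below `ζ / 2`, then the
  -- neighbourhood. This order is possible since the tolerances `ζe s` do not depend on `ε`.
  obtain ⟨ζ, hζ0, hζ1, hζ2⟩ : ∃ ζ : ℝ, 0 < ζ ∧ ζ ≤ ζv ∧ ∀ s, ζ ≤ ζe s := by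
    have h : ∀ᶠ ζ : ℝ in 𝓝[>] 0, 0 < ζ ∧ ζ ≤ ζv ∧ ∀ s, ζ ≤ ζe s := by
      filter_upwards [self_mem_nhdsWithin, nhdsWithin_le_nhds (ge_mem_nhds hζv),
        eventually_all.mpr fun s => nhdsWithin_le_nhds (ge_mem_nhds (hζe s))] with ζ a1 a2 a3
      exact ⟨a1, a2, a3⟩
    exact h.exists
  obtain ⟨ε, hε0, hε1⟩ : ∃ ε : ℝ, 0 < ε ∧ m * ε * (2 * C + m * ε) < ζ / 2 := by
    have hc : Continuous fun ε : ℝ => m * ε * (2 * C + m * ε) := by fun_prop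
    have h : ∀ᶠ ε : ℝ in 𝓝[>] 0, 0 < ε ∧ m * ε * (2 * C + m * ε) < ζ / 2 := by
      filter_upwards [self_mem_nhdsWithin, nhdsWithin_le_nhds
        ((hc.tendsto' 0 0 (by simp)).eventually (gt_mem_nhds (half_pos hζ0)))] with ε a1 a2
      exact ⟨a1, a2⟩
    exact h.exists
  -- The bound `1` keeps the diagonal below `C ^ 2`; `ζ / 2` is what the orbit error leaves of the
  -- Gram tolerance.
  refine ⟨min 1 (ζ / 2), lt_min one_pos (half_pos hζ0), ?_⟩
  filter_upwards [eventually_all.mpr fun s => hedge s ε hε0] with n hn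
  have h1 := expectedVolume_le_couplingVolume (n := n) (η := min 1 (ζ / 2)) hF hm (by linarith)
    hε0.le (fun p => le_trans (by gcongr; exact (min_le_left _ _).trans one_le_two) (hC p))
    (le_trans (add_le_add hε1.le (min_le_right 1 (ζ / 2))) (add_halves ζ).le)
  rw [couplingVolume_eq] at h1
  set P : S → (F → Fin k → Fin n → ℂ) → ℝ≥0∞ := fun s X =>
    unitaryHaar n {u | ∀ p, vnorm (edgeTarget s X p - uact u (edgeSource s X) p) ≤ ε}
  have h2 : ∀ X ∈ gramNear n (blockMatrix φ F) ζ,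
      (∏ s : S, ENNReal.ofReal (gramDet φ (letterEdges (s, true) F)) ^ n) * ∏ s, P s X ≤
        ∏ s : S, (2 * ENNReal.ofReal (κ ^ 2) ^ n * (ENNReal.ofReal ε ^ (2 * n)) ^
          Fintype.card (letterEdges (s, true) F × Fin k)) := by
    intro X hX
    rw [← Finset.prod_mul_distrib]
    refine Finset.prod_le_prod' fun s _ => ?_
    rw [← norm_det_blockMatrix hφ]
    refine hn s _ _ fun p q => ?_
    rw [tgram_edgeTarget, ← blockMatrix_targetIndex]
    exact (hX _ _).trans (hζ2 s)
  have hK1 : (∏ s : S, ENNReal.ofReal (gramDet φ (letterEdges (s, true) F)) ^ n) ≠ ⊤ :=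
    ENNReal.prod_ne_top fun s _ => ENNReal.pow_ne_top ENNReal.ofReal_ne_top
  have hinc0 : incrementVolume F k n ε ≠ 0 := by
    unfold incrementVolume
    have h3 : ENNReal.ofReal ε ≠ 0 := by simpa using hε0
    exact mul_ne_zero (pow_ne_zero _ (ballVolume_ne_zero n))
      (pow_ne_zero _ (mul_ne_zero (pow_ne_zero _ h3) (ballVolume_ne_zero n)))
  rw [← ENNReal.mul_le_mul_iff_left hinc0 (incrementVolume_ne_top ε)]
  calc _ = (∏ s : S, ENNReal.ofReal (gramDet φ (letterEdges (s, true) F)) ^ n) *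
        (expectedVolume n (windowNhd φ F (min 1 (ζ / 2))) * incrementVolume F k n ε) := by ring
    _ ≤ (∏ s : S, ENNReal.ofReal (gramDet φ (letterEdges (s, true) F)) ^ n) *
        ∫⁻ X in gramNear n (blockMatrix φ F) ζ, ∏ s, P s X := by gcongr
    _ = ∫⁻ X in gramNear n (blockMatrix φ F) ζ,
        (∏ s : S, ENNReal.ofReal (gramDet φ (letterEdges (s, true) F)) ^ n) * ∏ s, P s X :=
      (lintegral_const_mul' _ _ hK1).symm
    _ ≤ ∫⁻ _ in gramNear n (blockMatrix φ F) ζ,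
        ∏ s : S, (2 * ENNReal.ofReal (κ ^ 2) ^ n * (ENNReal.ofReal ε ^ (2 * n)) ^
          Fintype.card (letterEdges (s, true) F × Fin k)) :=
      setLIntegral_mono' (measurableSet_gramNear _ _) h2
    _ = (∏ s : S, (2 * ENNReal.ofReal (κ ^ 2) ^ n * (ENNReal.ofReal ε ^ (2 * n)) ^
          Fintype.card (letterEdges (s, true) F × Fin k))) *
          volume (gramNear n (blockMatrix φ F) ζ) := setLIntegral_const _ _
    _ ≤ (∏ s : S, (2 * ENNReal.ofReal (κ ^ 2) ^ n * (ENNReal.ofReal ε ^ (2 * n)) ^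
          Fintype.card (letterEdges (s, true) F × Fin k))) *
          (ENNReal.ofReal a ^ n * ballVolume n ^ Fintype.card (F × Fin k)) := by
      gcongr
      rw [volume_gramNear]
      exact hvol ζ hζ1 n
    _ = _ := by
      rw [incrementVolume_eq hF, Finset.prod_mul_distrib, Finset.prod_const, Finset.card_univ]
      ring

end UpperBound

/-! ### Lower bound for the expected volume over a window -/

section LowerBound

open Matrix

variable {S : Type*} [Fintype S] [DecidableEq S] {n k : ℕ} {F : Finset (FreeGroup S)}

/-- The total exponent of the word `g`. -/
def totalExponent (g : FreeGroup S) : ℤ :=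
  Multiplicative.toAdd (FreeGroup.lift (fun _ : S => Multiplicative.ofAdd (1 : ℤ)) g)

theorem totalExponent_letter_mul (s : S) (g : FreeGroup S) :
    totalExponent (letter (s, true) * g) = totalExponent g + 1 := by
  rw [letter_true, totalExponent, map_mul, FreeGroup.lift_apply_of, toAdd_mul, toAdd_ofAdd, add_comm]
  rfl

/-- A non-negative function on `F` that increases by one along every edge. -/
def edgeHeight (F : Finset (FreeGroup S)) (g : FreeGroup S) : ℝ :=
  ∑ h ∈ F, |(totalExponent h : ℝ)| + totalExponent g

theorem edgeHeight_nonneg (g : F) : 0 ≤ edgeHeight F g := by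
  have h1 := Finset.single_le_sum (f := fun h : FreeGroup S => |(totalExponent h : ℝ)|)
    (fun h _ => abs_nonneg _) g.2
  have h2 := neg_abs_le (totalExponent (g : FreeGroup S) : ℝ)
  unfold edgeHeight
  linarith

theorem edgeHeight_letter_mul (s : S) (g : FreeGroup S) :
    edgeHeight F (letter (s, true) * g) = edgeHeight F g + 1 := by
  rw [edgeHeight, totalExponent_letter_mul, edgeHeight]
  push_cast
  ring

/-- The block matrix with the diagonal increased so that passing from the source to the target of
an edge increases the diagonal by `t ^ 2`. -/
def inflatedBlock (φ : FreeGroup S → Matrix (Fin k) (Fin k) ℂ) (F : Finset (FreeGroup S)) (t : ℝ) :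
    Matrix (F × Fin k) (F × Fin k) ℂ :=
  blockMatrix φ F + diagonal fun p => ((t ^ 2 * edgeHeight F p.1 : ℝ) : ℂ)

variable {φ : FreeGroup S → Matrix (Fin k) (Fin k) ℂ}

theorem inflatedBlock_zero : inflatedBlock φ F 0 = blockMatrix φ F := by
  simp [inflatedBlock]

theorem continuous_inflatedBlock : Continuous (inflatedBlock φ F) := by
  refine continuous_const.add (Continuous.matrix_diagonal ?_)
  fun_prop

theorem posDef_inflatedBlock (hφ : IsPositiveDefinite φ) (h : 0 < gramDet φ F) (t : ℝ) :
    (inflatedBlock φ F t).PosDef := by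
  refine (posDef_blockMatrix hφ h).add_posSemidef (PosSemidef.diagonal fun p => ?_)
  rw [Pi.zero_apply, Complex.zero_le_real]
  have := edgeHeight_nonneg p.1
  positivity

theorem targetIndex_injective (s : S) :
    Function.Injective (targetIndex s : letterEdges (s, true) F × Fin k → F × Fin k) := by
  rintro ⟨⟨a, ha⟩, i⟩ ⟨⟨b, hb⟩, j⟩ h
  simpa [targetIndex] using h

/-- The parts coming from `φ` agree by translation invariance, and the height grows by one along the
edge. This is the Gram deficit of sources against targets that `le_unitaryHaar_near` requires. -/
theorem inflatedBlock_sourceIndex (s : S) (t : ℝ) (p q : letterEdges (s, true) F × Fin k) :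
    inflatedBlock φ F t (sourceIndex s p) (sourceIndex s q) =
      ((inflatedBlock φ F t).submatrix (targetIndex s) (targetIndex s) -
        ((t ^ 2 : ℝ) : ℂ) • (1 : Matrix (letterEdges (s, true) F × Fin k)
          (letterEdges (s, true) F × Fin k) ℂ)) p q := by
  rw [Matrix.sub_apply, Matrix.smul_apply, submatrix_apply, inflatedBlock, Matrix.add_apply,
    Matrix.add_apply, blockMatrix_sourceIndex, blockMatrix_targetIndex]
  by_cases hpq : p = q
  · subst hpq
    rw [diagonal_apply_eq, diagonal_apply_eq, one_apply_eq]
    simp only [sourceIndex, targetIndex, edgeHeight_letter_mul, smul_eq_mul]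
    push_cast
    ring
  · have h1 : sourceIndex s p ≠ sourceIndex s q := fun h => hpq (by
      obtain ⟨⟨a, ha⟩, i⟩ := p
      obtain ⟨⟨b, hb⟩, j⟩ := q
      simpa [sourceIndex] using h)
    rw [diagonal_apply_ne _ h1, diagonal_apply_ne _ ((targetIndex_injective s).ne hpq),
      one_apply_ne hpq, smul_zero, sub_zero]

/-- Exponential lower bound for the expected volume of the tuples typical for a window
neighbourhood. -/
theorem eventually_le_expectedVolume (hφ : IsPositiveDefinite φ) (hF : IsRooted F)
    (hpos : 0 < gramDet φ F) {c : ℝ} (hc0 : 0 ≤ c)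
    (hc : c * ∏ s : S, gramDet φ (letterEdges (s, true) F) < gramDet φ F) {η : ℝ} (hη : 0 < η) :
    ∀ᶠ n : ℕ in atTop, ENNReal.ofReal c ^ n ≤
      2 * 2 ^ Fintype.card S * expectedVolume n (windowNhd φ F η) := by
  let T : ∀ s : S, ℝ → Matrix (letterEdges (s, true) F × Fin k) (letterEdges (s, true) F × Fin k) ℂ :=
    fun s t => (inflatedBlock φ F t).submatrix (targetIndex s) (targetIndex s)
  have hT : ∀ s t, (T s t).PosDef := fun s t =>
    (posDef_inflatedBlock hφ hpos t).submatrix (targetIndex_injective s)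
  have hTc : ∀ s, Continuous (T s) := fun s => continuous_inflatedBlock.matrix_submatrix _ _
  have hT0 : ∀ s, ‖(T s 0).det‖ = gramDet φ (letterEdges (s, true) F) := fun s => by
    rw [← norm_det_blockMatrix hφ]
    congr 2
    ext p q
    change inflatedBlock φ F 0 (targetIndex s p) (targetIndex s q) = _
    rw [inflatedBlock_zero, blockMatrix_targetIndex]
  obtain ⟨C, hC1, hC⟩ := exists_diag_bound (blockMatrix φ F)
  let m := F.sup FreeGroup.norm
  have hm : ∀ g ∈ F, g.norm ≤ m := fun g hg => Finset.le_sup (f := FreeGroup.norm) hg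
  -- A single small parameter drives all errors: radius `t`, inner radius `(1 - t) * t`, loss factor
  -- `1 + t` per edge probability. At `t = 0` the determinant condition is the hypothesis `hc`.
  obtain ⟨t, ht0, ht1, hdet, hdiag, hclose⟩ : ∃ t : ℝ, 0 < t ∧ t < 1 ∧
      c * ∏ s, ((1 + t) * ‖(T s ((1 - t) * t)).det‖) < ‖(inflatedBlock φ F ((1 - t) * t)).det‖ *
        ∏ s : S, (1 - t) ^ (2 * Fintype.card (letterEdges (s, true) F × Fin k)) ∧
      (∀ p, ‖inflatedBlock φ F ((1 - t) * t) p p‖ + 1 < C ^ 2) ∧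
      ∀ p q, m * t * (2 * C + m * t) +
        ‖inflatedBlock φ F ((1 - t) * t) p q - blockMatrix φ F p q‖ < η := by
    have hu : Continuous fun t : ℝ => (1 - t) * t := by fun_prop
    have hI : Continuous fun t : ℝ => inflatedBlock φ F ((1 - t) * t) :=
      continuous_inflatedBlock.comp hu
    have h1 : ∀ᶠ t : ℝ in 𝓝 0,
        c * ∏ s, ((1 + t) * ‖(T s ((1 - t) * t)).det‖) <
        ‖(inflatedBlock φ F ((1 - t) * t)).det‖ *
          ∏ s : S, (1 - t) ^ (2 * Fintype.card (letterEdges (s, true) F × Fin k)) := by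
      have e1 : Continuous fun t : ℝ => c * ∏ s, ((1 + t) * ‖(T s ((1 - t) * t)).det‖) := by
        refine continuous_const.mul (continuous_finsetProd _ fun s _ => ?_)
        exact (continuous_const.add continuous_id).mul ((hTc s).comp hu).matrix_det.norm
      have e2 : Continuous fun t : ℝ => ‖(inflatedBlock φ F ((1 - t) * t)).det‖ *
          ∏ s : S, (1 - t) ^ (2 * Fintype.card (letterEdges (s, true) F × Fin k)) := by
        refine hI.matrix_det.norm.mul (continuous_finsetProd _ fun s _ => ?_)
        fun_prop
      refine (e1.tendsto 0).eventually_lt (e2.tendsto 0) ?_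
      simp only [add_zero, sub_zero, mul_zero, one_mul, one_pow, Finset.prod_const_one, mul_one,
        hT0, inflatedBlock_zero, norm_det_blockMatrix hφ]
      exact hc
    have h2 : ∀ᶠ t : ℝ in 𝓝 0, ∀ p, ‖inflatedBlock φ F ((1 - t) * t) p p‖ + 1 < C ^ 2 := by
      refine eventually_all.mpr fun p => ?_
      refine ((((hI.matrix_elem p p).norm.add continuous_const).tendsto 0).eventually
        (gt_mem_nhds ?_))
      change ‖inflatedBlock φ F ((1 - 0) * 0) p p‖ + 1 < C ^ 2
      rw [mul_zero, inflatedBlock_zero]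
      linarith [hC p]
    have h3 : ∀ᶠ t : ℝ in 𝓝 0, ∀ p q, m * t * (2 * C + m * t) +
        ‖inflatedBlock φ F ((1 - t) * t) p q - blockMatrix φ F p q‖ < η := by
      refine eventually_all.mpr fun p => eventually_all.mpr fun q => ?_
      have e1 : Continuous fun t : ℝ => m * t * (2 * C + m * t) := by fun_prop
      refine (((e1.add ((hI.matrix_elem p q).sub continuous_const).norm).tendsto 0).eventually
        (gt_mem_nhds ?_))
      change m * 0 * (2 * C + m * 0) +
        ‖inflatedBlock φ F ((1 - 0) * 0) p q - blockMatrix φ F p q‖ < η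
      rw [mul_zero, mul_zero, inflatedBlock_zero]
      simpa using hη
    have h : ∀ᶠ t : ℝ in 𝓝[>] 0, 0 < t ∧ t < 1 ∧
      c * ∏ s, ((1 + t) * ‖(T s ((1 - t) * t)).det‖) < ‖(inflatedBlock φ F ((1 - t) * t)).det‖ *
        ∏ s : S, (1 - t) ^ (2 * Fintype.card (letterEdges (s, true) F × Fin k)) ∧
      (∀ p, ‖inflatedBlock φ F ((1 - t) * t) p p‖ + 1 < C ^ 2) ∧
      ∀ p q, m * t * (2 * C + m * t) +
        ‖inflatedBlock φ F ((1 - t) * t) p q - blockMatrix φ F p q‖ < η := by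
      filter_upwards [self_mem_nhdsWithin, nhdsWithin_le_nhds (gt_mem_nhds one_pos),
        nhdsWithin_le_nhds h1, nhdsWithin_le_nhds h2, nhdsWithin_le_nhds h3] with t a1 a2 a3 a4 a5
      exact ⟨a1, a2, a3, a4, a5⟩
    exact h.exists
  set t' := (1 - t) * t with ht'
  have ht'0 : 0 < t' := mul_pos (by linarith) ht0
  have ht't : t' < t := by nlinarith
  choose ζe hζe hedge using fun s : S => le_unitaryHaar_near (hT s t') ht'0 ht't
    (show 1 < 1 + t by linarith)
  obtain ⟨ζ, hζ0, hζ1, hζ2, hζ3⟩ : ∃ ζ : ℝ, 0 < ζ ∧ ζ ≤ 1 ∧ (∀ s, ζ ≤ ζe s) ∧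
      ∀ p q, m * t * (2 * C + m * t) + ζ +
        ‖inflatedBlock φ F t' p q - blockMatrix φ F p q‖ < η := by
    have h : ∀ᶠ ζ : ℝ in 𝓝[>] 0, 0 < ζ ∧ ζ ≤ 1 ∧ (∀ s, ζ ≤ ζe s) ∧
      ∀ p q, m * t * (2 * C + m * t) + ζ +
        ‖inflatedBlock φ F t' p q - blockMatrix φ F p q‖ < η := by
      filter_upwards [self_mem_nhdsWithin, nhdsWithin_le_nhds (ge_mem_nhds one_pos),
        eventually_all.mpr fun s => nhdsWithin_le_nhds (ge_mem_nhds (hζe s)),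
        eventually_all.mpr fun p => eventually_all.mpr fun q => nhdsWithin_le_nhds
          (gt_mem_nhds (sub_pos.mpr (hclose p q)))] with ζ a1 a2 a3 a4
      exact ⟨a1, a2, a3, fun p q => by linarith [a4 p q]⟩
    exact h.exists
  have hQ := posDef_inflatedBlock hφ hpos t'
  filter_upwards [eventually_all.mpr hedge, eventually_volume_tgram_near_ge hQ hζ0] with n hn hvol
  rw [← volume_gramNear] at hvol
  have h1 := couplingVolume_le_expectedVolume (n := n) (φ := φ) (Q := inflatedBlock φ F t') hF hm
    (by linarith) ht0.le (fun p => by linarith [hdiag p]) hζ3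
  rw [couplingVolume_eq] at h1
  set P : S → (F → Fin k → Fin n → ℂ) → ℝ≥0∞ := fun s X =>
    unitaryHaar n {u | ∀ p, vnorm (edgeTarget s X p - uact u (edgeSource s X) p) ≤ t}
  set B : ℝ≥0∞ := ∏ s, (2 * ENNReal.ofReal ((1 + t) * ‖(T s t').det‖) ^ n)
  set V : ℝ≥0∞ := ∏ s : S, (ENNReal.ofReal t' ^ (2 * n)) ^
    Fintype.card (letterEdges (s, true) F × Fin k)
  have h2 : ∀ X ∈ gramNear n (inflatedBlock φ F t') ζ, V ≤ B * ∏ s, P s X := by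
    intro X hX
    rw [← Finset.prod_mul_distrib]
    refine Finset.prod_le_prod' fun s _ => ?_
    refine hn s _ _ (fun p q => ?_) fun p q => ?_
    · rw [tgram_edgeSource, ← inflatedBlock_sourceIndex]
      exact (hX _ _).trans (hζ2 s)
    · rw [tgram_edgeTarget]
      exact (hX _ _).trans (hζ2 s)
  have hBtop : B ≠ ⊤ := ENNReal.prod_ne_top fun s _ => by finiteness
  have h3 : V * volume (gramNear n (inflatedBlock φ F t') ζ) ≤
      B * (expectedVolume n (windowNhd φ F η) * incrementVolume F k n t) := by
    calc V * volume (gramNear n (inflatedBlock φ F t') ζ)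
        = ∫⁻ _ in gramNear n (inflatedBlock φ F t') ζ, V := (setLIntegral_const _ _).symm
      _ ≤ ∫⁻ X in gramNear n (inflatedBlock φ F t') ζ, B * ∏ s, P s X :=
        setLIntegral_mono' (measurableSet_gramNear _ _) h2
      _ = B * ∫⁻ X in gramNear n (inflatedBlock φ F t') ζ, ∏ s, P s X :=
        lintegral_const_mul' _ _ hBtop
      _ ≤ _ := by gcongr
  set W : ℝ≥0∞ := ∏ s : S, ENNReal.ofReal
    ((1 - t) ^ (2 * Fintype.card (letterEdges (s, true) F × Fin k))) ^ n
  -- The edge probabilities see the inner radius `t'`, while the thickening has radius `t`; `W`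
  -- records the ratio `t' / t = 1 - t`.
  have hV : W * incrementVolume F k n t = V * ballVolume n ^ Fintype.card (F × Fin k) := by
    rw [incrementVolume_eq hF, mul_left_comm, ← Finset.prod_mul_distrib, mul_comm]
    congr 1
    refine Finset.prod_congr rfl fun s _ => ?_
    rw [ht', ENNReal.ofReal_mul (by linarith), ENNReal.ofReal_pow (by linarith)]
    ring
  have hinc0 : incrementVolume F k n t ≠ 0 := by
    unfold incrementVolume
    have h3 : ENNReal.ofReal t ≠ 0 := by simpa using ht0
    exact mul_ne_zero (pow_ne_zero _ (ballVolume_ne_zero n))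
      (pow_ne_zero _ (mul_ne_zero (pow_ne_zero _ h3) (ballVolume_ne_zero n)))
  have h4 : ENNReal.ofReal ‖(inflatedBlock φ F t').det‖ ^ n * W ≤
      2 * B * expectedVolume n (windowNhd φ F η) := by
    rw [← ENNReal.mul_le_mul_iff_left hinc0 (incrementVolume_ne_top t)]
    calc _ = V * (ENNReal.ofReal ‖(inflatedBlock φ F t').det‖ ^ n *
          ballVolume n ^ Fintype.card (F × Fin k)) := by
          rw [mul_assoc, hV]; ring
      _ ≤ V * (2 * volume (gramNear n (inflatedBlock φ F t') ζ)) := by gcongr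
      _ = 2 * (V * volume (gramNear n (inflatedBlock φ F t') ζ)) := by ring
      _ ≤ 2 * (B * (expectedVolume n (windowNhd φ F η) * incrementVolume F k n t)) := by gcongr
      _ = _ := by ring
  let B' : ℝ := ∏ s, ((1 + t) * ‖(T s t').det‖)
  have hB'0 : 0 < B' := Finset.prod_pos fun s _ =>
    mul_pos (by linarith) (norm_pos_iff.mpr (hT s t').det_pos.ne')
  have hB : B = 2 ^ Fintype.card S * ENNReal.ofReal B' ^ n := by
    simp only [B, B', Finset.prod_mul_distrib, Finset.prod_const, Finset.card_univ]
    rw [Finset.prod_pow, ← ENNReal.ofReal_prod_of_nonneg fun s _ =>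
      mul_nonneg (by linarith) (norm_nonneg _)]
    simp only [Finset.prod_mul_distrib, Finset.prod_const, Finset.card_univ]
  have hB0 : ENNReal.ofReal B' ^ n ≠ 0 := pow_ne_zero _ (by simpa using hB'0)
  have hB1 : ENNReal.ofReal B' ^ n ≠ ⊤ := ENNReal.pow_ne_top ENNReal.ofReal_ne_top
  rw [← ENNReal.mul_le_mul_iff_left hB0 hB1]
  calc ENNReal.ofReal c ^ n * ENNReal.ofReal B' ^ n = ENNReal.ofReal (c * B') ^ n := by
        rw [ENNReal.ofReal_mul hc0, mul_pow]
    _ ≤ ENNReal.ofReal (‖(inflatedBlock φ F t').det‖ *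
        ∏ s : S, (1 - t) ^ (2 * Fintype.card (letterEdges (s, true) F × Fin k))) ^ n := by
        gcongr
    _ = ENNReal.ofReal ‖(inflatedBlock φ F t').det‖ ^ n * W := by
        rw [ENNReal.ofReal_mul (norm_nonneg _), ENNReal.ofReal_prod_of_nonneg fun s _ =>
          pow_nonneg (by linarith) _, mul_pow, ← Finset.prod_pow]
    _ ≤ 2 * B * expectedVolume n (windowNhd φ F η) := h4
    _ = _ := by rw [hB]; ring

end LowerBound

/-! ### From volume estimates to the annealed entropy -/

section EntropyBounds

theorem log_div_le_of_le {x : ℝ≥0∞} {n : ℕ} (hn : 0 < n) {c : ℝ}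
    (h : x ≤ ENNReal.ofReal (Real.exp c) ^ n) : ENNReal.log x / (n : EReal) ≤ c := by
  have hn0 : (0 : EReal) < (n : EReal) := by exact_mod_cast hn
  rw [EReal.div_le_iff_le_mul hn0 (EReal.natCast_ne_top n)]
  refine (ENNReal.log_le_log h).trans ?_
  rw [ENNReal.log_pow, ENNReal.log_ofReal_of_pos (Real.exp_pos c), Real.log_exp]

theorem le_log_div_of_le {x : ℝ≥0∞} {n : ℕ} (hn : 0 < n) {c : ℝ}
    (h : ENNReal.ofReal (Real.exp c) ^ n ≤ x) : c ≤ ENNReal.log x / (n : EReal) := by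
  have hn0 : (0 : EReal) < (n : EReal) := by exact_mod_cast hn
  rw [EReal.le_div_iff_mul_le hn0 (EReal.natCast_ne_top n)]
  refine le_trans ?_ (ENNReal.log_le_log h)
  rw [ENNReal.log_pow, ENNReal.log_ofReal_of_pos (Real.exp_pos c), Real.log_exp, mul_comm]

theorem eventually_const_mul_pow_le {K : ℝ≥0∞} (hK : K ≠ ⊤) {b b' : ℝ} (h0 : 0 < b')
    (h : b < b') : ∀ᶠ n : ℕ in atTop, K * ENNReal.ofReal b ^ n ≤ ENNReal.ofReal b' ^ n := by
  have h1 : ENNReal.ofReal (b / b') < 1 := by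
    rw [ENNReal.ofReal_lt_one, div_lt_one h0]
    exact h
  have h2 := ENNReal.Tendsto.const_mul (a := K)
    (ENNReal.tendsto_pow_atTop_nhds_zero_of_lt_one h1) (.inr hK)
  rw [mul_zero] at h2
  filter_upwards [h2.eventually (ge_mem_nhds one_pos)] with n hn
  have h3 : ENNReal.ofReal b = ENNReal.ofReal (b / b') * ENNReal.ofReal b' := by
    rw [← ENNReal.ofReal_mul' h0.le, div_mul_cancel₀ _ h0.ne']
  rw [h3, mul_pow, ← mul_assoc]
  exact mul_le_of_le_one_left' hn

variable {S : Type*} [Fintype S] [DecidableEq S] {k : ℕ} {F : Finset (FreeGroup S)}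
  {φ : FreeGroup S → Matrix (Fin k) (Fin k) ℂ}

/-- Any rooted window gives an upper bound. The condition is stated with exponentials so that
`gramDet φ F = 0` is allowed, which then forces the value `-∞`. -/
theorem annealedEntropy_le (hφ : IsPositiveDefinite φ) (hF : IsRooted F)
    (hpos : ∀ s : S, 0 < gramDet φ (letterEdges (s, true) F)) {c : ℝ}
    (hc : gramDet φ F < Real.exp c * ∏ s : S, gramDet φ (letterEdges (s, true) F)) :
    annealedEntropy φ ≤ c := by
  set D := ∏ s : S, gramDet φ (letterEdges (s, true) F)
  have hD : 0 < D := Finset.prod_pos fun s _ => hpos s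
  obtain ⟨κ, hκ1, a, ha, hκa⟩ : ∃ κ : ℝ, 1 < κ ∧ ∃ a : ℝ, gramDet φ F < a ∧
      (κ ^ 2) ^ Fintype.card S * a < Real.exp c * D := by
    have hcont : Continuous fun t : ℝ =>
        ((1 + t) ^ 2) ^ Fintype.card S * (gramDet φ F + t) := by fun_prop
    have h : ∀ᶠ t : ℝ in 𝓝[>] 0, 0 < t ∧
        ((1 + t) ^ 2) ^ Fintype.card S * (gramDet φ F + t) < Real.exp c * D := by
      filter_upwards [self_mem_nhdsWithin, nhdsWithin_le_nhds
        ((hcont.tendsto' 0 (gramDet φ F) (by simp)).eventually (gt_mem_nhds hc))] with t a1 a2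
      exact ⟨a1, a2⟩
    obtain ⟨t, ht0, ht⟩ := h.exists
    exact ⟨1 + t, by linarith, gramDet φ F + t, by linarith, ht⟩
  obtain ⟨η, hη, hE⟩ := exists_expectedVolume_mul_le hφ hF hpos ha hκ1
  refine iInf_le_of_le (windowNhd φ F η) (iInf_le_of_le (isOpen_windowNhd φ η)
    (iInf_le_of_le (mem_windowNhd_self φ hη) ?_))
  refine limsup_le_of_le (by isBoundedDefault) ?_
  filter_upwards [hE, eventually_gt_atTop 0, eventually_const_mul_pow_le
    (K := 2 ^ Fintype.card S) (by finiteness) (by positivity) hκa] with n hn hn0 hK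
  refine log_div_le_of_le hn0 ?_
  have h0 : ENNReal.ofReal D ^ n ≠ 0 := pow_ne_zero _ (by simpa using hD)
  have h1 : ENNReal.ofReal D ^ n ≠ ⊤ := ENNReal.pow_ne_top ENNReal.ofReal_ne_top
  rw [← ENNReal.mul_le_mul_iff_left h0 h1]
  have h2 : ∏ s : S, ENNReal.ofReal (gramDet φ (letterEdges (s, true) F)) ^ n =
      ENNReal.ofReal D ^ n := by
    rw [Finset.prod_pow, ENNReal.ofReal_prod_of_nonneg fun s _ => (hpos s).le]
  rw [h2] at hn
  refine hn.trans (le_trans (le_of_eq ?_) (hK.trans (le_of_eq ?_)))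
  · rw [ENNReal.ofReal_mul (by positivity), ENNReal.ofReal_pow (sq_nonneg κ)]
    ring
  · rw [ENNReal.ofReal_mul (Real.exp_pos c).le, mul_pow]

theorem le_limsup_windowNhd (hφ : IsPositiveDefinite φ) (hF : IsRooted F)
    (hpos : 0 < gramDet φ F) {c : ℝ}
    (hc : Real.exp c * ∏ s : S, gramDet φ (letterEdges (s, true) F) < gramDet φ F)
    {η : ℝ} (hη : 0 < η) :
    c ≤ limsup (fun n : ℕ => ENNReal.log (expectedVolume n (windowNhd φ F η)) / (n : EReal))
      atTop := by
  -- The strict inequality leaves room for a slightly larger exponent, which absorbs the constant `2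
  -- * 2 ^ |S|` for large `n`.
  obtain ⟨t, ht0, ht⟩ : ∃ t : ℝ, 0 < t ∧
      Real.exp (c + t) * ∏ s : S, gramDet φ (letterEdges (s, true) F) < gramDet φ F := by
    have hcont : Continuous fun t : ℝ =>
        Real.exp (c + t) * ∏ s : S, gramDet φ (letterEdges (s, true) F) := by fun_prop
    have h : ∀ᶠ t : ℝ in 𝓝[>] 0, 0 < t ∧
        Real.exp (c + t) * ∏ s : S, gramDet φ (letterEdges (s, true) F) < gramDet φ F := by
      filter_upwards [self_mem_nhdsWithin, nhdsWithin_le_nhds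
        ((hcont.tendsto 0).eventually (gt_mem_nhds (by simpa using hc)))] with t a1 a2
      exact ⟨a1, a2⟩
    exact h.exists
  refine le_limsup_of_frequently_le (Eventually.frequently ?_) (by isBoundedDefault)
  filter_upwards [eventually_le_expectedVolume hφ hF hpos (Real.exp_pos (c + t)).le ht hη,
    eventually_gt_atTop 0, eventually_const_mul_pow_le (K := 2 * 2 ^ Fintype.card S)
    (by finiteness) (Real.exp_pos (c + t)) (Real.exp_lt_exp.mpr (lt_add_of_pos_right c ht0))]
    with n hn hn0 hK
  refine le_log_div_of_le hn0 ?_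
  have h0 : (2 * 2 ^ Fintype.card S : ℝ≥0∞) ≠ 0 := by positivity
  have h1 : (2 * 2 ^ Fintype.card S : ℝ≥0∞) ≠ ⊤ := by finiteness
  exact (ENNReal.mul_le_mul_iff_right h0 h1).mp (hK.trans hn)

/-- The balls are cofinal among windows: the row of the identity in `φ[B_m]` already contains the
values of `φ` on `B_m`. -/
theorem exists_windowNhd_subset {O : Set (FreeGroup S → Matrix (Fin k) (Fin k) ℂ)}
    (hO : IsOpen O) (hφO : φ ∈ O) :
    ∃ (m : ℕ) (η : ℝ), 0 < η ∧ windowNhd φ (ball m) η ⊆ O := by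
  obtain ⟨I, u, hu, hIu⟩ := isOpen_pi_iff.mp hO φ hφO
  have h1 : ∀ g ∈ I, ∃ δ : ℝ, 0 < δ ∧
      ∀ M : Matrix (Fin k) (Fin k) ℂ, (∀ i j, ‖M i j - φ g i j‖ ≤ δ) → M ∈ u g := fun g hg =>
    exists_entrywise_of_mem_nhds ((hu g hg).1.mem_nhds (hu g hg).2)
  choose! δ hδ hδu using h1
  have h2 : ∀ᶠ η : ℝ in 𝓝[>] 0, 0 < η ∧ ∀ g ∈ I, η ≤ δ g := by
    filter_upwards [self_mem_nhdsWithin, (Finset.eventually_all I).mpr fun g hg =>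
      nhdsWithin_le_nhds (ge_mem_nhds (hδ g hg))] with η a1 a2
    exact ⟨a1, a2⟩
  obtain ⟨η, hη0, hη⟩ := h2.exists
  refine ⟨I.sup FreeGroup.norm, η, hη0, fun ψ hψ => hIu fun g hg => hδu g hg _ fun i j => ?_⟩
  have h3 := hψ (⟨1, mem_ball.mpr (by simp)⟩, i)
    (⟨g, mem_ball.mpr (Finset.le_sup (f := FreeGroup.norm) hg)⟩, j)
  simp only [blockMatrix, Matrix.of_apply, inv_one, one_mul] at h3
  exact h3.le.trans (hη g hg)

theorem le_annealedEntropy (hφ : IsPositiveDefinite φ) (hpos : ∀ F, 0 < gramDet φ F) {c : ℝ}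
    (hc : ∀ m : ℕ, Real.exp c * ∏ s : S, gramDet φ (letterEdges (s, true) (ball m)) <
      gramDet φ (ball m)) :
    c ≤ annealedEntropy φ := by
  refine le_iInf fun O => le_iInf fun hO => le_iInf fun hφO => ?_
  obtain ⟨m, η, hη, hsub⟩ := exists_windowNhd_subset hO hφO
  refine (le_limsup_windowNhd hφ (isRooted_ball m) (hpos _) (hc m) hη).trans ?_
  refine limsup_le_limsup (Eventually.of_forall fun n => ?_) (by isBoundedDefault)
    (by isBoundedDefault)
  refine EReal.div_le_div_right_of_nonneg (by positivity) (ENNReal.log_le_log ?_)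
  refine lintegral_mono fun u => ?_
  gcongr
  exact fun v hv => hsub hv

theorem exp_mul_prod_lt_iff (hpos : ∀ F, 0 < gramDet φ F) (F : Finset (FreeGroup S)) {c : ℝ} :
    Real.exp c * ∏ s : S, gramDet φ (letterEdges (s, true) F) < gramDet φ F ↔
      c < windowRate φ F := by
  have hD : 0 < ∏ s : S, gramDet φ (letterEdges (s, true) F) :=
    Finset.prod_pos fun s _ => hpos _
  rw [← Real.log_lt_log_iff (mul_pos (Real.exp_pos c) hD) (hpos F),
    Real.log_mul (Real.exp_pos c).ne' hD.ne', Real.log_exp, Real.log_prod fun s _ => (hpos _).ne',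
    windowRate, lt_sub_iff_add_lt]
  rfl

theorem lt_exp_mul_prod_iff (hpos : ∀ F, 0 < gramDet φ F) (F : Finset (FreeGroup S)) {c : ℝ} :
    gramDet φ F < Real.exp c * ∏ s : S, gramDet φ (letterEdges (s, true) F) ↔
      windowRate φ F < c := by
  have hD : 0 < ∏ s : S, gramDet φ (letterEdges (s, true) F) :=
    Finset.prod_pos fun s _ => hpos _
  rw [← Real.log_lt_log_iff (hpos F) (mul_pos (Real.exp_pos c) hD),
    Real.log_mul (Real.exp_pos c).ne' hD.ne', Real.log_exp, Real.log_prod fun s _ => (hpos _).ne',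
    windowRate, sub_lt_iff_lt_add]
  rfl

/-- The annealed entropy in the non-singular case. -/
theorem annealedEntropy_eq_iInf (hφ : IsPositiveDefinite φ) (hpos : ∀ F, 0 < gramDet φ F) :
    annealedEntropy φ = ⨅ m : ℕ, (windowRate φ (ball m) : EReal) := by
  refine le_antisymm (le_iInf fun m => ?_) ?_
  · refine EReal.le_of_forall_lt_iff_le.mp fun c hc => annealedEntropy_le hφ (isRooted_ball m)
      (fun s => hpos _) ?_
    exact (lt_exp_mul_prod_iff hpos _).mpr (EReal.coe_lt_coe_iff.mp hc)
  · refine EReal.ge_of_forall_gt_iff_ge.mp fun c hc => le_annealedEntropy hφ hpos fun m => ?_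
    exact (exp_mul_prod_lt_iff hpos _).mpr (EReal.coe_lt_coe_iff.mp (hc.trans_le (iInf_le _ m)))

end EntropyBounds

/-! ### The expansion along the order -/

section Expansion

variable {S : Type*} [Fintype S] [DecidableEq S] {k : ℕ}
  {φ : FreeGroup S → Matrix (Fin k) (Fin k) ℂ}
  {r : S × Bool → S × Bool → Prop} [IsStrictTotalOrder (S × Bool) r]

theorem log_ofReal_sqrt_of_pos {x : ℝ} (hx : 0 < x) :
    ENNReal.log (ENNReal.ofReal √x) = ((Real.log x / 2 : ℝ) : EReal) := by
  rw [ENNReal.log_ofReal_of_pos (Real.sqrt_pos.mpr hx), Real.log_sqrt hx.le]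

theorem sum_coe_ereal {ι : Type*} (s : Finset ι) (f : ι → ℝ) :
    ∑ i ∈ s, (f i : EReal) = ((∑ i ∈ s, f i : ℝ) : EReal) :=
  (map_sum (⟨⟨Real.toEReal, EReal.coe_zero⟩, EReal.coe_add⟩ : ℝ →+ EReal) f s).symm

theorem ball_zero : (ball 0 : Finset (FreeGroup S)) = {1} := by
  ext g
  simp [mem_ball]

theorem sewardTerm_nonneg (hφ : IsPositiveDefinite φ) {g : FreeGroup S} (hg : g ≠ 1) :
    0 ≤ sewardTerm r φ g := by
  have h := condEntropy_predecessors_le (r := r) hφ hg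
  unfold sewardTerm entropyDiff
  split_ifs with hb
  · exact le_top
  · refine (EReal.sub_nonneg (.inr ?_) (.inr hb)).mpr h
    rw [condEntropy_eq]
    exact (ENNReal.log_lt_top_iff.mpr ENNReal.ofReal_lt_top).ne

theorem ne_one_of_mem_sphere_succ {n : ℕ} {g : FreeGroup S} (hg : g ∈ sphere (n + 1)) : g ≠ 1 := by
  rintro rfl
  simp [mem_sphere] at hg

theorem sum_sewardTerm_nonneg (hφ : IsPositiveDefinite φ) (n : ℕ) :
    0 ≤ ∑ g ∈ sphere (n + 1), sewardTerm r φ g :=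
  Finset.sum_nonneg fun _ hg => sewardTerm_nonneg hφ (ne_one_of_mem_sphere_succ hg)

/-- In the extended reals the partial sums of a non-negative series converge to their supremum,
possibly `+∞`. -/
theorem summable_sum_sewardTerm (r : S × Bool → S × Bool → Prop) [IsStrictTotalOrder (S × Bool) r]
    (hφ : IsPositiveDefinite φ) :
    Summable fun n : ℕ => ∑ g ∈ sphere (n + 1), sewardTerm r φ g :=
  (hasSum_of_isLUB_of_nonneg _ (fun n => sum_sewardTerm_nonneg hφ n) (isLUB_iSup)).summable

/-! ### The non-singular case -/

theorem condGramDet_predecessors_pos (hφ : IsPositiveDefinite φ) (hpos : ∀ F, 0 < gramDet φ F)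
    (g : FreeGroup S) : 0 < condGramDet φ {g} (predecessors r g) := by
  have h := gramDet_union hφ (E := {g}) (F := predecessors r g)
    (Finset.disjoint_singleton_left.mpr (notMem_predecessors_self g))
  have h1 := hpos ({g} ∪ predecessors r g)
  rw [h] at h1
  exact pos_of_mul_pos_left h1 (hpos _).le

theorem sewardTerm_eq (hφ : IsPositiveDefinite φ) (hpos : ∀ F, 0 < gramDet φ F) (g : FreeGroup S) :
    sewardTerm r φ g = (((Real.log (condGramDet φ {deleteFirst g} (predecessors r (deleteFirst g))) -
      Real.log (condGramDet φ {g} (predecessors r g))) / 2 : ℝ) : EReal) := by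
  rw [sewardTerm, condEntropy_eq, condEntropy_eq,
    log_ofReal_sqrt_of_pos (condGramDet_predecessors_pos hφ hpos _),
    log_ofReal_sqrt_of_pos (condGramDet_predecessors_pos hφ hpos _), entropyDiff,
    if_neg (EReal.coe_ne_bot _), ← EReal.coe_sub, sub_div]

theorem annealedEntropy_eq_of_pos (r : S × Bool → S × Bool → Prop)
    [IsStrictTotalOrder (S × Bool) r] (hφ : IsPositiveDefinite φ) (hpos : ∀ F, 0 < gramDet φ F) :
    annealedEntropy φ = 2 * entropy φ (ball 0) -
      ∑' n : ℕ, ∑ g ∈ sphere (n + 1), sewardTerm r φ g := by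
  -- By interlacing, `b` decreases to the same infimum as the window rates, while `logGramDet φ {1}
  -- - b N` is a partial sum of the series.
  let b : ℕ → ℝ := fun N => (logGramDet φ (ball (N + 1)) -
    (2 * Fintype.card S - 1) * logGramDet φ (ball N)) / 2
  have hb1 : ∀ N, windowRate φ (ball (N + 1)) ≤ b N := fun N => by
    have := two_mul_windowRate_ball_succ_le hφ hpos N
    simp only [b]
    linarith
  have hb2 : ∀ N, b N ≤ windowRate φ (ball N) := fun N => by
    have := le_two_mul_windowRate_ball hφ hpos N
    simp only [b]
    linarith
  have hanti : Antitone fun N => (b N : EReal) := antitone_nat_of_succ_le fun N =>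
    EReal.coe_le_coe_iff.mpr ((hb2 (N + 1)).trans (hb1 N))
  have hann : annealedEntropy φ = ⨅ N, (b N : EReal) := by
    rw [annealedEntropy_eq_iInf hφ hpos]
    refine le_antisymm (le_iInf fun N => (iInf_le _ (N + 1)).trans ?_)
      (le_iInf fun N => (iInf_le _ N).trans ?_)
    · exact EReal.coe_le_coe_iff.mpr (hb1 N)
    · exact EReal.coe_le_coe_iff.mpr (hb2 N)
  have hlim : Tendsto (fun N => (b N : EReal)) atTop (𝓝 (annealedEntropy φ)) :=
    hann ▸ tendsto_atTop_iInf hanti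
  have hent : 2 * entropy φ (ball 0) = ((logGramDet φ {1} : ℝ) : EReal) := by
    rw [entropy_eq hφ, log_ofReal_sqrt_of_pos (hpos _), ball_zero, logGramDet]
    have h2 : (2 : EReal) = ((2 : ℝ) : EReal) := rfl
    rw [h2, ← EReal.coe_mul, mul_div_cancel₀ _ two_ne_zero]
  have hpart : ∀ N, ∑ n ∈ Finset.range (N + 1), ∑ g ∈ sphere (n + 1), sewardTerm r φ g =
      ((logGramDet φ {1} - b N : ℝ) : EReal) := fun N => by
    have h := sum_range_sphere_condGramDet (r := r) hφ hpos N
    simp only [sewardTerm_eq hφ hpos, sum_coe_ereal]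
    rw [EReal.coe_eq_coe_iff]
    simp only [← Finset.sum_div, h, b]
    ring
  have hsum := ((summable_sum_sewardTerm r hφ).hasSum.tendsto_sum_nat).comp (tendsto_add_atTop_nat 1)
  have hlim2 : Tendsto (fun N => (b N : EReal)) atTop (𝓝 ((logGramDet φ {1} : EReal) -
      ∑' n : ℕ, ∑ g ∈ sphere (n + 1), sewardTerm r φ g)) := by
    have h1 : ∀ N, (b N : EReal) = (logGramDet φ {1} : EReal) +
        -(∑ n ∈ Finset.range (N + 1), ∑ g ∈ sphere (n + 1), sewardTerm r φ g) := fun N => by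
      rw [hpart, ← EReal.coe_neg, ← EReal.coe_add]
      congr 1
      ring
    simp only [h1, sub_eq_add_neg]
    -- Addition is continuous here because the first summand is finite, even when the series
    -- diverges to `+∞`.
    have hc := EReal.continuousAt_add (p := ((logGramDet φ {1} : EReal),
      -∑' n : ℕ, ∑ g ∈ sphere (n + 1), sewardTerm r φ g))
      (.inl (EReal.coe_ne_top _)) (.inl (EReal.coe_ne_bot _))
    exact hc.tendsto.comp (tendsto_const_nhds.prodMk_nhds hsum.neg)
  rw [hent]
  exact tendsto_nhds_unique hlim hlim2

/-! ### The singular case -/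

/-- If no conditional determinant vanished, the product formula would make every ball, hence every
window, nonsingular. Choosing `g` with the fewest predecessors makes all earlier factors positive.
-/
theorem exists_minimal_singular (r : S × Bool → S × Bool → Prop)
    [IsStrictTotalOrder (S × Bool) r] (hφ : IsPositiveDefinite φ) {F : Finset (FreeGroup S)}
    (hF : gramDet φ F = 0) :
    ∃ g : FreeGroup S, condGramDet φ {g} (predecessors r g) = 0 ∧
      0 < gramDet φ (predecessors r g) := by
  have h1 : ∃ g : FreeGroup S, condGramDet φ {g} (predecessors r g) = 0 := by
    by_contra! h
    have h2 : F ⊆ ball (F.sup FreeGroup.norm) := fun g hg =>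
      mem_ball.mpr (Finset.le_sup (f := FreeGroup.norm) hg)
    refine (gramDet_pos_mono hφ h2 ?_).ne' hF
    rw [gramDet_eq_prod (r := r) hφ _ fun g hg => predecessors_subset_ball hg]
    exact Finset.prod_pos fun g _ => (condGramDet_nonneg _ _).lt_of_ne' (h g)
  classical
  let p : ℕ → Prop := fun m => ∃ g : FreeGroup S,
    condGramDet φ {g} (predecessors r g) = 0 ∧ (predecessors r g).card = m
  have hp : ∃ m, p m := h1.imp' (fun g => (predecessors r g).card) fun g hg => ⟨g, hg, rfl⟩
  obtain ⟨g, hg, hgm⟩ := Nat.find_spec hp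
  refine ⟨g, hg, ?_⟩
  rw [gramDet_eq_prod (r := r) hφ _ fun h hh => predecessors_subset (mem_predecessors.mp hh)]
  refine Finset.prod_pos fun h hh => (condGramDet_nonneg _ _).lt_of_ne' fun h0 => ?_
  have h2 := card_predecessors_lt (mem_predecessors.mp hh)
  rw [hgm] at h2
  exact Nat.find_min hp h2 ⟨h, h0, rfl⟩

/-- If the edge window misses `g`, it lies in `predecessors r g`. Otherwise its translate by `a`
does: as `a g` is no longer than `g`, the word `g` begins with the inverse of `a`, while `g = a h`
with `h` no longer than `g` would make it begin with `a`. -/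
theorem gramDet_letterEdges_insert_pos (hφ : IsPositiveDefinite φ) {g : FreeGroup S}
    (hg : 0 < gramDet φ (predecessors r g)) (a : S × Bool) :
    0 < gramDet φ (letterEdges a (insert g (predecessors r g))) := by
  by_cases hmem : g ∈ letterEdges a (insert g (predecessors r g))
  · rw [← gramDet_image_mul_left (letter a)]
    refine gramDet_pos_mono hφ (fun x hx => ?_) hg
    obtain ⟨h, hh, rfl⟩ := Finset.mem_image.mp hx
    rw [mem_letterEdges] at hh hmem
    refine (Finset.mem_insert.mp hh.2).resolve_left fun hag => ?_
    have hne : letter a ≠ 1 := by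
      have h1 := startsWith_letter_mul (a := a) (h := 1) fun hc => hc.ne_one rfl
      rw [mul_one] at h1
      exact h1.ne_one
    have h1 : (letter a * g).norm ≤ g.norm :=
      (mem_predecessors.mp ((Finset.mem_insert.mp hmem.2).resolve_left
        fun e => hne (mul_eq_right.mp e))).norm_le
    have h2 : h.norm ≤ g.norm :=
      (mem_predecessors.mp ((Finset.mem_insert.mp hh.1).resolve_left
        fun e => hne (mul_eq_right.mp (e ▸ hag)))).norm_le
    have h3 : StartsWith (flip a) g := by
      by_contra hc
      rw [norm_letter_mul hc] at h1
      omega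
    have h4 : ¬ StartsWith (flip a) h := fun hc => by
      have h5 := letter_mul_of_startsWith hc
      have h6 := hc.norm_eq
      have h7 := not_startsWith_flip_deleteFirst hc
      rw [← h5, hag, flip_flip] at h7
      rw [← h5, hag] at h6
      omega
    exact flip_ne a (startsWith_unique h3 (hag ▸ startsWith_letter_mul h4))
  · refine gramDet_pos_mono hφ (fun x hx => ?_) hg
    exact (Finset.mem_insert.mp (mem_letterEdges.mp hx).1).resolve_left fun e => hmem (e ▸ hx)

theorem annealedEntropy_eq_of_singular (r : S × Bool → S × Bool → Prop)
    [IsStrictTotalOrder (S × Bool) r] (hφ : IsPositiveDefinite φ) {F : Finset (FreeGroup S)}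
    (hF : gramDet φ F = 0) :
    annealedEntropy φ = 2 * entropy φ (ball 0) -
      ∑' n : ℕ, ∑ g ∈ sphere (n + 1), sewardTerm r φ g := by
  obtain ⟨g, hg, hgpos⟩ := exists_minimal_singular r hφ hF
  have h0 : gramDet φ (insert g (predecessors r g)) = 0 := by
    rw [Finset.insert_eq, gramDet_union hφ
      (Finset.disjoint_singleton_left.mpr (notMem_predecessors_self g)), hg, zero_mul]
  have hl : annealedEntropy φ = ⊥ := by
    -- The window determinant is zero and the edge determinants are positive, so every real number
    -- is an upper bound.
    refine (EReal.eq_bot_iff_forall_lt _).mpr fun c => ?_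
    refine lt_of_le_of_lt (annealedEntropy_le (c := c - 1) hφ (isRooted_insert_predecessors g)
      (fun s => gramDet_letterEdges_insert_pos hφ hgpos _) ?_)
      (EReal.coe_lt_coe_iff.mpr (sub_one_lt c))
    rw [h0]
    exact mul_pos (Real.exp_pos _)
      (Finset.prod_pos fun s _ => gramDet_letterEdges_insert_pos hφ hgpos _)
  rw [hl]
  by_cases hg1 : g = 1
  · subst hg1
    have h1 : entropy φ (ball 0) = ⊥ := by
      rw [predecessors_one] at h0
      rw [entropy_eq hφ, ball_zero, ← insert_empty_eq, h0]
      simp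
    rw [h1, EReal.mul_bot_of_pos two_pos, EReal.bot_sub]
  · obtain ⟨n, hn⟩ : ∃ n, g.norm = n + 1 := ⟨_, norm_deleteFirst hg1⟩
    have h1 : sewardTerm r φ g = ⊤ := by
      rw [sewardTerm, entropyDiff, if_pos]
      rw [condEntropy_eq, hg]
      simp
    have h2 : ∑ h ∈ sphere (n + 1), sewardTerm r φ h = ⊤ := top_le_iff.mp (h1 ▸
      Finset.single_le_sum (f := sewardTerm r φ)
        (fun h hh => sewardTerm_nonneg hφ (ne_one_of_mem_sphere_succ hh)) (mem_sphere.mpr hn))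
    have h3 : ∑' n : ℕ, ∑ g ∈ sphere (n + 1), sewardTerm r φ g = ⊤ := by
      refine top_le_iff.mp (h2 ▸ ?_)
      exact (summable_sum_sewardTerm r hφ).le_tsum n fun m _ => sum_sewardTerm_nonneg hφ m
    rw [h3, EReal.sub_top]

end Expansion

end AnnealedEntropy

end

theorem mainTheorem7 {S : Type*} [Fintype S] [DecidableEq S]
    (r : S × Bool → S × Bool → Prop) [IsStrictTotalOrder (S × Bool) r]
    {k : ℕ} (hk : 0 < k) (φ : FreeGroup S → Matrix (Fin k) (Fin k) ℂ)
    (hφ : AnnealedEntropy.IsPositiveDefinite φ) :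
    (∀ g : FreeGroup S, g ≠ 1 →
      AnnealedEntropy.condEntropy φ {g} (AnnealedEntropy.predecessors r g) ≤
        AnnealedEntropy.condEntropy φ {AnnealedEntropy.deleteFirst g}
          (AnnealedEntropy.predecessors r (AnnealedEntropy.deleteFirst g))) ∧
    (∀ g : FreeGroup S, g ≠ 1 → 0 ≤ AnnealedEntropy.sewardTerm r φ g) ∧
    (Summable fun n : ℕ => ∑ g ∈ AnnealedEntropy.sphere (n + 1), AnnealedEntropy.sewardTerm r φ g) ∧
    AnnealedEntropy.annealedEntropy φ =
      2 * AnnealedEntropy.entropy φ (AnnealedEntropy.ball 0) -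
        ∑' n : ℕ, ∑ g ∈ AnnealedEntropy.sphere (n + 1), AnnealedEntropy.sewardTerm r φ g := by
  refine ⟨fun g hg => AnnealedEntropy.condEntropy_predecessors_le hφ hg,
    fun g hg => AnnealedEntropy.sewardTerm_nonneg hφ hg,
    AnnealedEntropy.summable_sum_sewardTerm r hφ, ?_⟩
  -- If some determinant vanishes, both sides are `-∞`; the limit argument applies only when none
  -- does.
  by_cases hpos : ∀ F, 0 < AnnealedEntropy.gramDet φ F
  · exact AnnealedEntropy.annealedEntropy_eq_of_pos r hφ hpos
  · push Not at hpos
    obtain ⟨F, hF⟩ := hpos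
    exact AnnealedEntropy.annealedEntropy_eq_of_singular r hφ
      (le_antisymm hF (AnnealedEntropy.gramDet_nonneg hφ F))
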